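/- **Model.** A consumer lives for $T$ periods, $1\le T\le\infty$. In period $t$ she privately observes a type $\theta_t\in\{l,h\}$; types follow a Markov chain with initial probabilities $\pi_i>0$ and transition probabilities $\pi_{ij}\ge 0$ that are persistent, $\pi_{ii}>\pi_{ji}$ for $i\ne j$ (so $\pi_{ll}=\pi_{hh}=1$ is allowed). Income $y_t$ lies in a finite set $Y\subset\mathbb R_+$ and has distribution $p_{\theta_t}$, where $p_l(y),p_h(y)>0$ for all $y$ and $\sum_y p_l(y)y<\sum_y p_h(y)y$. A surjective map $\phi:Y\to\Phi$ gives the signal $\phi_t=\phi(y_t)$. Utility $u:\mathbb R_+\to\mathbb R$ is twice continuously differentiable, strictly increasing and strictly concave; $\delta\in(0,1)$ is the common discount factor. A flow contract is $z\in\mathbb R_+^Y$; put $v(z,\theta)=\sum_y p_\theta(y)u(z(y))$ and $\xi(z,\theta)=\sum_y p_\theta(y)(y-z(y))$, and let $z^c$ be the constant contract $c$. A direct mechanism $M=\{z_t\}_{t=1}^T$ assigns a flow contract $z_t(\eta^{t-1},\hat\theta_t)$ to each history $\eta^{t-1}=(\phi^{t-1},\hat\theta^{t-1})$ of signals and reports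 and each current report. A reporting strategy may depend on all past incomes, types and reports and on the current type. $M$ is incentive compatible (IC) if truth-telling maximizes the ex-ante expected discounted utility among all reporting strategies. $V_t(\eta^{t-1},\theta_t)$ is the continuation utility under truth-telling and $\Pi(M)=\mathbb E\sum_t\delta^{t-1}\xi(z_t(\eta^{t-1},\theta_t),\theta_t)$ (sums being taken in the extended reals). $\mathcal V$ is the set of pairs $V=(V_l,V_h)\in\mathbb R^2$ with $V_\theta=V_1(M\mid\theta)$ for some IC mechanism $M$ with $\Pi(M)>-\infty$. For $V\in\mathcal V$ the firm's problem is to maximize $\Pi(M)$ over IC mechanisms with $V_1(M\mid\theta)=V_\theta$, $\theta\in\{l,h\}$. The relaxed problem replaces IC by one-shot incentive compatibility (OSIC): for each $t\le T$ and each $\phi^{t-1}$, after the truthful reports $h^{t-1}$ and the signals $\phi^{t-1}$, a consumer with type $\theta_t=l$ does not gain by reporting $h$ in period $t$ and being truthful afterwards. Put $\ell(y)=p_l(y)/p_h(y)$ and $\ell(\varphi)=\sum_{\phi(y)=\varphi}p_l(y)\big/\sum_{\phi(y)=\varphi}p_h(y)$. A history $(\eta^{t-1},\theta_t)$ is on path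 if its sequence of reports, read as types, has positive probability; if all $\pi_{ij}>0$, every history is on path. $M$ is bounded if $|v(z_t(\eta^{t-1},\hat\theta),\theta)|$ is bounded uniformly in $t,\eta^{t-1},\hat\theta,\theta$. **Theorem.** Let $V\in\mathcal V$. *Existence and uniqueness.* If $T<\infty$ or $u$ is bounded, the relaxed problem has a solution. Whenever it has a solution, the solution is unique: any two solutions specify the same flow contracts at all on-path histories (hence at all histories if all $\pi_{ij}>0$). *Properties.* If $V_h>V_l$, every solution $\{z_t\}$ of the relaxed problem satisfies: (i) all OSIC constraints hold as equalities; (ii) there are $c_t:\Phi^{t-1}\to\mathbb R_+$ such that $z_t(\phi^{t-1},\theta^{t-1},\theta_t)=z^{c_\tau(\phi^{\tau-1})}$ at each on-path history that contains a low report, where $\tau\le t$ is the period of the first low report; and there are $\mu_{t-1}:\Phi^{t-1}\to\mathbb R$, $\lambda_{t-1}:\Phi^{t-1}\to\mathbb R_+$ such that for all $t\le T$ and all $\eta^{t-1}=(\phi^{t-1},h^{t-1})$: (iii) for all $y\in Y$, $\mu_{t-1}(\phi^{t-1})-\lambda_{t-1}(\phi^{t-1})\,\ell(y)\le 1/u'(z_t(y\mid\eta^{t-1},h))$,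 with equality if $z_t(y\mid\eta^{t-1},h)>0$; (iv) $V_t(\eta^{t-1},h)>V_t(\eta^{t-1},l)$, unless both equal the least possible continuation utility $\sum_{s=t}^T\delta^{s-t}u(0)$; (v) if $t\ge2$ and $\varphi,\varphi'\in\Phi$ satisfy $\ell(\varphi')\le\ell(\varphi)$, then $$\pi_{lh}V_t((\phi^{t-2},\varphi',h^{t-1}),h)+\pi_{ll}V_t((\phi^{t-2},\varphi',h^{t-1}),l)\ \ge\ \pi_{lh}V_t((\phi^{t-2},\varphi,h^{t-1}),h)+\pi_{ll}V_t((\phi^{t-2},\varphi,h^{t-1}),l).$$ *Optimality.* If $V_h\ge V_l$ and $M$ is a bounded solution of the relaxed problem, then some solution of the relaxed problem that agrees with $M$ at all on-path histories is incentive compatible and solves the firm's problem; if all $\pi_{ij}>0$, $M$ itself is incentive compatible and solves the firm's problem. -/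

import Mathlib

open Filter Finset
open scoped NNReal

namespace Insurance

/-- The two types of a consumer. -/
inductive Ty
  | l
  | h
  deriving DecidableEq

instance : Fintype Ty := ⟨{Ty.l, Ty.h}, fun x => by cases x <;> decide⟩

/-- Primitives of the dynamic insurance model: `Y` indexes the finitely many income levels,
`Φ` is the finite set of signals. -/
structure Env (Y Φ : Type*) [Fintype Y] [Fintype Φ] where
  /-- number of periods, possibly infinite -/
  T : ℕ∞
  T_pos : 0 < T
  /-- income levels -/
  income : Y → ℝ
  income_nonneg : ∀ y, 0 ≤ income y
  income_injective : Function.Injective income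
  /-- distribution of income of each type -/
  p : Ty → Y → ℝ
  p_pos : ∀ i y, 0 < p i y
  p_sum : ∀ i, ∑ y, p i y = 1
  mean_lt : ∑ y, p Ty.l y * income y < ∑ y, p Ty.h y * income y
  /-- distribution of the initial type -/
  init : Ty → ℝ
  init_pos : ∀ i, 0 < init i
  init_sum : ∑ i, init i = 1
  /-- transition probabilities: `trans i j` is the probability of `j` after `i` -/
  trans : Ty → Ty → ℝ
  trans_nonneg : ∀ i j, 0 ≤ trans i j
  trans_sum : ∀ i, ∑ j, trans i j = 1
  persistent : ∀ i j, i ≠ j → trans j i < trans i i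
  /-- discount factor -/
  δ : ℝ
  δ_pos : 0 < δ
  δ_lt_one : δ < 1
  /-- Bernoulli utility; only its values on `[0, ∞)` matter -/
  u : ℝ → ℝ
  u_contDiff : ContDiffOn ℝ 2 u (Set.Ici 0)
  u_strictConcave : StrictConcaveOn ℝ (Set.Ici 0) u
  u_strictMono : StrictMonoOn u (Set.Ici 0)
  /-- signal function -/
  signal : Y → Φ
  signal_surjective : Function.Surjective signal

/-- Flow contracts: nonnegative final consumption for each income level. -/
abbrev Flow (Y : Type*) := Y → ℝ≥0

/-- Observable histories: the past pairs (signal, report), the most recent one first. -/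
abbrev Hist (Φ : Type*) := List (Φ × Ty)

/-- Private histories: the past triples (income, report, true type), the most recent one first. -/
abbrev PHist (Y : Type*) := List (Y × Ty × Ty)

/-- Direct mechanisms: the flow contract in period `t` is `M η θ`, where `η` is the observable
history of length `t - 1` and `θ` the current report. Only the values at histories of length less
than the horizon are relevant. -/
abbrev Mechanism (Y Φ : Type*) := Hist Φ → Ty → Flow Y

/-- Reporting strategies. -/
abbrev Strategy (Y : Type*) := PHist Y → Ty → Ty

/-- Truth-telling. -/
def truthful {Y : Type*} : Strategy Y := fun _ θ => θ

/-- The full coverage contract with consumption `c`. -/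
def fullCoverage {Y : Type*} (c : ℝ≥0) : Flow Y := fun _ => c

/-- The signals of an observable history. -/
def sigs {Φ : Type*} (η : Hist Φ) : List Φ := η.map Prod.fst

/-- All reports in `η` are high. -/
def AllHigh {Φ : Type*} (η : Hist Φ) : Prop := ∀ x ∈ η, x.2 = Ty.h

/-- The true type was high and was truthfully reported in all past periods. -/
def TrueHigh {Y : Type*} (H : PHist Y) : Prop := ∀ x ∈ H, x.2.1 = Ty.h ∧ x.2.2 = Ty.h

noncomputable section

namespace Env

variable {Y Φ : Type*} [Fintype Y] [Fintype Φ] (E : Env Y Φ)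

/-- Expected flow utility of type `θ` from the flow contract `z`. -/
def v (z : Flow Y) (θ : Ty) : ℝ := ∑ y, E.p θ y * E.u (z y)

/-- Expected flow profit from the flow contract `z` provided to type `θ`. -/
def ξ (z : Flow Y) (θ : Ty) : ℝ := ∑ y, E.p θ y * (E.income y - z y)

/-- Marginal utility (one-sided at zero consumption). -/
def marginal (c : ℝ) : ℝ := derivWithin E.u (Set.Ici 0) c

/-- Likelihood ratio of an income level. -/
def lr (y : Y) : ℝ := E.p Ty.l y / E.p Ty.h y

open Classical in
/-- Likelihood ratio of a signal. -/
def lrSignal (φ : Φ) : ℝ :=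
  (∑ y with E.signal y = φ, E.p Ty.l y) / (∑ y with E.signal y = φ, E.p Ty.h y)

open Classical in
/-- `∑ δ ^ k * f k` over the `k` such that period `s + 1 + k` is at most `T`, as the limit of the
partial sums in the extended reals. (All the sequences `f` below are bounded on one side by a
constant, so that this limit exists.) -/
def discounted (s : ℕ) (f : ℕ → ℝ) : EReal :=
  limsup (fun n : ℕ => ((∑ k ∈ range n,
    if ((s + k : ℕ) : ℕ∞) < E.T then E.δ ^ k * f k else 0 : ℝ) : EReal)) atTop

/-- Expectation of `f` evaluated `k` periods ahead, given the observable history `η` and the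
current type `θ`, if the consumer reports truthfully from now on. -/
def ahead (f : Hist Φ → Ty → ℝ) : ℕ → Hist Φ → Ty → ℝ
  | 0, η, θ => f η θ
  | k + 1, η, θ =>
      ∑ y, E.p θ y * ∑ θ', E.trans θ θ' * ahead f k ((E.signal y, θ) :: η) θ'

/-- The continuation utility `V_t(M ∣ η, θ)` under truth-telling, with `t = η.length + 1`. -/
def V (M : Mechanism Y Φ) (η : Hist Φ) (θ : Ty) : EReal :=
  E.discounted η.length fun k => E.ahead (fun η θ => E.v (M η θ) θ) k η θ

/-- Total discounted expected profits under truth-telling. -/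
def profit (M : Mechanism Y Φ) : EReal :=
  E.discounted 0 fun k => ∑ i, E.init i * E.ahead (fun η θ => E.ξ (M η θ) θ) k [] i

/-- The observable part of a private history. -/
def pub (H : PHist Y) : Hist Φ := H.map fun x => (E.signal x.1, x.2.1)

/-- Expected flow utility `k` periods ahead, given the private history `H` and the current
type `θ`, if the consumer follows the reporting strategy `r` from now on. -/
def strategyFlow (M : Mechanism Y Φ) (r : Strategy Y) : ℕ → PHist Y → Ty → ℝ
  | 0, H, θ => E.v (M (E.pub H) (r H θ)) θ
  | k + 1, H, θ =>
      ∑ y, E.p θ y * ∑ θ', E.trans θ θ' * strategyFlow M r k ((y, r H θ, θ) :: H) θ'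

/-- Continuation utility of the strategy `r` at the private history `H` with current type `θ`. -/
def strategyV (M : Mechanism Y Φ) (r : Strategy Y) (H : PHist Y) (θ : Ty) : EReal :=
  E.discounted H.length fun k => E.strategyFlow M r k H θ

/-- The ex-ante payoff `V₀ʳ(M)` of the strategy `r`. -/
def V₀ (M : Mechanism Y Φ) (r : Strategy Y) : EReal :=
  E.discounted 0 fun k => ∑ i, E.init i * E.strategyFlow M r k [] i

/-- Incentive compatibility. -/
def IC (M : Mechanism Y Φ) : Prop := ∀ r : Strategy Y, E.V₀ M r ≤ E.V₀ M truthful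

open Classical in
/-- The one-shot critical deviation at the signal history `σ`: report `h` when the type is low for
the first time, right after the signals `σ`; otherwise report truthfully. -/
def oscd (σ : List Φ) : Strategy Y := fun H θ =>
  if TrueHigh H ∧ sigs (E.pub H) = σ ∧ θ = Ty.l then Ty.h else θ

/-- One-shot incentive compatibility: no one-shot critical deviation is profitable at the
contingency at which it departs from truth-telling. (If that contingency has positive probability,
this is the same as not being profitable ex ante.) -/
def OSIC (M : Mechanism Y Φ) : Prop :=
  ∀ H : PHist Y, TrueHigh H → (H.length : ℕ∞) < E.T →
    E.strategyV M (E.oscd (sigs (E.pub H))) H Ty.l ≤ E.strategyV M truthful H Ty.l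

/-- All the constraints in `OSIC` hold as equalities. -/
def OSICBinds (M : Mechanism Y Φ) : Prop :=
  ∀ H : PHist Y, TrueHigh H → (H.length : ℕ∞) < E.T →
    E.strategyV M (E.oscd (sigs (E.pub H))) H Ty.l = E.strategyV M truthful H Ty.l

/-- The mechanism delivers the utility `W θ` to each initial type `θ`. -/
def Delivers (W : Ty → ℝ) (M : Mechanism Y Φ) : Prop := ∀ θ, E.V M [] θ = (W θ : EReal)

/-- Feasible utility pairs consistent with finite profits. -/
def feasible : Set (Ty → ℝ) :=
  {W | ∃ M : Mechanism Y Φ, E.IC M ∧ ⊥ < E.profit M ∧ E.Delivers W M}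

/-- `M` solves the firm's profit maximization problem for the utility pair `W`. -/
def SolvesFirm (W : Ty → ℝ) (M : Mechanism Y Φ) : Prop :=
  E.IC M ∧ E.Delivers W M ∧
    ∀ M' : Mechanism Y Φ, E.IC M' → E.Delivers W M' → E.profit M' ≤ E.profit M

/-- `M` solves the relaxed problem for the utility pair `W`. -/
def SolvesRelaxed (W : Ty → ℝ) (M : Mechanism Y Φ) : Prop :=
  E.OSIC M ∧ E.Delivers W M ∧
    ∀ M' : Mechanism Y Φ, E.OSIC M' → E.Delivers W M' → E.profit M' ≤ E.profit M

/-- The types reported in `η`, followed by `θ`, occur with positive probability. If all transition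
probabilities are positive, this is the case for all `η` and `θ`. -/
def OnPath (η : Hist Φ) (θ : Ty) : Prop :=
  List.IsChain (fun new old => 0 < E.trans old new) (θ :: η.map Prod.snd)

/-- Two mechanisms specify the same flow contract at each history of positive probability. -/
def AgreeOnPath (M M' : Mechanism Y Φ) : Prop :=
  ∀ (η : Hist Φ) (θ : Ty), (η.length : ℕ∞) < E.T → E.OnPath η θ → M η θ = M' η θ

/-- No distortions following a low type: there is full coverage from the first low report on, with
a consumption level that depends only on the signals `sigs η₀` before that report. -/
def FullCoverageAfterLow (M : Mechanism Y Φ) : Prop :=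
  ∃ c : List Φ → ℝ≥0, ∀ η₀ : Hist Φ, AllHigh η₀ →
    ((η₀.length : ℕ∞) < E.T → E.OnPath η₀ Ty.l → M η₀ Ty.l = fullCoverage (c (sigs η₀))) ∧
    ∀ (η₁ : Hist Φ) (φ : Φ) (θ : Ty), ((η₁ ++ (φ, Ty.l) :: η₀).length : ℕ∞) < E.T →
      E.OnPath (η₁ ++ (φ, Ty.l) :: η₀) θ →
      M (η₁ ++ (φ, Ty.l) :: η₀) θ = fullCoverage (c (sigs η₀))

/-- The inverse marginal utility condition for flow contracts following high types, with multipliers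
that depend on the past signals. -/
def InverseMarginal (M : Mechanism Y Φ) (μ lam : List Φ → ℝ) : Prop :=
  ∀ η : Hist Φ, AllHigh η → (η.length : ℕ∞) < E.T → ∀ y : Y,
    μ (sigs η) - lam (sigs η) * E.lr y ≤ 1 / E.marginal (M η Ty.h y) ∧
    (0 < M η Ty.h y →
      μ (sigs η) - lam (sigs η) * E.lr y = 1 / E.marginal (M η Ty.h y))

/-- The least continuation utility from period `s + 1` on: consumption zero forever. -/
def leastV (s : ℕ) : EReal := E.discounted s fun _ => E.u 0

/-- Future type reward: high types get a higher continuation utility than low types, except where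
both get the least possible one. -/
def TypeReward (M : Mechanism Y Φ) : Prop :=
  ∀ η : Hist Φ, AllHigh η → (η.length : ℕ∞) < E.T →
    E.V M η Ty.l < E.V M η Ty.h ∨
    (E.V M η Ty.l = E.leastV η.length ∧ E.V M η Ty.h = E.leastV η.length)

/-- Future signal effect: the continuation utility, averaged over next period's type with the
transition probabilities of the low type, is decreasing in the likelihood ratio of the signal. -/
def SignalEffect (M : Mechanism Y Φ) : Prop :=
  ∀ η : Hist Φ, AllHigh η → ((η.length + 1 : ℕ) : ℕ∞) < E.T → ∀ φ φ' : Φ,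
    E.lrSignal φ' ≤ E.lrSignal φ →
    (E.trans Ty.l Ty.h : EReal) * E.V M ((φ, Ty.h) :: η) Ty.h
        + (E.trans Ty.l Ty.l : EReal) * E.V M ((φ, Ty.h) :: η) Ty.l
      ≤ (E.trans Ty.l Ty.h : EReal) * E.V M ((φ', Ty.h) :: η) Ty.h
        + (E.trans Ty.l Ty.l : EReal) * E.V M ((φ', Ty.h) :: η) Ty.l

/-- Bounded mechanisms: flow utilities are uniformly bounded. -/
def Bounded (M : Mechanism Y Φ) : Prop :=
  ∃ B : ℝ, ∀ (η : Hist Φ) (r θ : Ty), (η.length : ℕ∞) < E.T → |E.v (M η r) θ| ≤ B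

end Env

end

end Insurance

open Insurance

/-! Utility is measured in excess of consuming zero forever, so every continuation value is an
expected discounted sum of nonnegative flows in `ℝ≥0∞`. Such a sum, `Proc.tot`, is the least
supersolution of its recursion; comparisons, one-shot deviation arguments and changes of state space
follow from this without convergence questions at an infinite horizon. Profit is a constant minus
`cost`, so the relaxed problem is to minimize `cost` subject to `Feas`.

In utility coordinates the constraints are affine and cost is convex (`mix`). Two optima average to
a feasible mechanism that is cheaper unless they agree on path, which is uniqueness
(`Opt.agreeOnPath`). Constant consumption is the cheapest way to deliver a continuation utility
(`const_le_C`); granting it from the first low report on (`insure`) disturbs no relaxed constraint,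
whence (ii).

The core is a shadow price. If at an all-high history the high type gets more than the low type, she
is not fully insured, since otherwise a low type who always reports high would get as much. Moving
slightly towards full insurance after the high report saves cost but uses up incentive slack. Hence
slack has a value of at least some rate `ρ > 0` (`Opt.slack_value`), and the constraint binds, which
gives (i). So no change that keeps the high type's utility and the later constraints can hurt the
deviating low type to first order while its cost is of smaller order. For (iv), a continuation in
which the low type gets more could be averaged out (`Opt.child_eq`), and one with equal utilities
above the minimum could be separated (`Opt.child_eq_zero`). For (v), continuations after two signals
in the wrong order could be partly swapped (`Opt.signalEffect`). Perturbing a single flow contract,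
with a small Farkas lemma, gives (iii).

For the firm's problem, the insured optimum is incentive compatible: low types are held by the
one-shot constraints, high types by (iv), and after a low report reports do not matter. Conversely,
every incentive compatible mechanism has a relaxed-feasible companion with the same cost
(`exists_feas_of_ic`). Existence is by compactness: a bound on cost bounds consumption at each
on-path history, cost is lower semicontinuous, and utilities are continuous if the horizon is finite
or utility is bounded. -/

open scoped ENNReal

/-! ### Discounted sums of nonnegative flows along Markov processes -/

namespace Insurance

/-- A Markov process with finitely many successors of each state, a clock, a horizon
and a discount factor. -/
structure Proc (S I : Type*) where
  w : S → I → ℝ≥0∞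
  nx : S → I → S
  len : S → ℕ
  T : ℕ∞
  δ : ℝ≥0∞
  len_nx : ∀ s i, len (nx s i) = len s + 1

/-- The present value at date `n` of one unit in each remaining period. -/
noncomputable def annuity (T : ℕ∞) (δ : ℝ≥0∞) (n : ℕ) : ℝ≥0∞ :=
  ∑' k, if ((n + k : ℕ) : ℕ∞) < T then δ ^ k else 0

namespace Proc

variable {S I S' : Type*} [Fintype I] (p : Proc S I) (p' : Proc S' I)

/-- Expectation of `f` one period ahead. -/
noncomputable def step (f : S → ℝ≥0∞) (s : S) : ℝ≥0∞ := ∑ i, p.w s i * f (p.nx s i)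

/-- Expected discounted sum of `f` up to the horizon. -/
noncomputable def tot (f : S → ℝ≥0∞) (s : S) : ℝ≥0∞ :=
  ∑' k, if ((p.len s + k : ℕ) : ℕ∞) < p.T then p.δ ^ k * (p.step^[k] f) s else 0

/-- The clock advances by one per step, so the horizon test for `k + 1` at a state is the test for
`k` at its successors. This turns the tail of the series into a one-step expectation. -/
theorem step_term (f : S → ℝ≥0∞) (s : S) (k : ℕ) :
    (if ((p.len s + (k + 1) : ℕ) : ℕ∞) < p.T then p.δ ^ (k + 1) * (p.step^[k + 1] f) s else 0) =
    p.δ * ∑ i, p.w s i * (if ((p.len (p.nx s i) + k : ℕ) : ℕ∞) < p.T then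
      p.δ ^ k * (p.step^[k] f) (p.nx s i) else 0) := by
  have e : ∀ i, p.len (p.nx s i) + k = p.len s + (k + 1) := fun i => by rw [p.len_nx]; ring
  simp only [e]
  split_ifs
  · rw [Function.iterate_succ_apply', step, Finset.mul_sum, Finset.mul_sum]
    refine Finset.sum_congr rfl fun i _ => ?_
    ring
  · simp

theorem tot_rec (f : S → ℝ≥0∞) (s : S) :
    p.tot f s = if (p.len s : ℕ∞) < p.T then f s + p.δ * p.step (p.tot f) s else 0 := by
  have h1 : p.tot f s = (if (p.len s : ℕ∞) < p.T then f s else 0) + p.δ * p.step (p.tot f) s := by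
    rw [tot, tsum_eq_zero_add' ENNReal.summable]
    congr 1
    · simp
    · simp only [step_term, ENNReal.tsum_mul_left]
      rw [Summable.tsum_finsetSum fun i _ => ENNReal.summable, step]
      simp only [ENNReal.tsum_mul_left, tot]
  split_ifs with h
  · rw [h1, if_pos h]
  · rw [tot]
    refine ENNReal.tsum_eq_zero.2 fun k => if_neg fun hk => h (lt_of_le_of_lt ?_ hk)
    exact_mod_cast Nat.le_add_right _ _

variable {p}

theorem tot_of_lt {f : S → ℝ≥0∞} {s : S} (h : (p.len s : ℕ∞) < p.T) :
    p.tot f s = f s + p.δ * p.step (p.tot f) s := by rw [tot_rec, if_pos h]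

theorem tot_of_not_lt {f : S → ℝ≥0∞} {s : S} (h : ¬ (p.len s : ℕ∞) < p.T) : p.tot f s = 0 := by
  rw [tot_rec, if_neg h]

/-- Only successors of positive weight have to be compared; this is what later allows histories off
path to be ignored. -/
theorem step_mono_at {g g' : S → ℝ≥0∞} {s : S}
    (h : ∀ i, p.w s i ≠ 0 → g (p.nx s i) ≤ g' (p.nx s i)) : p.step g s ≤ p.step g' s := by
  refine Finset.sum_le_sum fun i _ => ?_
  by_cases hi : p.w s i = 0
  · simp [hi]
  · gcongr; exact h i hi

theorem step_congr_at {g g' : S → ℝ≥0∞} {s : S}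
    (h : ∀ i, p.w s i ≠ 0 → g (p.nx s i) = g' (p.nx s i)) : p.step g s = p.step g' s :=
  le_antisymm (step_mono_at fun i hi => (h i hi).le) (step_mono_at fun i hi => (h i hi).ge)

/-- `tot f` is the least supersolution of its recursion, on every invariant set. -/
theorem tot_le_of_super (P : S → Prop) (hP : ∀ s i, P s → p.w s i ≠ 0 → P (p.nx s i))
    {f g : S → ℝ≥0∞}
    (h : ∀ s, P s → (p.len s : ℕ∞) < p.T → f s + p.δ * p.step g s ≤ g s) {s : S} (hs : P s) :
    p.tot f s ≤ g s := by
  refine ENNReal.tsum_le_of_sum_range_le fun n => ?_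
  -- Peeling off the first period leaves the discounted expectation of shorter partial sums at the
  -- successors, to which the induction hypothesis applies.
  induction n generalizing s with
  | zero => simp
  | succ n ih =>
    by_cases hT : (p.len s : ℕ∞) < p.T
    · refine le_trans ?_ (h s hs hT)
      rw [Finset.sum_range_succ']
      simp only [step_term, add_zero, hT, if_true, pow_zero, one_mul, Function.iterate_zero, id]
      rw [add_comm]
      gcongr
      rw [← Finset.mul_sum, Finset.sum_comm, step]
      gcongr with i
      rw [← Finset.mul_sum]
      by_cases hi : p.w s i = 0
      · simp [hi]
      · gcongr
        exact ih (hP s i hs hi)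
    · refine le_trans (le_of_eq ?_) (zero_le)
      refine Finset.sum_eq_zero fun k _ => if_neg fun hk => hT (lt_of_le_of_lt ?_ hk)
      exact_mod_cast Nat.le_add_right _ _

theorem tot_mono_on (P : S → Prop) (hP : ∀ s i, P s → p.w s i ≠ 0 → P (p.nx s i))
    {f g : S → ℝ≥0∞} (h : ∀ s, P s → (p.len s : ℕ∞) < p.T → f s ≤ g s) {s : S} (hs : P s) :
    p.tot f s ≤ p.tot g s := by
  refine tot_le_of_super P hP (fun s hs hT => ?_) hs
  rw [tot_of_lt (f := g) hT]
  gcongr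
  exact h s hs hT

theorem tot_mono {f g : S → ℝ≥0∞} (h : ∀ s, (p.len s : ℕ∞) < p.T → f s ≤ g s) (s : S) :
    p.tot f s ≤ p.tot g s :=
  tot_mono_on (fun _ => True) (by simp) (fun s _ => h s) trivial

theorem tot_congr_on (P : S → Prop) (hP : ∀ s i, P s → p.w s i ≠ 0 → P (p.nx s i))
    {f g : S → ℝ≥0∞} (h : ∀ s, P s → (p.len s : ℕ∞) < p.T → f s = g s) {s : S} (hs : P s) :
    p.tot f s = p.tot g s :=
  le_antisymm (tot_mono_on P hP (fun s h1 h2 => (h s h1 h2).le) hs)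
    (tot_mono_on P hP (fun s h1 h2 => (h s h1 h2).ge) hs)

theorem iterate_step_linear (a b : ℝ≥0∞) (f g : S → ℝ≥0∞) (k : ℕ) :
    p.step^[k] (fun s => a * f s + b * g s) =
      fun s => a * (p.step^[k] f) s + b * (p.step^[k] g) s := by
  induction k with
  | zero => rfl
  | succ k ih =>
    simp only [Function.iterate_succ_apply', ih]
    funext s
    simp only [step, Finset.mul_sum]
    rw [← Finset.sum_add_distrib]
    exact Finset.sum_congr rfl fun i _ => by ring

theorem tot_linear (a b : ℝ≥0∞) (f g : S → ℝ≥0∞) (s : S) :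
    p.tot (fun s => a * f s + b * g s) s = a * p.tot f s + b * p.tot g s := by
  simp only [tot, ← ENNReal.tsum_mul_left]
  rw [← ENNReal.tsum_add]
  refine tsum_congr fun k => ?_
  rw [iterate_step_linear]
  split_ifs
  · ring
  · simp

theorem tot_const (hw : ∀ s, ∑ i, p.w s i = 1) (c : ℝ≥0∞) (s : S) :
    p.tot (fun _ => c) s = c * annuity p.T p.δ (p.len s) := by
  have h : ∀ k, p.step^[k] (fun _ => c) = fun _ => c := by
    intro k
    induction k with
    | zero => rfl
    | succ k ih =>
      rw [Function.iterate_succ_apply', ih]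
      funext s
      rw [step, ← Finset.sum_mul, hw, one_mul]
  rw [tot, annuity, ← ENNReal.tsum_mul_left]
  refine tsum_congr fun k => ?_
  rw [h]
  split_ifs
  · ring
  · simp

/-- Comparison outside of an absorbing set `Z`, given the comparison where it is entered. -/
theorem tot_le_off (Z : Set S) (hZ : ∀ s i, s ∈ Z → p.nx s i ∈ Z) {f f' : S → ℝ≥0∞}
    (hf : ∀ s, s ∉ Z → (p.len s : ℕ∞) < p.T → f' s ≤ f s)
    (he : ∀ s i, s ∉ Z → p.w s i ≠ 0 → p.nx s i ∈ Z → p.tot f' (p.nx s i) ≤ p.tot f (p.nx s i))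
    {s : S} (hs : s ∉ Z) : p.tot f' s ≤ p.tot f s := by
  classical
  -- The function that equals `tot f'` on `Z` and `tot f` off `Z` is a supersolution for `f'`; the
  -- entry condition `he` is what is needed at the border.
  have key : ∀ s, p.tot f' s ≤ if s ∈ Z then p.tot f' s else p.tot f s := by
    intro s
    refine tot_le_of_super (p := p) (fun _ => True) (by simp)
      (g := fun s => if s ∈ Z then p.tot f' s else p.tot f s) (fun s _ hT => ?_) trivial
    by_cases hs : s ∈ Z
    · simp only [hs, if_true]
      rw [tot_of_lt (f := f') hT]
      gcongr
      refine step_mono_at fun i _ => ?_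
      simp [hZ s i hs]
    · simp only [hs, if_false]
      rw [tot_of_lt (f := f) hT]
      refine add_le_add (hf s hs hT) ?_
      gcongr
      refine step_mono_at fun i hi => ?_
      split_ifs with h
      · exact he s i hs hi h
      · rfl
  have := key s
  rwa [if_neg hs] at this

theorem tot_eq_off (Z : Set S) (hZ : ∀ s i, s ∈ Z → p.nx s i ∈ Z) {f f' : S → ℝ≥0∞}
    (hf : ∀ s, s ∉ Z → (p.len s : ℕ∞) < p.T → f' s = f s)
    (he : ∀ s i, s ∉ Z → p.w s i ≠ 0 → p.nx s i ∈ Z → p.tot f' (p.nx s i) = p.tot f (p.nx s i))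
    {s : S} (hs : s ∉ Z) : p.tot f' s = p.tot f s :=
  le_antisymm
    (tot_le_off Z hZ (fun s h1 h2 => (hf s h1 h2).le) (fun s i h1 h2 h3 => (he s i h1 h2 h3).le) hs)
    (tot_le_off Z hZ (fun s h1 h2 => (hf s h1 h2).ge) (fun s i h1 h2 h3 => (he s i h1 h2 h3).ge) hs)

/-- `tot` commutes with homomorphisms of processes. -/
theorem tot_map {p' : Proc S' I} (ψ : S → S') (P : S → Prop)
    (hP : ∀ s i, P s → p.w s i ≠ 0 → P (p.nx s i))
    (hT : p'.T = p.T) (hδ : p'.δ = p.δ) (hlen : ∀ s, P s → p'.len (ψ s) = p.len s)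
    (hw : ∀ s i, P s → p'.w (ψ s) i = p.w s i)
    (hnx : ∀ s i, P s → p.w s i ≠ 0 → p'.nx (ψ s) i = ψ (p.nx s i))
    {f : S → ℝ≥0∞} {f' : S' → ℝ≥0∞}
    (hf : ∀ s, P s → (p.len s : ℕ∞) < p.T → f' (ψ s) = f s) {s : S} (hs : P s) :
    p'.tot f' (ψ s) = p.tot f s := by
  have h : ∀ k s, P s → ((p.len s + k : ℕ) : ℕ∞) < p.T →
      (p'.step^[k] f') (ψ s) = (p.step^[k] f) s := by
    intro k
    induction k with
    | zero => intro s hs hk; exact hf s hs (by simpa using hk)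
    | succ k ih =>
      intro s hs hk
      rw [Function.iterate_succ_apply', Function.iterate_succ_apply', step, step]
      refine Finset.sum_congr rfl fun i _ => ?_
      rw [hw s i hs]
      by_cases hi : p.w s i = 0
      · simp [hi]
      · rw [hnx s i hs hi, ih _ (hP s i hs hi)]
        rw [p.len_nx]
        convert hk using 2
        ring
  rw [tot, tot]
  refine tsum_congr fun k => ?_
  rw [hlen s hs, hT, hδ]
  split_ifs with hk
  · rw [h k s hs hk]
  · rfl

/-- A sum dominated term by term can reach the same finite total only if all terms of positive
weight coincide. Finiteness is handed on to these terms so that the argument can be repeated at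
successors; `a = b = 0` and `d = 1` give plain weighted sums. -/
theorem add_mul_eq_split {ι : Type*} [Fintype ι] {a b d : ℝ≥0∞} {w x y : ι → ℝ≥0∞} (hd : d ≠ 0)
    (hab : a ≤ b) (hxy : ∀ i, x i ≤ y i) (hfin : b + d * ∑ i, w i * y i ≠ ⊤)
    (h : a + d * ∑ i, w i * x i = b + d * ∑ i, w i * y i) :
    a = b ∧ ∀ i, w i ≠ 0 → x i = y i ∧ y i ≠ ⊤ := by
  classical
  have hs : ∑ i, w i * x i ≤ ∑ i, w i * y i := by gcongr with i; exact hxy i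
  rw [ENNReal.add_ne_top] at hfin
  have hfin1 : a ≠ ⊤ := ne_top_of_le_ne_top hfin.1 hab
  have hds : d * ∑ i, w i * x i ≤ d * ∑ i, w i * y i := by gcongr
  have h1 : a = b := by
    by_contra hne
    have := ENNReal.add_lt_add_of_lt_of_le (ne_top_of_le_ne_top hfin.2 hds)
      (lt_of_le_of_ne hab hne) hds
    exact this.ne h
  refine ⟨h1, fun i hi => ?_⟩
  subst h1
  rw [ENNReal.add_right_inj hfin1] at h
  have hwy : w i * y i ≠ ⊤ := by
    intro hc
    refine hfin.2 (ENNReal.mul_eq_top.2 (Or.inl ⟨hd, ?_⟩))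
    exact ENNReal.sum_eq_top.2 ⟨i, mem_univ _, hc⟩
  have hy : y i ≠ ⊤ := fun hc => hwy (by rw [hc]; exact ENNReal.mul_top hi)
  refine ⟨?_, hy⟩
  by_contra hne
  have hlt : x i < y i := lt_of_le_of_ne (hxy i) hne
  have hwi : w i ≠ ⊤ ∨ y i = 0 := by
    by_contra hc
    push Not at hc
    exact hwy (by rw [hc.1]; exact ENNReal.top_mul hc.2)
  have hwi' : w i ≠ ⊤ := hwi.resolve_right (fun h0 => by simp [h0] at hlt)
  have hdt : d ≠ ⊤ := by
    intro hc
    apply hfin.2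
    rw [hc]
    refine ENNReal.top_mul fun h0 => ?_
    rw [Finset.sum_eq_zero_iff] at h0
    have := h0 i (mem_univ _)
    rcases mul_eq_zero.1 this with h2 | h2
    · exact hi h2
    · simp [h2] at hlt
  have hS : ∑ i, w i * y i ≠ ⊤ := fun hc => hfin.2 (by rw [hc]; exact ENNReal.mul_top hd)
  have hlt' : ∑ i, w i * x i < ∑ i, w i * y i := by
    rw [← Finset.add_sum_erase _ _ (mem_univ i), ← Finset.add_sum_erase _ _ (mem_univ i)]
    refine ENNReal.add_lt_add_of_lt_of_le ?_ ((ENNReal.mul_lt_mul_iff_right hi hwi').2 hlt) ?_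
    · refine ne_top_of_le_ne_top hS (le_trans ?_ hs)
      exact Finset.sum_le_sum_of_subset (Finset.erase_subset _ _)
    · gcongr with j; exact hxy j
  exact ((ENNReal.mul_lt_mul_iff_right hd hdt).2 hlt').ne h

/-- If `f' ≤ f` have the same finite total at `s`, then this is inherited by all successors of `s`,
and `f' s = f s`. -/
theorem tot_eq_propagate (hδ : p.δ ≠ 0) {f f' : S → ℝ≥0∞}
    (hf : ∀ s, (p.len s : ℕ∞) < p.T → f' s ≤ f s) {s : S}
    (hT : (p.len s : ℕ∞) < p.T) (heq : p.tot f' s = p.tot f s) (hfin : p.tot f s ≠ ⊤) :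
    f' s = f s ∧ ∀ i, p.w s i ≠ 0 →
      p.tot f' (p.nx s i) = p.tot f (p.nx s i) ∧ p.tot f (p.nx s i) ≠ ⊤ := by
  rw [tot_of_lt hT, tot_of_lt hT] at heq
  rw [tot_of_lt hT] at hfin
  exact add_mul_eq_split hδ (hf s hT) (fun i => tot_mono hf _) hfin heq

end Proc

theorem annuity_rec {T : ℕ∞} {δ : ℝ≥0∞} {n : ℕ} (h : (n : ℕ∞) < T) :
    annuity T δ n = 1 + δ * annuity T δ (n + 1) := by
  rw [annuity, tsum_eq_zero_add' ENNReal.summable, annuity, ← ENNReal.tsum_mul_left]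
  congr 1
  · simp [h]
  · refine tsum_congr fun k => ?_
    have : n + (k + 1) = n + 1 + k := by ring
    rw [this]
    split_ifs
    · ring
    · simp

theorem annuity_ne_top {T : ℕ∞} {δ : ℝ≥0∞} (hδ : δ < 1) (n : ℕ) : annuity T δ n ≠ ⊤ := by
  refine ne_top_of_le_ne_top (b := ∑' k, δ ^ k) ?_ (ENNReal.tsum_le_tsum fun k => ?_)
  · rw [ENNReal.tsum_geometric]
    exact ENNReal.inv_ne_top.2 (tsub_pos_of_lt hδ).ne'
  · split_ifs
    · exact le_rfl
    · exact zero_le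

theorem one_le_annuity {T : ℕ∞} {δ : ℝ≥0∞} {n : ℕ} (h : (n : ℕ∞) < T) : 1 ≤ annuity T δ n := by
  rw [annuity_rec h]; exact le_self_add

end Insurance

/-! ### Payoffs as excess utilities, profit as a constant minus cost -/

namespace Insurance

theorem Ty.sum_eq {R : Type*} [AddCommMonoid R] (f : Ty → R) : ∑ i, f i = f Ty.l + f Ty.h := by
  have : (Finset.univ : Finset Ty) = {Ty.l, Ty.h} := rfl
  rw [this, Finset.sum_pair (by decide)]

noncomputable section

namespace Env

variable {Y Φ : Type*} [Fintype Y] [Fintype Φ] (E : Env Y Φ)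

/-- Income probabilities as extended nonnegative reals. -/
def pe (θ : Ty) (y : Y) : ℝ≥0∞ := ENNReal.ofReal (E.p θ y)

/-- Transition probabilities as extended nonnegative reals. -/
def te (θ θ' : Ty) : ℝ≥0∞ := ENNReal.ofReal (E.trans θ θ')

/-- Initial probabilities as extended nonnegative reals. -/
def ie (θ : Ty) : ℝ≥0∞ := ENNReal.ofReal (E.init θ)

/-- The discount factor as an extended nonnegative real. -/
def de : ℝ≥0∞ := ENNReal.ofReal E.δ

/-- Utility in excess of the utility of zero consumption. -/
def ut (c : ℝ≥0) : ℝ≥0 := (E.u c - E.u 0).toNNReal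

theorem pe_pos (θ : Ty) (y : Y) : 0 < E.pe θ y := ENNReal.ofReal_pos.2 (E.p_pos θ y)

theorem pe_ne_zero (θ : Ty) (y : Y) : E.pe θ y ≠ 0 := (E.pe_pos θ y).ne'

theorem pe_ne_top (θ : Ty) (y : Y) : E.pe θ y ≠ ⊤ := ENNReal.ofReal_ne_top

theorem te_ne_top (θ θ' : Ty) : E.te θ θ' ≠ ⊤ := ENNReal.ofReal_ne_top

theorem de_ne_top : E.de ≠ ⊤ := ENNReal.ofReal_ne_top

theorem de_ne_zero : E.de ≠ 0 := (ENNReal.ofReal_pos.2 E.δ_pos).ne'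

theorem de_lt_one : E.de < 1 := by
  rw [de, ENNReal.ofReal_lt_one]; exact E.δ_lt_one

theorem ie_ne_zero (θ : Ty) : E.ie θ ≠ 0 := (ENNReal.ofReal_pos.2 (E.init_pos θ)).ne'

theorem ie_ne_top (θ : Ty) : E.ie θ ≠ ⊤ := ENNReal.ofReal_ne_top

theorem pe_sum (θ : Ty) : ∑ y, E.pe θ y = 1 := by
  simp only [pe]
  rw [← ENNReal.ofReal_sum_of_nonneg fun y _ => (E.p_pos θ y).le, E.p_sum, ENNReal.ofReal_one]

theorem te_sum (θ : Ty) : ∑ θ', E.te θ θ' = 1 := by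
  simp only [te]
  rw [← ENNReal.ofReal_sum_of_nonneg fun y _ => E.trans_nonneg θ y, E.trans_sum,
    ENNReal.ofReal_one]

theorem te_self_ne_zero (θ : Ty) : E.te θ θ ≠ 0 := by
  have : 0 < E.trans θ θ := by
    cases θ
    · exact lt_of_le_of_lt (E.trans_nonneg _ _) (E.persistent Ty.l Ty.h (by decide))
    · exact lt_of_le_of_lt (E.trans_nonneg _ _) (E.persistent Ty.h Ty.l (by decide))
  exact (ENNReal.ofReal_pos.2 this).ne'

theorem te_ne_zero_iff (θ θ' : Ty) : E.te θ θ' ≠ 0 ↔ 0 < E.trans θ θ' := by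
  rw [← pos_iff_ne_zero, te, ENNReal.ofReal_pos]

theorem T_pos' : ((0 : ℕ) : ℕ∞) < E.T := by exact_mod_cast E.T_pos

/-- The process of observable histories and types, when the report is `ρ θ` for type `θ` and
`n` periods precede the recorded history. -/
@[simps]
def proc (n : ℕ) (ρ : Ty → Ty) : Proc (Hist Φ × Ty) (Y × Ty) where
  w s i := E.pe s.2 i.1 * E.te s.2 i.2
  nx s i := ((E.signal i.1, ρ s.2) :: s.1, i.2)
  len s := n + s.1.length
  T := E.T
  δ := E.de
  len_nx s i := by simp [add_assoc]

/-- The process of private histories and types under a reporting strategy. -/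
@[simps]
def sproc (r : Strategy Y) : Proc (PHist Y × Ty) (Y × Ty) where
  w s i := E.pe s.2 i.1 * E.te s.2 i.2
  nx s i := ((i.1, r s.1 s.2, s.2) :: s.1, i.2)
  len s := s.1.length
  T := E.T
  δ := E.de
  len_nx s i := by simp

/-- Expected value of `f` applied to consumption. -/
def flow (f : ℝ≥0 → ℝ≥0) (ρ : Ty → Ty) (M : Mechanism Y Φ) (s : Hist Φ × Ty) : ℝ≥0∞ :=
  ∑ y, E.pe s.2 y * (f (M s.1 (ρ s.2) y) : ℝ≥0∞)

/-- Expected discounted sum of `f` applied to consumption, under truth-telling. -/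
def J (f : ℝ≥0 → ℝ≥0) (M : Mechanism Y Φ) : Hist Φ × Ty → ℝ≥0∞ :=
  (E.proc 0 id).tot (E.flow f id M)

/-- Continuation utility under truth-telling, in excess of that of zero consumption. -/
abbrev U (M : Mechanism Y Φ) : Hist Φ × Ty → ℝ≥0∞ := E.J E.ut M

/-- Expected discounted consumption under truth-telling. -/
abbrev C (M : Mechanism Y Φ) : Hist Φ × Ty → ℝ≥0∞ := E.J id M

/-- Excess utility when the current report is high, followed by truth-telling. -/
def dev (M : Mechanism Y Φ) (η : Hist Φ) : ℝ≥0∞ :=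
  E.flow E.ut (fun _ => Ty.h) M (η, Ty.l) +
    E.de * (E.proc 0 fun _ => Ty.h).step (E.U M) (η, Ty.l)

/-- Ex-ante expected discounted consumption. -/
def cost (M : Mechanism Y Φ) : ℝ≥0∞ := ∑ i, E.ie i * E.C M ([], i)

/-- Excess utility of a reporting strategy. -/
def SU (M : Mechanism Y Φ) (r : Strategy Y) : PHist Y × Ty → ℝ≥0∞ :=
  (E.sproc r).tot fun s => ∑ y, E.pe s.2 y * (E.ut (M (E.pub s.1) (r s.1 s.2) y) : ℝ≥0∞)

theorem proc_w_sum (n : ℕ) (ρ : Ty → Ty) (s : Hist Φ × Ty) : ∑ i, (E.proc n ρ).w s i = 1 := by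
  simp only [proc_w, Fintype.sum_prod_type, ← Finset.mul_sum, te_sum, mul_one, pe_sum]

theorem ut_coe (c : ℝ≥0) : (E.ut c : ℝ) = E.u c - E.u 0 := by
  refine Real.coe_toNNReal _ (sub_nonneg.2 ?_)
  exact E.u_strictMono.monotoneOn (Set.mem_Ici.2 le_rfl) (Set.mem_Ici.2 c.2) c.2

theorem ut_strictMono : StrictMono E.ut := by
  intro a b hab
  rw [← NNReal.coe_lt_coe, ut_coe, ut_coe]
  have := E.u_strictMono (Set.mem_Ici.2 a.2) (Set.mem_Ici.2 b.2) hab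
  simpa using this

theorem ut_zero : E.ut 0 = 0 := by simp [ut]

theorem ut_continuous : Continuous E.ut := by
  refine continuous_real_toNNReal.comp (Continuous.sub ?_ continuous_const)
  exact E.u_contDiff.continuousOn.comp_continuous NNReal.continuous_coe fun x => x.2

theorem sum_ofReal (θ : Ty) (X : Y → Ty → ℝ) (hX : ∀ y θ', 0 ≤ X y θ') :
    ∑ i : Y × Ty, E.pe θ i.1 * E.te θ i.2 * ENNReal.ofReal (X i.1 i.2) =
      ENNReal.ofReal (∑ y, E.p θ y * ∑ θ', E.trans θ θ' * X y θ') := by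
  rw [Fintype.sum_prod_type, ENNReal.ofReal_sum_of_nonneg]
  · refine Finset.sum_congr rfl fun y _ => ?_
    rw [ENNReal.ofReal_mul (E.p_pos θ y).le, ENNReal.ofReal_sum_of_nonneg, Finset.mul_sum]
    · refine Finset.sum_congr rfl fun θ' _ => ?_
      rw [ENNReal.ofReal_mul (E.trans_nonneg θ θ'), mul_assoc]; rfl
    · exact fun θ' _ => mul_nonneg (E.trans_nonneg θ θ') (hX y θ')
  · exact fun y _ => mul_nonneg (E.p_pos θ y).le
      (Finset.sum_nonneg fun θ' _ => mul_nonneg (E.trans_nonneg θ θ') (hX y θ'))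

theorem sum_affine (θ : Ty) (a e : ℝ) (A X : Y → Ty → ℝ) :
    ∑ y, E.p θ y * ∑ θ', E.trans θ θ' * (a * A y θ' + e * X y θ') =
      a * (∑ y, E.p θ y * ∑ θ', E.trans θ θ' * A y θ')
        + e * ∑ y, E.p θ y * ∑ θ', E.trans θ θ' * X y θ' := by
  simp only [Finset.mul_sum, ← Finset.sum_add_distrib]
  exact Finset.sum_congr rfl fun y _ => Finset.sum_congr rfl fun θ' _ => by ring

theorem sum_const (θ : Ty) (a : ℝ) :
    ∑ y, E.p θ y * ∑ θ', E.trans θ θ' * a = a := by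
  simp only [← Finset.sum_mul, E.trans_sum, one_mul, E.p_sum]

theorem v_eq (z : Flow Y) (θ : Ty) :
    E.v z θ = E.u 0 + ∑ y, E.p θ y * (E.ut (z y) : ℝ) := by
  simp only [v, ut_coe, mul_sub, Finset.sum_sub_distrib, ← Finset.sum_mul, E.p_sum]
  ring

theorem sum_p_ofReal (θ : Ty) (x : Y → ℝ≥0) :
    ∑ y, E.pe θ y * (x y : ℝ≥0∞) = ENNReal.ofReal (∑ y, E.p θ y * (x y : ℝ)) := by
  rw [ENNReal.ofReal_sum_of_nonneg fun y _ => mul_nonneg (E.p_pos θ y).le NNReal.zero_le_coe]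
  refine Finset.sum_congr rfl fun y _ => ?_
  rw [ENNReal.ofReal_mul (E.p_pos θ y).le, ENNReal.ofReal_coe_nnreal]; rfl

theorem ahead_affine (a e : ℝ) (f g : Hist Φ → Ty → ℝ) (k : ℕ) (η : Hist Φ) (θ : Ty) :
    E.ahead (fun η θ => a * f η θ + e * g η θ) k η θ =
      a * E.ahead f k η θ + e * E.ahead g k η θ := by
  induction k generalizing η θ with
  | zero => rfl
  | succ k ih => simp only [ahead, ih, sum_affine]

theorem ahead_const (a : ℝ) (k : ℕ) (η : Hist Φ) (θ : Ty) :
    E.ahead (fun _ _ => a) k η θ = a := by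
  induction k generalizing η θ with
  | zero => rfl
  | succ k ih => simp only [ahead, ih, sum_const]

theorem ahead_mono {f g : Hist Φ → Ty → ℝ} (h : ∀ η θ, f η θ ≤ g η θ) (k : ℕ) (η : Hist Φ)
    (θ : Ty) : E.ahead f k η θ ≤ E.ahead g k η θ := by
  induction k generalizing η θ with
  | zero => exact h η θ
  | succ k ih =>
    simp only [ahead]
    refine Finset.sum_le_sum fun y _ => mul_le_mul_of_nonneg_left
      (Finset.sum_le_sum fun θ' _ => mul_le_mul_of_nonneg_left (ih _ _) (E.trans_nonneg _ _))
      (E.p_pos _ _).le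

theorem ahead_nonneg {f : Hist Φ → Ty → ℝ} (h : ∀ η θ, 0 ≤ f η θ) (k : ℕ) (η : Hist Φ)
    (θ : Ty) : 0 ≤ E.ahead f k η θ := by
  have := E.ahead_mono (f := fun _ _ => 0) h k η θ
  rwa [ahead_const] at this

theorem step_ahead {f : Hist Φ → Ty → ℝ} (h : ∀ η θ, 0 ≤ f η θ) (k : ℕ) (s : Hist Φ × Ty) :
    ((E.proc 0 id).step^[k] fun s => ENNReal.ofReal (f s.1 s.2)) s =
      ENNReal.ofReal (E.ahead f k s.1 s.2) := by
  induction k generalizing s with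
  | zero => rfl
  | succ k ih =>
    rw [Function.iterate_succ_apply', Proc.step]
    simp only [ih, proc_w, proc_nx, id]
    rw [E.sum_ofReal s.2 (fun y θ' => E.ahead f k ((E.signal y, s.2) :: s.1) θ')
      fun y θ' => E.ahead_nonneg h _ _ _]
    rfl

/-- Both claims are proved in one induction because moving `ENNReal.ofReal` through the expectation
requires nonnegative terms. -/
theorem strategyFlow_eq (M : Mechanism Y Φ) (r : Strategy Y) (k : ℕ) (s : PHist Y × Ty) :
    E.u 0 ≤ E.strategyFlow M r k s.1 s.2 ∧
    ((E.sproc r).step^[k] fun s =>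
      ∑ y, E.pe s.2 y * (E.ut (M (E.pub s.1) (r s.1 s.2) y) : ℝ≥0∞)) s =
      ENNReal.ofReal (E.strategyFlow M r k s.1 s.2 - E.u 0) := by
  induction k generalizing s with
  | zero =>
    simp only [strategyFlow, Function.iterate_zero, id, v_eq]
    refine ⟨le_add_of_nonneg_right
      (Finset.sum_nonneg fun y _ => mul_nonneg (E.p_pos _ _).le NNReal.zero_le_coe), ?_⟩
    rw [add_sub_cancel_left, sum_p_ofReal]
  | succ k ih =>
    have h : E.strategyFlow M r (k + 1) s.1 s.2 - E.u 0 = ∑ y, E.p s.2 y *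
        ∑ θ', E.trans s.2 θ' *
          (E.strategyFlow M r k ((y, r s.1 s.2, s.2) :: s.1) θ' - E.u 0) := by
      have h1 := E.sum_affine s.2 1 (-1)
        (fun y θ' => E.strategyFlow M r k ((y, r s.1 s.2, s.2) :: s.1) θ') (fun _ _ => E.u 0)
      rw [E.sum_const] at h1
      simp only [one_mul, neg_mul, ← sub_eq_add_neg] at h1
      rw [h1]
      rfl
    have h0 : ∀ y θ', 0 ≤ E.strategyFlow M r k ((y, r s.1 s.2, s.2) :: s.1) θ' - E.u 0 :=
      fun y θ' => sub_nonneg.2 (ih ((y, r s.1 s.2, s.2) :: s.1, θ')).1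
    constructor
    · rw [← sub_nonneg, h]
      exact Finset.sum_nonneg fun y _ => mul_nonneg (E.p_pos _ _).le
        (Finset.sum_nonneg fun θ' _ => mul_nonneg (E.trans_nonneg _ _) (h0 y θ'))
    · rw [Function.iterate_succ_apply', Proc.step, h]
      simp only [fun s => (ih s).2, sproc_w, sproc_nx]
      exact E.sum_ofReal s.2 (fun y θ' =>
        E.strategyFlow M r k ((y, r s.1 s.2, s.2) :: s.1) θ' - E.u 0) h0

/-- Real discounted sum. -/
def rsum (s : ℕ) (b : ℕ → ℝ) : ℝ :=
  ∑' k, if ((s + k : ℕ) : ℕ∞) < E.T then E.δ ^ k * b k else 0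

theorem summable_disc (s : ℕ) {b : ℕ → ℝ} {B : ℝ} (hb : ∀ k, |b k| ≤ B) :
    Summable fun k => if ((s + k : ℕ) : ℕ∞) < E.T then E.δ ^ k * b k else 0 := by
  refine Summable.of_norm_bounded (g := fun k => E.δ ^ k * B)
    ((summable_geometric_of_lt_one E.δ_pos.le E.δ_lt_one).mul_right B) fun k => ?_
  have hB : 0 ≤ B := (abs_nonneg _).trans (hb k)
  have hδ : 0 ≤ E.δ ^ k := pow_nonneg E.δ_pos.le k
  split_ifs
  · rw [Real.norm_eq_abs, abs_mul, abs_of_nonneg hδ]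
    exact mul_le_mul_of_nonneg_left (hb k) hδ
  · simpa using mul_nonneg hδ hB

theorem tendsto_excess (s : ℕ) (g : ℕ → ℝ) (hg : ∀ k, 0 ≤ g k) :
    Tendsto (fun n : ℕ => ((∑ k ∈ range n,
      if ((s + k : ℕ) : ℕ∞) < E.T then E.δ ^ k * g k else 0 : ℝ) : EReal)) atTop
      (nhds ((∑' k, if ((s + k : ℕ) : ℕ∞) < E.T then E.de ^ k * ENNReal.ofReal (g k) else 0 :
        ℝ≥0∞) : EReal)) := by
  have h := (continuous_coe_ennreal_ereal.tendsto _).comp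
    (ENNReal.tendsto_nat_tsum fun k =>
      if ((s + k : ℕ) : ℕ∞) < E.T then E.de ^ k * ENNReal.ofReal (g k) else 0)
  refine h.congr fun n => ?_
  have h0 : ∀ k, 0 ≤ if ((s + k : ℕ) : ℕ∞) < E.T then E.δ ^ k * g k else 0 := by
    intro k
    split_ifs
    · exact mul_nonneg (pow_nonneg E.δ_pos.le k) (hg k)
    · rfl
  have : ∑ k ∈ range n, (if ((s + k : ℕ) : ℕ∞) < E.T then E.de ^ k * ENNReal.ofReal (g k) else 0)
      = ENNReal.ofReal (∑ k ∈ range n,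
        if ((s + k : ℕ) : ℕ∞) < E.T then E.δ ^ k * g k else 0) := by
    rw [ENNReal.ofReal_sum_of_nonneg fun k _ => h0 k]
    refine Finset.sum_congr rfl fun k _ => ?_
    split_ifs
    · rw [ENNReal.ofReal_mul (pow_nonneg E.δ_pos.le k), ENNReal.ofReal_pow E.δ_pos.le, de]
    · simp
  simp only [Function.comp]
  rw [this, EReal.coe_ennreal_ofReal, max_eq_left (Finset.sum_nonneg fun k _ => h0 k)]

/-- The limsup is a genuine limit: the bounded part converges absolutely, the nonnegative part
converges in `[0, ∞]`, and addition on `EReal` is continuous where one summand is finite. -/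
theorem discounted_add (s : ℕ) {f b g : ℕ → ℝ} {B : ℝ} (hb : ∀ k, |b k| ≤ B)
    (hg : ∀ k, 0 ≤ g k) (hf : ∀ k, f k = b k + g k) :
    E.discounted s f = (E.rsum s b : EReal) +
      ((∑' k, if ((s + k : ℕ) : ℕ∞) < E.T then E.de ^ k * ENNReal.ofReal (g k) else 0 :
        ℝ≥0∞) : EReal) := by
  refine Tendsto.limsup_eq ?_
  have h1 := (continuous_coe_real_ereal.tendsto _).comp
    (E.summable_disc s hb).hasSum.tendsto_sum_nat
  have h2 := (EReal.continuousAt_add (p := ((E.rsum s b : EReal), _))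
    (Or.inl (EReal.coe_ne_top _)) (Or.inl (EReal.coe_ne_bot _))).tendsto.comp
      (h1.prodMk_nhds (E.tendsto_excess s g hg))
  refine h2.congr fun n => ?_
  simp only [Function.comp, ← EReal.coe_add, ← Finset.sum_add_distrib]
  congr 1
  refine Finset.sum_congr rfl fun k _ => ?_
  split_ifs
  · rw [hf]; ring
  · simp

theorem discounted_sub (s : ℕ) {f b g : ℕ → ℝ} {B : ℝ} (hb : ∀ k, |b k| ≤ B)
    (hg : ∀ k, 0 ≤ g k) (hf : ∀ k, f k = b k - g k) :
    E.discounted s f = (E.rsum s b : EReal) -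
      ((∑' k, if ((s + k : ℕ) : ℕ∞) < E.T then E.de ^ k * ENNReal.ofReal (g k) else 0 :
        ℝ≥0∞) : EReal) := by
  refine Tendsto.limsup_eq ?_
  have h1 := (continuous_coe_real_ereal.tendsto _).comp
    (E.summable_disc s hb).hasSum.tendsto_sum_nat
  have h2 := (EReal.continuousAt_add (p := ((E.rsum s b : EReal), _))
    (Or.inl (EReal.coe_ne_top _)) (Or.inl (EReal.coe_ne_bot _))).tendsto.comp
      (h1.prodMk_nhds ((continuous_neg.tendsto _).comp (E.tendsto_excess s g hg)))
  refine h2.congr fun n => ?_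
  simp only [Function.comp, ← EReal.coe_add, ← EReal.coe_neg, ← Finset.sum_neg_distrib,
    ← Finset.sum_add_distrib]
  congr 1
  refine Finset.sum_congr rfl fun k _ => ?_
  split_ifs
  · rw [hf]; ring
  · simp

/-- Least continuation utility, as a real number. -/
def lowest (s : ℕ) : ℝ := E.rsum s fun _ => E.u 0

theorem leastV_eq (s : ℕ) : E.leastV s = (E.lowest s : EReal) := by
  rw [leastV, E.discounted_add s (b := fun _ => E.u 0) (g := fun _ => 0) (B := |E.u 0|)
    (fun _ => le_rfl) (fun _ => le_rfl) (fun _ => by simp)]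
  simp [lowest]

theorem strategyV_eq (M : Mechanism Y Φ) (r : Strategy Y) (H : PHist Y) (θ : Ty) :
    E.strategyV M r H θ = (E.lowest H.length : EReal) + (E.SU M r (H, θ) : EReal) := by
  rw [strategyV, E.discounted_add H.length (b := fun _ => E.u 0)
    (g := fun k => E.strategyFlow M r k H θ - E.u 0) (B := |E.u 0|)
    (fun _ => le_rfl) (fun k => sub_nonneg.2 (E.strategyFlow_eq M r k (H, θ)).1)
    (fun _ => by ring)]
  rw [SU, Proc.tot]
  simp only [fun k => (E.strategyFlow_eq M r k (H, θ)).2]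
  rfl

theorem flow_id_eq (f : ℝ≥0 → ℝ≥0) (M : Mechanism Y Φ) :
    E.flow f id M = fun s =>
      ENNReal.ofReal (∑ y, E.p s.2 y * (f (M s.1 s.2 y) : ℝ)) := by
  funext s
  exact E.sum_p_ofReal s.2 _

theorem sum_p_nonneg (θ : Ty) (x : Y → ℝ≥0) : 0 ≤ ∑ y, E.p θ y * (x y : ℝ) :=
  Finset.sum_nonneg fun y _ => mul_nonneg (E.p_pos θ y).le (x y).2

theorem V_eq (M : Mechanism Y Φ) (η : Hist Φ) (θ : Ty) :
    E.V M η θ = (E.lowest η.length : EReal) + (E.U M (η, θ) : EReal) := by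
  rw [V, E.discounted_add η.length (b := fun _ => E.u 0)
    (g := fun k => E.ahead (fun η θ => ∑ y, E.p θ y * (E.ut (M η θ y) : ℝ)) k η θ)
    (B := |E.u 0|) (fun _ => le_rfl)
    (fun k => E.ahead_nonneg (fun η θ => E.sum_p_nonneg θ _) _ _ _) fun k => ?_]
  · rw [U, J, Proc.tot, flow_id_eq]
    simp only [E.step_ahead (f := fun η θ => ∑ y, E.p θ y * (E.ut (M η θ y) : ℝ))
      fun η θ => E.sum_p_nonneg θ _]
    simp [lowest]
  · have := E.ahead_affine 1 1 (fun _ _ => E.u 0)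
      (fun η θ => ∑ y, E.p θ y * (E.ut (M η θ y) : ℝ)) k η θ
    simp only [ahead_const, one_mul] at this
    simp only [v_eq]
    exact this

theorem V₀_eq (M : Mechanism Y Φ) (r : Strategy Y) :
    E.V₀ M r = (E.lowest 0 : EReal) + ((∑ i, E.ie i * E.SU M r ([], i) : ℝ≥0∞) : EReal) := by
  rw [V₀, E.discounted_add 0 (b := fun _ => E.u 0)
    (g := fun k => ∑ i, E.init i * (E.strategyFlow M r k [] i - E.u 0)) (B := |E.u 0|)
    (fun _ => le_rfl) (fun k => Finset.sum_nonneg fun i _ => mul_nonneg (E.init_pos i).le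
      (sub_nonneg.2 (E.strategyFlow_eq M r k ([], i)).1)) fun k => ?_]
  · congr 3
    simp only [SU, Proc.tot, ← ENNReal.tsum_mul_left]
    rw [← Summable.tsum_finsetSum fun i _ => ENNReal.summable]
    refine tsum_congr fun k => ?_
    simp only [fun k i => (E.strategyFlow_eq M r k ([], i)).2]
    rw [ENNReal.ofReal_sum_of_nonneg fun i _ => mul_nonneg (E.init_pos i).le
      (sub_nonneg.2 (E.strategyFlow_eq M r k ([], i)).1)]
    simp only [sproc_len, List.length_nil, sproc_T, sproc_δ]
    split_ifs
    · rw [Finset.mul_sum]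
      refine Finset.sum_congr rfl fun i _ => ?_
      rw [ENNReal.ofReal_mul (E.init_pos i).le, ie]
      ring
    · simp
  · simp only [mul_sub, Finset.sum_sub_distrib, ← Finset.sum_mul, E.init_sum]
    ring

/-- Expected discounted income. -/
def totalIncome : ℝ := E.rsum 0 fun k => ∑ i, E.init i *
  E.ahead (fun _ θ => ∑ y, E.p θ y * E.income y) k [] i

/-- Income does not depend on the mechanism and has bounded expectation, so its discounted value is
a finite constant. Hence maximizing profit is minimizing the cost of consumption. -/
theorem profit_eq (M : Mechanism Y Φ) :
    E.profit M = (E.totalIncome : EReal) - (E.cost M : EReal) := by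
  have hI : ∀ θ, 0 ≤ ∑ y, E.p θ y * E.income y := fun θ =>
    Finset.sum_nonneg fun y _ => mul_nonneg (E.p_pos θ y).le (E.income_nonneg y)
  have hB : ∀ θ, ∑ y, E.p θ y * E.income y ≤ ∑ i, ∑ y, E.p i y * E.income y := fun θ =>
    Finset.single_le_sum (f := fun i => ∑ y, E.p i y * E.income y) (fun i _ => hI i) (mem_univ θ)
  have h0 : ∀ k i, 0 ≤ E.ahead (fun η θ => ∑ y, E.p θ y * (M η θ y : ℝ)) k [] i :=
    fun k i => E.ahead_nonneg (fun η θ => E.sum_p_nonneg θ _) _ _ _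
  rw [profit, E.discounted_sub 0 (b := fun k => ∑ i, E.init i *
      E.ahead (fun _ θ => ∑ y, E.p θ y * E.income y) k [] i)
    (g := fun k => ∑ i, E.init i *
      E.ahead (fun η θ => ∑ y, E.p θ y * (M η θ y : ℝ)) k [] i)
    (B := ∑ i, ∑ y, E.p i y * E.income y) (fun k => ?_)
    (fun k => Finset.sum_nonneg fun i _ => mul_nonneg (E.init_pos i).le (h0 k i)) fun k => ?_]
  · congr 2
    simp only [cost, C, J, Proc.tot, ← ENNReal.tsum_mul_left]
    rw [← Summable.tsum_finsetSum fun i _ => ENNReal.summable]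
    refine tsum_congr fun k => ?_
    rw [flow_id_eq]
    simp only [id, E.step_ahead (f := fun η θ => ∑ y, E.p θ y * (M η θ y : ℝ))
      fun η θ => E.sum_p_nonneg θ _]
    rw [ENNReal.ofReal_sum_of_nonneg fun i _ => mul_nonneg (E.init_pos i).le (h0 k i)]
    simp only [proc_len, List.length_nil, proc_T, proc_δ, add_zero]
    split_ifs
    · rw [Finset.mul_sum]
      refine Finset.sum_congr rfl fun i _ => ?_
      rw [ENNReal.ofReal_mul (E.init_pos i).le, ie]
      ring
    · simp
  · rw [abs_of_nonneg (Finset.sum_nonneg fun i _ => mul_nonneg (E.init_pos i).le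
      (E.ahead_nonneg (fun η θ => hI θ) _ _ _))]
    have h1 : ∀ i, E.init i * E.ahead (fun _ θ => ∑ y, E.p θ y * E.income y) k [] i ≤
        E.init i * ∑ i, ∑ y, E.p i y * E.income y := fun i => by
      refine mul_le_mul_of_nonneg_left ?_ (E.init_pos i).le
      have := E.ahead_mono (f := fun _ θ => ∑ y, E.p θ y * E.income y)
        (g := fun _ _ => ∑ i, ∑ y, E.p i y * E.income y) (fun _ θ => hB θ) k [] i
      rwa [ahead_const] at this
    refine (Finset.sum_le_sum fun i _ => h1 i).trans ?_
    rw [← Finset.sum_mul, E.init_sum, one_mul]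
  · rw [← Finset.sum_sub_distrib]
    refine Finset.sum_congr rfl fun i _ => ?_
    have := E.ahead_affine 1 (-1) (fun _ θ => ∑ y, E.p θ y * E.income y)
      (fun η θ => ∑ y, E.p θ y * (M η θ y : ℝ)) k [] i
    rw [← mul_sub]
    congr 1
    simp only [one_mul, neg_mul, ← sub_eq_add_neg] at this
    rw [← this]
    congr 1
    funext η θ
    simp only [ξ, mul_sub, Finset.sum_sub_distrib]

theorem coe_add_strictMono (a : ℝ) : StrictMono fun x : EReal => (a : EReal) + x :=
  fun _ _ h => EReal.add_lt_add_left_coe h a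

theorem profit_le_iff {M M' : Mechanism Y Φ} :
    E.profit M' ≤ E.profit M ↔ E.cost M ≤ E.cost M' := by
  rw [profit_eq, profit_eq, sub_eq_add_neg, sub_eq_add_neg,
    (coe_add_strictMono E.totalIncome).le_iff_le, EReal.neg_le_neg_iff,
    EReal.coe_ennreal_le_coe_ennreal_iff]

theorem profit_ne_bot_iff {M : Mechanism Y Φ} : ⊥ < E.profit M ↔ E.cost M ≠ ⊤ := by
  rw [profit_eq, sub_eq_add_neg, bot_lt_iff_ne_bot, ne_eq, EReal.add_eq_bot_iff]
  simp

theorem V_le_iff {M M' : Mechanism Y Φ} {η η' : Hist Φ} {θ θ' : Ty} (h : η.length = η'.length) :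
    E.V M η θ ≤ E.V M' η' θ' ↔ E.U M (η, θ) ≤ E.U M' (η', θ') := by
  rw [V_eq, V_eq, h, (coe_add_strictMono _).le_iff_le, EReal.coe_ennreal_le_coe_ennreal_iff]

theorem V_eq_leastV_iff {M : Mechanism Y Φ} {η : Hist Φ} {θ : Ty} :
    E.V M η θ = E.leastV η.length ↔ E.U M (η, θ) = 0 := by
  rw [V_eq, leastV_eq]
  have := (coe_add_strictMono (E.lowest η.length)).injective.eq_iff
    (a := (E.U M (η, θ) : EReal)) (b := ((0 : ℝ≥0∞) : EReal))
  simp only [EReal.coe_ennreal_zero, add_zero] at this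
  rw [this, EReal.coe_ennreal_eq_zero]

end Env

end

end Insurance

/-! ### The relaxed problem in terms of excess utility and cost -/

namespace Insurance

noncomputable section

namespace Env

variable {Y Φ : Type*} [Fintype Y] [Fintype Φ] (E : Env Y Φ)

theorem pub_cons (x : Y × Ty × Ty) (H : PHist Y) :
    E.pub (x :: H) = (E.signal x.1, x.2.1) :: E.pub H := rfl

theorem pub_length (H : PHist Y) : (E.pub H).length = H.length := by simp [pub]

/-- While reports are truthful, forgetting the private part of the history is a homomorphism onto
the process of public histories. The invariant set `P` admits strategies that are truthful only from
some contingency on. -/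
theorem SU_eq_of_truthful (M : Mechanism Y Φ) (r : Strategy Y) (P : PHist Y × Ty → Prop)
    (hP : ∀ H θ y θ', P (H, θ) → P ((y, θ, θ) :: H, θ')) (hr : ∀ H θ, P (H, θ) → r H θ = θ)
    {H : PHist Y} {θ : Ty} (h : P (H, θ)) : E.SU M r (H, θ) = E.U M (E.pub H, θ) := by
  refine (Proc.tot_map (p := E.sproc r) (p' := E.proc 0 id) (fun s => (E.pub s.1, s.2)) P
    ?_ rfl rfl ?_ ?_ ?_ ?_ h).symm
  · rintro ⟨H, θ⟩ ⟨y, θ'⟩ h _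
    have := hP H θ y θ' h
    simpa [hr H θ h] using this
  · rintro ⟨H, θ⟩ _
    simp [pub_length]
  · rintro ⟨H, θ⟩ i _
    rfl
  · rintro ⟨H, θ⟩ i h _
    simp [pub_cons, hr H θ h]
  · rintro ⟨H, θ⟩ h _
    simp [flow, hr H θ h]

theorem SU_truthful (M : Mechanism Y Φ) (H : PHist Y) (θ : Ty) :
    E.SU M truthful (H, θ) = E.U M (E.pub H, θ) :=
  E.SU_eq_of_truthful M truthful (fun _ => True) (by simp) (fun _ _ _ => rfl) trivial

theorem SU_rec (M : Mechanism Y Φ) (r : Strategy Y) {H : PHist Y} {θ : Ty}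
    (h : (H.length : ℕ∞) < E.T) :
    E.SU M r (H, θ) = ∑ y, E.pe θ y * (E.ut (M (E.pub H) (r H θ) y) : ℝ≥0∞) +
      E.de * ∑ i : Y × Ty, E.pe θ i.1 * E.te θ i.2 *
        E.SU M r ((i.1, r H θ, θ) :: H, i.2) := by
  rw [SU, Proc.tot_of_lt (by exact h)]
  rfl

theorem J_rec (f : ℝ≥0 → ℝ≥0) (M : Mechanism Y Φ) {η : Hist Φ} {θ : Ty}
    (h : (η.length : ℕ∞) < E.T) :
    E.J f M (η, θ) = E.flow f id M (η, θ) +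
      E.de * ∑ i : Y × Ty, E.pe θ i.1 * E.te θ i.2 * E.J f M ((E.signal i.1, θ) :: η, i.2) := by
  rw [J, Proc.tot_of_lt (by simpa using h)]
  rfl

theorem U_rec (M : Mechanism Y Φ) {η : Hist Φ} {θ : Ty} (h : (η.length : ℕ∞) < E.T) :
    E.U M (η, θ) = E.flow E.ut id M (η, θ) +
      E.de * ∑ i : Y × Ty, E.pe θ i.1 * E.te θ i.2 * E.U M ((E.signal i.1, θ) :: η, i.2) :=
  E.J_rec _ _ h

theorem C_rec (M : Mechanism Y Φ) {η : Hist Φ} {θ : Ty} (h : (η.length : ℕ∞) < E.T) :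
    E.C M (η, θ) = E.flow id id M (η, θ) +
      E.de * ∑ i : Y × Ty, E.pe θ i.1 * E.te θ i.2 * E.C M ((E.signal i.1, θ) :: η, i.2) :=
  E.J_rec _ _ h

theorem J_of_not_lt (f : ℝ≥0 → ℝ≥0) (M : Mechanism Y Φ) {η : Hist Φ} {θ : Ty}
    (h : ¬ (η.length : ℕ∞) < E.T) : E.J f M (η, θ) = 0 := by
  rw [J, Proc.tot_of_not_lt (by simpa using h)]

theorem dev_eq (M : Mechanism Y Φ) (η : Hist Φ) :
    E.dev M η = E.flow E.ut (fun _ => Ty.h) M (η, Ty.l) +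
      E.de * ∑ i : Y × Ty, E.pe Ty.l i.1 * E.te Ty.l i.2 *
        E.U M ((E.signal i.1, Ty.h) :: η, i.2) := rfl

theorem oscd_of_not_trueHigh {σ : List Φ} {H : PHist Y} (h : ¬ TrueHigh H) (θ : Ty) :
    E.oscd σ H θ = θ := by simp [oscd, h]

theorem oscd_high {σ : List Φ} (H : PHist Y) : E.oscd σ H Ty.h = Ty.h := by simp [oscd]

theorem not_trueHigh_cons {Y : Type*} (y : Y) (r : Ty) (H : PHist Y) : ¬ TrueHigh ((y, r, Ty.l) :: H) := by
  intro h
  have := (h _ (List.mem_cons_self)).2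
  simp at this

theorem SU_oscd_of_not_trueHigh (M : Mechanism Y Φ) (σ : List Φ) {H : PHist Y} {θ : Ty}
    (h : ¬ TrueHigh H) : E.SU M (E.oscd σ) (H, θ) = E.U M (E.pub H, θ) := by
  refine E.SU_eq_of_truthful M _ (fun s => ¬ TrueHigh s.1) (fun H θ y θ' h hc => h ?_)
    (fun H θ h => E.oscd_of_not_trueHigh h θ) h
  exact fun x hx => hc x (List.mem_cons_of_mem _ hx)

/-- The misreport leaves a true low type in the private history, which is then never `TrueHigh`
again; so the strategy is truthful from the next period on. -/
theorem SU_oscd (M : Mechanism Y Φ) {H : PHist Y} (h : TrueHigh H) (hT : (H.length : ℕ∞) < E.T) :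
    E.SU M (E.oscd (sigs (E.pub H))) (H, Ty.l) = E.dev M (E.pub H) := by
  have hr : E.oscd (sigs (E.pub H)) H Ty.l = Ty.h := by simp [oscd, h]
  rw [SU_rec _ _ _ hT, hr, dev_eq]
  congr 2
  refine Finset.sum_congr rfl fun i _ => ?_
  rw [SU_oscd_of_not_trueHigh _ _ _ (not_trueHigh_cons _ _ _)]
  rfl

theorem allHigh_pub {H : PHist Y} (h : TrueHigh H) : AllHigh (E.pub H) := by
  intro x hx
  obtain ⟨z, hz, rfl⟩ := List.mem_map.1 hx
  exact (h z hz).1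

theorem exists_pub_eq {η : Hist Φ} (h : AllHigh η) : ∃ H : PHist Y, TrueHigh H ∧ E.pub H = η := by
  induction η with
  | nil => exact ⟨[], by simp [TrueHigh], rfl⟩
  | cons x η ih =>
    obtain ⟨H, hH, rfl⟩ := ih fun y hy => h y (List.mem_cons_of_mem _ hy)
    obtain ⟨y, hy⟩ := E.signal_surjective x.1
    refine ⟨(y, Ty.h, Ty.h) :: H, ?_, ?_⟩
    · intro z hz
      rcases List.mem_cons.1 hz with rfl | hz
      · simp
      · exact hH z hz
    · rw [pub_cons, hy, ← h x List.mem_cons_self]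

/-- The constraints of the relaxed problem in terms of excess utilities. -/
structure Feas (w : Ty → ℝ≥0∞) (M : Mechanism Y Φ) : Prop where
  osic : ∀ η : Hist Φ, AllHigh η → (η.length : ℕ∞) < E.T → E.dev M η ≤ E.U M (η, Ty.l)
  delivers : ∀ θ, E.U M ([], θ) = w θ

/-- Solutions of the relaxed problem with finite cost. -/
structure Opt (w : Ty → ℝ≥0∞) (M : Mechanism Y Φ) : Prop where
  feas : E.Feas w M
  le : ∀ M', E.Feas w M' → E.cost M ≤ E.cost M'
  cost_ne_top : E.cost M ≠ ⊤

theorem osic_iff_at {M : Mechanism Y Φ} {H : PHist Y} (h : TrueHigh H)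
    (hT : (H.length : ℕ∞) < E.T) :
    E.strategyV M (E.oscd (sigs (E.pub H))) H Ty.l ≤ E.strategyV M truthful H Ty.l ↔
      E.dev M (E.pub H) ≤ E.U M (E.pub H, Ty.l) := by
  rw [strategyV_eq, strategyV_eq, (coe_add_strictMono _).le_iff_le,
    EReal.coe_ennreal_le_coe_ennreal_iff, SU_truthful, SU_oscd _ _ h hT]

theorem osicBinds_iff_at {M : Mechanism Y Φ} {H : PHist Y} (h : TrueHigh H)
    (hT : (H.length : ℕ∞) < E.T) :
    E.strategyV M (E.oscd (sigs (E.pub H))) H Ty.l = E.strategyV M truthful H Ty.l ↔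
      E.dev M (E.pub H) = E.U M (E.pub H, Ty.l) := by
  rw [strategyV_eq, strategyV_eq, (coe_add_strictMono _).injective.eq_iff,
    EReal.coe_ennreal_eq_coe_ennreal_iff, SU_truthful, SU_oscd _ _ h hT]

theorem osic_iff {M : Mechanism Y Φ} :
    E.OSIC M ↔
      ∀ η : Hist Φ, AllHigh η → (η.length : ℕ∞) < E.T → E.dev M η ≤ E.U M (η, Ty.l) := by
  constructor
  · intro h η hη hT
    obtain ⟨H, hH, rfl⟩ := E.exists_pub_eq hη
    rw [pub_length] at hT
    exact (E.osic_iff_at hH hT).1 (h H hH hT)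
  · intro h H hH hT
    exact (E.osic_iff_at hH hT).2 (h _ (E.allHigh_pub hH) (by rwa [pub_length]))

/-- The utility pair `W` in terms of excess utilities. -/
def excess (W : Ty → ℝ) (θ : Ty) : ℝ≥0∞ := ENNReal.ofReal (W θ - E.lowest 0)

theorem V_nil_eq_iff {W : Ty → ℝ} {M : Mechanism Y Φ} {θ : Ty} (h : E.lowest 0 ≤ W θ) :
    E.V M [] θ = (W θ : EReal) ↔ E.U M ([], θ) = E.excess W θ := by
  have h1 : (W θ : EReal) = (E.lowest 0 : EReal) + (E.excess W θ : EReal) := by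
    rw [excess, EReal.coe_ennreal_ofReal, max_eq_left (sub_nonneg.2 h), ← EReal.coe_add]
    congr 1
    ring
  rw [h1, V_eq, List.length_nil, (coe_add_strictMono _).injective.eq_iff,
    EReal.coe_ennreal_eq_coe_ennreal_iff]

theorem lowest_le_of_delivers {W : Ty → ℝ} {M : Mechanism Y Φ} (h : E.Delivers W M) (θ : Ty) :
    E.lowest 0 ≤ W θ := by
  have := h θ
  rw [V_eq] at this
  rw [← EReal.coe_le_coe_iff, ← this]
  exact le_add_of_nonneg_right (EReal.coe_ennreal_nonneg _)

theorem feas_iff {W : Ty → ℝ} (hW : ∀ θ, E.lowest 0 ≤ W θ) {M : Mechanism Y Φ} :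
    E.Feas (E.excess W) M ↔ E.OSIC M ∧ E.Delivers W M := by
  constructor
  · rintro ⟨h1, h2⟩
    exact ⟨E.osic_iff.2 h1, fun θ => (E.V_nil_eq_iff (hW θ)).2 (h2 θ)⟩
  · rintro ⟨h1, h2⟩
    exact ⟨E.osic_iff.1 h1, fun θ => (E.V_nil_eq_iff (hW θ)).1 (h2 θ)⟩

/-- The competitor in `hfin` ensures that optimality is never a mere tie at infinite cost. -/
theorem solvesRelaxed_iff {W : Ty → ℝ} (hW : ∀ θ, E.lowest 0 ≤ W θ)
    (hfin : ∃ M, E.Feas (E.excess W) M ∧ E.cost M ≠ ⊤) {M : Mechanism Y Φ} :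
    E.SolvesRelaxed W M ↔ E.Opt (E.excess W) M := by
  constructor
  · rintro ⟨h1, h2, h3⟩
    have h : ∀ M', E.Feas (E.excess W) M' → E.cost M ≤ E.cost M' := fun M' hM' =>
      E.profit_le_iff.1 (h3 M' ((E.feas_iff hW).1 hM').1 ((E.feas_iff hW).1 hM').2)
    obtain ⟨M₀, hM₀, hc⟩ := hfin
    exact ⟨(E.feas_iff hW).2 ⟨h1, h2⟩, h, ne_top_of_le_ne_top hc (h M₀ hM₀)⟩
  · rintro ⟨h1, h2, -⟩
    obtain ⟨h3, h4⟩ := (E.feas_iff hW).1 h1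
    exact ⟨h3, h4, fun M' h5 h6 => E.profit_le_iff.2 (h2 M' ((E.feas_iff hW).2 ⟨h5, h6⟩))⟩

theorem excess_ne_top (W : Ty → ℝ) (θ : Ty) : E.excess W θ ≠ ⊤ := ENNReal.ofReal_ne_top

theorem ic_iff {M : Mechanism Y Φ} :
    E.IC M ↔ ∀ r : Strategy Y, ∑ i, E.ie i * E.SU M r ([], i) ≤ ∑ i, E.ie i * E.U M ([], i) := by
  refine forall_congr' fun r => ?_
  rw [V₀_eq, V₀_eq, (coe_add_strictMono _).le_iff_le, EReal.coe_ennreal_le_coe_ennreal_iff]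
  simp only [SU_truthful]
  rfl

end Env

end

end Insurance

/-! ### From incentive compatibility to the relaxed constraints -/

namespace Insurance

theorem AllHigh.cons {Φ : Type*} {η : Hist Φ} (h : AllHigh η) (φ : Φ) :
    AllHigh ((φ, Ty.h) :: η) := by
  intro x hx
  rcases List.mem_cons.1 hx with rfl | hx
  · rfl
  · exact h x hx

theorem AllHigh.of_cons {Φ : Type*} {x : Φ × Ty} {η : Hist Φ} (h : AllHigh (x :: η)) :
    x.2 = Ty.h ∧ AllHigh η :=
  ⟨h x List.mem_cons_self, fun y hy => h y (List.mem_cons_of_mem _ hy)⟩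

theorem allHigh_nil {Φ : Type*} : AllHigh ([] : Hist Φ) := by simp [AllHigh]

/-- All reports are replaced by high ones. -/
def highify {Φ : Type*} (η : Hist Φ) : Hist Φ := η.map fun x => (x.1, Ty.h)

theorem AllHigh.highify_eq {Φ : Type*} {η : Hist Φ} (h : AllHigh η) : highify η = η := by
  refine (List.map_congr_left fun x hx => ?_).trans (List.map_id η)
  rw [← h x hx]
  rfl

theorem AllHigh.eq_of_sigs {Φ : Type*} {η η' : Hist Φ} (h : AllHigh η) (h' : AllHigh η')
    (hs : sigs η = sigs η') : η = η' := by
  have : ∀ η : Hist Φ, highify η = (sigs η).map fun φ => (φ, Ty.h) := by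
    intro η; simp [highify, sigs]
  rw [← h.highify_eq, ← h'.highify_eq, this, this, hs]

/-- The report in the first period. -/
def firstReport {Φ : Type*} (η : Hist Φ) : Option Ty := (η.map Prod.snd).getLast?

theorem firstReport_cons {Φ : Type*} (x : Φ × Ty) (η : Hist Φ) :
    firstReport (x :: η) = some ((firstReport η).getD x.2) := by
  simp [firstReport, List.getLast?_cons]

theorem AllHigh.firstReport {Φ : Type*} {η : Hist Φ} (h : AllHigh η) (hne : η ≠ []) :
    firstReport η = some Ty.h := by
  induction η with
  | nil => exact absurd rfl hne
  | cons x η ih =>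
    rw [firstReport_cons]
    by_cases hη : η = []
    · subst hη; simp [Insurance.firstReport, h.of_cons.1]
    · simp [ih h.of_cons.2 hη]

noncomputable section

/-- The mechanism that treats all reports as high ones if the first report is high. -/
def pretend {Y Φ : Type*} (M : Mechanism Y Φ) : Mechanism Y Φ := fun η θ =>
  if firstReport η = some Ty.h then M (highify η) Ty.h else M η θ

theorem pretend_high {Y Φ : Type*} {M : Mechanism Y Φ} {η : Hist Φ} (hη : AllHigh η) :
    pretend M η Ty.h = M η Ty.h := by
  simp [pretend, hη.highify_eq]

namespace Env

variable {Y Φ : Type*} [Fintype Y] [Fintype Φ] (E : Env Y Φ)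

/-- Excess utility of always reporting a high type. -/
def pret (M : Mechanism Y Φ) : Hist Φ × Ty → ℝ≥0∞ :=
  (E.proc 0 fun _ => Ty.h).tot (E.flow E.ut (fun _ => Ty.h) M)

variable {E}

/-- Truth-telling utility is a supersolution of the recursion in which high is always reported: for
a low type by the one-shot constraint, for a high type because that report is the truth. -/
theorem pret_le {M : Mechanism Y Φ}
    (h : ∀ η : Hist Φ, AllHigh η → (η.length : ℕ∞) < E.T → E.dev M η ≤ E.U M (η, Ty.l))
    {η : Hist Φ} (hη : AllHigh η) (θ : Ty) : E.pret M (η, θ) ≤ E.U M (η, θ) := by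
  refine Proc.tot_le_of_super (p := E.proc 0 fun _ => Ty.h) (fun s => AllHigh s.1)
    (fun s i hs _ => hs.cons _) ?_ (s := (η, θ)) hη
  rintro ⟨η, θ⟩ hη hT
  simp only [proc_len, zero_add, proc_T] at hT
  cases θ
  · exact h η hη hT
  · rw [U_rec _ _ hT]
    exact le_rfl

theorem w_low_eq_zero (h : E.te Ty.h Ty.l = 0) {ρ : Ty → Ty} {n : ℕ} {s : Hist Φ × Ty}
    {i : Y × Ty} (hs : s.2 = Ty.h) (hi : (E.proc n ρ).w s i ≠ 0) : i.2 = Ty.h := by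
  rcases i with ⟨y, θ⟩
  cases θ
  · simp [hs, h] at hi
  · rfl

theorem J_pretend_low (f : ℝ≥0 → ℝ≥0) (M : Mechanism Y Φ) :
    E.J f (pretend M) ([], Ty.l) = E.J f M ([], Ty.l) := by
  refine Proc.tot_congr_on (p := E.proc 0 id)
    (fun s => s = ([], Ty.l) ∨ firstReport s.1 = some Ty.l) ?_ ?_ (Or.inl rfl)
  · rintro s i (rfl | hs) _
    · right; simp [firstReport]
    · right; simp [firstReport_cons, hs]
  · rintro s (rfl | hs) _
    · simp [flow, pretend, firstReport]
    · simp [flow, pretend, hs]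

theorem J_pretend_high (h : E.te Ty.h Ty.l = 0) (f : ℝ≥0 → ℝ≥0) (M : Mechanism Y Φ) :
    E.J f (pretend M) ([], Ty.h) = E.J f M ([], Ty.h) := by
  refine Proc.tot_congr_on (p := E.proc 0 id) (fun s => AllHigh s.1 ∧ s.2 = Ty.h) ?_ ?_
    ⟨allHigh_nil, rfl⟩
  · rintro ⟨η, θ⟩ i ⟨h1, rfl⟩ hi
    exact ⟨h1.cons _, w_low_eq_zero h rfl hi⟩
  · rintro ⟨η, θ⟩ ⟨h1, rfl⟩ _
    simp only [flow, id, pretend_high h1]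

/-- After a high first report, a truthful consumer facing `pretend M` is treated like one who faces
`M` and reports high forever. -/
theorem U_pretend (M : Mechanism Y Φ) {η : Hist Φ} (hη : firstReport η = some Ty.h) (θ : Ty) :
    E.U (pretend M) (η, θ) = E.pret M (highify η, θ) := by
  refine (Proc.tot_map (p := E.proc 0 id) (p' := E.proc 0 fun _ => Ty.h)
    (fun s => (highify s.1, s.2)) (fun s => firstReport s.1 = some Ty.h) ?_ rfl rfl ?_ ?_ ?_ ?_
    (s := (η, θ)) hη).symm
  · intro s i hs _
    simp [firstReport_cons, hs]
  · intro s _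
    simp [highify]
  · intro s i _
    rfl
  · intro s i _ _
    rfl
  · rintro ⟨η, θ⟩ hs _
    change firstReport η = some Ty.h at hs
    simp [flow, pretend, hs]

theorem dev_pretend (M : Mechanism Y Φ) {η : Hist Φ} (hη : AllHigh η)
    (hT : (η.length : ℕ∞) < E.T) : E.dev (pretend M) η = E.pret M (η, Ty.l) := by
  rw [pret, Proc.tot_of_lt (by simpa using hT), dev]
  refine congrArg₂ _ ?_ (congrArg₂ _ rfl ?_)
  · simp only [flow, pretend_high hη]
  · refine Proc.step_congr_at fun i _ => ?_
    have h1 := hη.cons (E.signal i.1)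
    simp only [proc_nx]
    rw [U_pretend _ (h1.firstReport (by simp)), h1.highify_eq]
    rfl

/-- After a high first report the reports no longer matter, so all later constraints are equalities.
Only the initial one remains, and it says that a low type does not gain from always reporting high.
-/
theorem feas_pretend {w : Ty → ℝ≥0∞} {M : Mechanism Y Φ} (h0 : E.te Ty.h Ty.l = 0)
    (hw : ∀ θ, E.U M ([], θ) = w θ) (h : E.pret M ([], Ty.l) ≤ E.U M ([], Ty.l)) :
    E.Feas w (pretend M) := by
  constructor
  · intro η hη hT
    rw [dev_pretend M hη hT]
    by_cases hne : η = []
    · subst hne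
      rwa [U, J_pretend_low]
    · rw [U_pretend M (hη.firstReport hne), hη.highify_eq]
  · intro θ
    rw [← hw]
    cases θ
    · exact J_pretend_low _ _
    · exact J_pretend_high h0 _ _

theorem cost_pretend {M : Mechanism Y Φ} (h0 : E.te Ty.h Ty.l = 0) :
    E.cost (pretend M) = E.cost M := by
  simp only [cost, Ty.sum_eq, C, J_pretend_low, J_pretend_high h0]

theorem pret_high (h : E.te Ty.h Ty.l = 0) (M : Mechanism Y Φ) (η : Hist Φ) :
    E.pret M (η, Ty.h) = E.U M (η, Ty.h) := by
  refine Proc.tot_map (p' := E.proc 0 fun _ => Ty.h) (p := E.proc 0 id) id (fun s => s.2 = Ty.h)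
    ?_ rfl rfl ?_ ?_ ?_ ?_ rfl
  · exact fun s i hs hi => w_low_eq_zero h hs hi
  · exact fun s _ => rfl
  · exact fun s i _ => rfl
  · exact fun s i hs _ => by simp [hs]
  · exact fun s hs _ => by simp [flow, hs]

theorem SU_const_high (M : Mechanism Y Φ) (s : PHist Y × Ty) :
    E.SU M (fun _ _ => Ty.h) s = E.pret M (E.pub s.1, s.2) := by
  refine (Proc.tot_map (p := E.sproc fun _ _ => Ty.h) (p' := E.proc 0 fun _ => Ty.h)
    (fun s => (E.pub s.1, s.2)) (fun _ => True) ?_ rfl rfl ?_ ?_ ?_ ?_ trivial).symm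
  · exact fun _ _ _ _ => trivial
  · exact fun s _ => by simp [pub_length]
  · exact fun s i _ => rfl
  · exact fun s i _ _ => by simp [pub_cons]
  · exact fun s _ _ => rfl

/-- Incentive compatibility is tested against always reporting high. An initially high type never
turns low, so for her this is the truth and her finite terms cancel. -/
theorem pret_nil_le_of_ic {M : Mechanism Y Φ} (h0 : E.te Ty.h Ty.l = 0) (hM : E.IC M)
    (hfin : ∀ θ, E.U M ([], θ) ≠ ⊤) : E.pret M ([], Ty.l) ≤ E.U M ([], Ty.l) := by
  have := E.ic_iff.1 hM fun _ _ => Ty.h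
  simp only [SU_const_high, Ty.sum_eq] at this
  change E.ie Ty.l * E.pret M ([], Ty.l) + E.ie Ty.h * E.pret M ([], Ty.h) ≤ _ at this
  rw [pret_high h0, ENNReal.add_le_add_iff_right
    (ENNReal.mul_ne_top (E.ie_ne_top _) (hfin Ty.h))] at this
  exact (ENNReal.mul_le_mul_iff_right (E.ie_ne_zero _) (E.ie_ne_top _)).1 this

/-- If the deviation does not lose where it is made, its value is a supersolution of the
truth-telling recursion, hence at least as high everywhere. -/
theorem U_le_SU_oscd {M : Mechanism Y Φ} {η : Hist Φ} (hη : AllHigh η)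
    (hd : E.U M (η, Ty.l) ≤ E.dev M η) (H : PHist Y) (θ : Ty) :
    E.U M (E.pub H, θ) ≤ E.SU M (E.oscd (sigs η)) (H, θ) := by
  rw [← SU_truthful]
  refine Proc.tot_le_of_super (p := E.sproc truthful) (fun _ => True) (by simp)
    (g := E.SU M (E.oscd (sigs η))) ?_ (s := (H, θ)) trivial
  rintro ⟨H, θ⟩ _ hT
  replace hT : (H.length : ℕ∞) < E.T := hT
  by_cases hc : TrueHigh H ∧ sigs (E.pub H) = sigs η ∧ θ = Ty.l
  · obtain ⟨h1, h2, rfl⟩ := hc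
    rw [← h2, SU_oscd _ _ h1 hT, (E.allHigh_pub h1).eq_of_sigs hη h2]
    refine le_trans (le_of_eq ?_) hd
    rw [← (E.allHigh_pub h1).eq_of_sigs hη h2, U_rec _ _ (by rwa [pub_length])]
    refine congrArg₂ _ rfl (congrArg₂ _ rfl ?_)
    refine Finset.sum_congr rfl fun i _ => congrArg₂ _ rfl ?_
    exact SU_oscd_of_not_trueHigh _ _ _ (not_trueHigh_cons _ _ _)
  · have hr : E.oscd (sigs η) H θ = θ := by simp [oscd, hc]
    rw [SU_rec _ _ _ hT, hr]
    exact le_rfl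

/-- A deviation that paid strictly at some history would be weakly better everywhere, while
incentive compatibility makes it equal to the truth at the start. Equality spreads along events of
positive probability, and these lead to the low type at that history because high types may turn
low. -/
theorem osic_of_ic {M : Mechanism Y Φ} (h0 : E.te Ty.h Ty.l ≠ 0) (hM : E.IC M)
    (hfin : ∀ θ, E.U M ([], θ) ≠ ⊤) (η : Hist Φ) (hη : AllHigh η)
    (hT : (η.length : ℕ∞) < E.T) : E.dev M η ≤ E.U M (η, Ty.l) := by
  by_contra hd
  push Not at hd
  obtain ⟨H, hH, rfl⟩ := E.exists_pub_eq hη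
  rw [pub_length] at hT
  set σ := sigs (E.pub H) with hσ
  have hge := U_le_SU_oscd hη hd.le
  -- Histories list the latest event first, so suffixes of `H` are its initial segments in time.
  have key : ∀ K : PHist Y, K <:+ H → ∀ θ,
      E.U M (E.pub K, θ) = E.SU M (E.oscd σ) (K, θ) ∧ E.SU M (E.oscd σ) (K, θ) ≠ ⊤ := by
    intro K
    induction K with
    | nil =>
      intro _
      have h1 := E.ic_iff.1 hM (E.oscd σ)
      have h2 : ∀ i, E.ie i * E.U M ([], i) ≤ E.ie i * E.SU M (E.oscd σ) ([], i) := fun i => by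
        gcongr; exact hge [] i
      have h3 : ∑ i, E.ie i * E.U M ([], i) ≠ ⊤ :=
        ENNReal.sum_ne_top.2 fun i _ => ENNReal.mul_ne_top (E.ie_ne_top i) (hfin i)
      have h4 := le_antisymm (Finset.sum_le_sum fun i _ => h2 i) h1
      intro θ
      have h5 := Proc.add_mul_eq_split (a := 0) (b := 0) (d := 1) (w := E.ie)
        (x := fun i => E.U M ([], i)) (y := fun i => E.SU M (E.oscd σ) ([], i)) one_ne_zero le_rfl
        (fun i => hge [] i) (by simpa using ne_top_of_le_ne_top h3 h1) (by simpa using h4)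
      exact h5.2 θ (E.ie_ne_zero θ)
    | cons x K ih =>
      intro hs θ
      have hK : K <:+ H := (List.suffix_cons x K).trans hs
      obtain ⟨h1, h2⟩ := ih hK Ty.h
      have hlen : ((E.pub K).length : ℕ∞) < E.T := by
        rw [pub_length]
        exact lt_of_le_of_lt (by exact_mod_cast hK.length_le) hT
      have hx := hH x (hs.subset List.mem_cons_self)
      obtain ⟨y, r, t⟩ := x
      obtain ⟨rfl, rfl⟩ := hx
      rw [U_rec _ _ hlen, SU_rec _ _ _ (by rwa [← E.pub_length]), oscd_high] at h1
      rw [SU_rec _ _ _ (by rwa [← E.pub_length]), oscd_high] at h2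
      have h3 := Proc.add_mul_eq_split (w := fun i : Y × Ty => E.pe Ty.h i.1 * E.te Ty.h i.2)
        (x := fun i => E.U M (E.pub ((i.1, Ty.h, Ty.h) :: K), i.2))
        (y := fun i => E.SU M (E.oscd σ) ((i.1, Ty.h, Ty.h) :: K, i.2)) E.de_ne_zero
        le_rfl (fun i => hge ((i.1, Ty.h, Ty.h) :: K) i.2) h2 h1
      refine h3.2 (y, θ) (mul_ne_zero (E.pe_ne_zero _ _) ?_)
      cases θ
      · exact h0
      · exact E.te_self_ne_zero _
  have := (key H List.suffix_rfl Ty.l).1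
  rw [SU_oscd _ _ hH hT] at this
  exact hd.ne this

/-- If high types never turn low, ex-ante incentive compatibility is silent about low types after
high reports, and `M` may violate the one-shot constraints there. `pretend` repairs this without
changing initial utilities or cost. -/
theorem exists_feas_of_ic {w : Ty → ℝ≥0∞} (hw : ∀ θ, w θ ≠ ⊤) {M : Mechanism Y Φ} (hM : E.IC M)
    (hU : ∀ θ, E.U M ([], θ) = w θ) : ∃ M', E.Feas w M' ∧ E.cost M' = E.cost M := by
  have hfin : ∀ θ, E.U M ([], θ) ≠ ⊤ := fun θ => by rw [hU]; exact hw θ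
  by_cases h0 : E.te Ty.h Ty.l = 0
  · exact ⟨pretend M, feas_pretend h0 hU (pret_nil_le_of_ic h0 hM hfin), cost_pretend h0⟩
  · exact ⟨M, ⟨osic_of_ic h0 hM hfin, hU⟩, rfl⟩

end Env

end

end Insurance

/-! ### Concavity: mixtures of mechanisms and the marginal cost of utility -/

namespace Insurance

noncomputable section

namespace Env

variable {Y Φ : Type*} [Fintype Y] [Fintype Φ] (E : Env Y Φ)

theorem exists_ut_eq {v c₀ : ℝ≥0} (h : v ≤ E.ut c₀) : ∃ c ≤ c₀, E.ut c = v := by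
  obtain ⟨c, hc, rfl⟩ := intermediate_value_Icc (zero_le (a := c₀)) E.ut_continuous.continuousOn
    ⟨by rw [ut_zero]; exact zero_le, h⟩
  exact ⟨c, hc.2, rfl⟩

theorem ut_concave {a b : ℝ≥0} (hab : a + b = 1) (x y : ℝ≥0) :
    a * E.ut x + b * E.ut y ≤ E.ut (a * x + b * y) := by
  have h := E.u_strictConcave.concaveOn.2 (Set.mem_Ici.2 x.2) (Set.mem_Ici.2 y.2) a.2 b.2
    (NNReal.coe_inj.2 hab)
  rw [← NNReal.coe_le_coe]
  push_cast [ut_coe]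
  have h1 : (a : ℝ) + b = 1 := by exact_mod_cast hab
  simp only [smul_eq_mul, NNReal.val_eq_coe] at h
  have : (a : ℝ) * (E.u x - E.u 0) + b * (E.u y - E.u 0) =
    a * E.u x + b * E.u y - (a + b) * E.u 0 := by ring
  rw [this, h1]
  linarith

theorem ut_strictConcave {a b : ℝ≥0} (hab : a + b = 1) (ha : a ≠ 0) (hb : b ≠ 0) {x y : ℝ≥0}
    (hxy : x ≠ y) : a * E.ut x + b * E.ut y < E.ut (a * x + b * y) := by
  have h := E.u_strictConcave.2 (Set.mem_Ici.2 x.2) (Set.mem_Ici.2 y.2)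
    (fun h => hxy (NNReal.coe_injective h))
    (NNReal.coe_pos.2 (pos_iff_ne_zero.2 ha)) (NNReal.coe_pos.2 (pos_iff_ne_zero.2 hb))
    (by exact_mod_cast hab)
  rw [← NNReal.coe_lt_coe]
  push_cast [ut_coe]
  have h1 : (a : ℝ) + b = 1 := by exact_mod_cast hab
  simp only [smul_eq_mul, NNReal.val_eq_coe] at h
  have : (a : ℝ) * (E.u x - E.u 0) + b * (E.u y - E.u 0) =
    a * E.u x + b * E.u y - (a + b) * E.u 0 := by ring
  rw [this, h1]
  linarith

theorem exists_comb {a b : ℝ≥0} (hab : a + b = 1) (x y : ℝ≥0) :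
    ∃ c, E.ut c = a * E.ut x + b * E.ut y ∧ c ≤ a * x + b * y := by
  obtain ⟨c, h1, h2⟩ := E.exists_ut_eq (E.ut_concave hab x y)
  exact ⟨c, h2, h1⟩

open Classical in
/-- Consumption whose utility is the average of the utilities of `x` and `y`. -/
def comb (a b x y : ℝ≥0) : ℝ≥0 :=
  if h : a + b = 1 then (E.exists_comb h x y).choose else 0

theorem ut_comb {a b : ℝ≥0} (hab : a + b = 1) (x y : ℝ≥0) :
    E.ut (E.comb a b x y) = a * E.ut x + b * E.ut y := by
  rw [comb, dif_pos hab]; exact (E.exists_comb hab x y).choose_spec.1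

theorem comb_le {a b : ℝ≥0} (hab : a + b = 1) (x y : ℝ≥0) :
    E.comb a b x y ≤ a * x + b * y := by
  rw [comb, dif_pos hab]; exact (E.exists_comb hab x y).choose_spec.2

theorem comb_self {a b : ℝ≥0} (hab : a + b = 1) (x : ℝ≥0) : E.comb a b x x = x := by
  apply E.ut_strictMono.injective
  rw [ut_comb _ hab, ← add_mul, hab, one_mul]

theorem eq_of_comb_eq {a b : ℝ≥0} (hab : a + b = 1) (ha : a ≠ 0) (hb : b ≠ 0) {x y : ℝ≥0}
    (h : E.comb a b x y = a * x + b * y) : x = y := by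
  by_contra hxy
  have := E.ut_strictConcave hab ha hb hxy
  rw [← h, ut_comb _ hab] at this
  exact this.false

theorem eq_of_comb_eq_left {a b : ℝ≥0} (hab : a + b = 1) (hb : b ≠ 0) {x y : ℝ≥0}
    (h : E.comb a b x y = x) : x = y := by
  apply E.ut_strictMono.injective
  have h1 := E.ut_comb hab x y
  rw [h] at h1
  have h2 : a * E.ut x + b * E.ut x = E.ut x := by rw [← add_mul, hab, one_mul]
  exact mul_left_cancel₀ hb (add_left_cancel (h2.trans h1))

/-- The mechanism whose flow utilities are averages of those of `M` and `N`. -/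
def mix (a b : ℝ≥0) (M N : Mechanism Y Φ) : Mechanism Y Φ :=
  fun η θ y => E.comb a b (M η θ y) (N η θ y)

variable {E}

theorem flow_ut_mix {a b : ℝ≥0} (hab : a + b = 1) (ρ : Ty → Ty) (M N : Mechanism Y Φ)
    (s : Hist Φ × Ty) : E.flow E.ut ρ (E.mix a b M N) s =
      a * E.flow E.ut ρ M s + b * E.flow E.ut ρ N s := by
  simp only [flow, mix, ut_comb _ hab, Finset.mul_sum, ← Finset.sum_add_distrib]
  refine Finset.sum_congr rfl fun y _ => ?_
  push_cast
  ring

theorem flow_id_mix_le {a b : ℝ≥0} (hab : a + b = 1) (ρ : Ty → Ty) (M N : Mechanism Y Φ)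
    (s : Hist Φ × Ty) : E.flow id ρ (E.mix a b M N) s ≤
      a * E.flow id ρ M s + b * E.flow id ρ N s := by
  simp only [flow, mix, id, Finset.mul_sum, ← Finset.sum_add_distrib]
  refine Finset.sum_le_sum fun y _ => ?_
  have h : ((E.comb a b (M s.1 (ρ s.2) y) (N s.1 (ρ s.2) y) : ℝ≥0) : ℝ≥0∞) ≤
      a * (M s.1 (ρ s.2) y) + b * (N s.1 (ρ s.2) y) := by
    exact_mod_cast E.comb_le hab _ _
  calc _ ≤ E.pe s.2 y * (a * (M s.1 (ρ s.2) y) + b * (N s.1 (ρ s.2) y)) := by gcongr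
    _ = _ := by ring

theorem U_mix {a b : ℝ≥0} (hab : a + b = 1) (M N : Mechanism Y Φ) (s : Hist Φ × Ty) :
    E.U (E.mix a b M N) s = a * E.U M s + b * E.U N s := by
  rw [U, U, U, J, J, J, ← Proc.tot_linear]
  congr 1
  funext s
  exact flow_ut_mix hab id M N s

theorem C_mix_le {a b : ℝ≥0} (hab : a + b = 1) (M N : Mechanism Y Φ) (s : Hist Φ × Ty) :
    E.C (E.mix a b M N) s ≤ a * E.C M s + b * E.C N s := by
  rw [C, C, C, J, J, J, ← Proc.tot_linear]
  exact Proc.tot_mono (fun s _ => flow_id_mix_le hab id M N s) s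

theorem dev_mix {a b : ℝ≥0} (hab : a + b = 1) (M N : Mechanism Y Φ) (η : Hist Φ) :
    E.dev (E.mix a b M N) η = a * E.dev M η + b * E.dev N η := by
  rw [dev_eq, dev_eq, dev_eq, flow_ut_mix hab]
  simp only [U_mix hab, mul_add, Finset.sum_add_distrib, Finset.mul_sum]
  have : ∀ x y z w x' z' : ℝ≥0∞, x = x' → z = z' → (y + w) + (x + z) = (y + x') + (w + z') := by
    rintro x y z w _ _ rfl rfl; ring
  refine this _ _ _ _ _ _ ?_ ?_ <;> exact Finset.sum_congr rfl fun i _ => by ring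

/-- Averaging flow utilities rather than consumption makes both sides of each constraint average
exactly. -/
theorem Feas.mix {w : Ty → ℝ≥0∞} {a b : ℝ≥0} (hab : a + b = 1) {M N : Mechanism Y Φ}
    (hM : E.Feas w M) (hN : E.Feas w N) : E.Feas w (E.mix a b M N) := by
  constructor
  · intro η hη hT
    rw [dev_mix hab, U_mix hab]
    gcongr
    · exact hM.osic η hη hT
    · exact hN.osic η hη hT
  · intro θ
    have : (a : ℝ≥0∞) + b = 1 := by exact_mod_cast hab
    rw [U_mix hab, hM.delivers, hN.delivers, ← add_mul, this, one_mul]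

variable (E)

theorem marginal_hasDeriv (c : ℝ≥0) :
    HasDerivWithinAt E.u (E.marginal c) (Set.Ici 0) c :=
  ((E.u_contDiff.differentiableOn (by norm_num)) c (Set.mem_Ici.2 c.2)).hasDerivWithinAt

theorem ut_le_tangent (c x : ℝ≥0) : (E.ut x : ℝ) ≤ E.ut c + E.marginal c * (x - c) := by
  -- Derivative at `t = 0` along the segment from `c` to `x`, which stays in the domain even if `c =
  -- 0`. By concavity the difference quotients are at least the total increment.
  have hg : HasDerivWithinAt (fun t : ℝ => E.u (c + t * (x - c))) (E.marginal c * (x - c))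
      (Set.Icc 0 1) 0 := by
    have h1 : HasDerivWithinAt (fun t : ℝ => (c : ℝ) + t * (x - c)) (x - c) (Set.Icc 0 1) 0 := by
      simpa using ((hasDerivWithinAt_id (0 : ℝ) (Set.Icc 0 1)).mul_const ((x : ℝ) - c)).const_add
        (c : ℝ)
    refine HasDerivWithinAt.comp (h₂ := E.u) 0 (by simpa using E.marginal_hasDeriv c) h1 ?_
    intro t ht
    have h2 := mul_nonneg (sub_nonneg.2 ht.2) c.2
    have h3 := mul_nonneg ht.1 x.2
    simp only [NNReal.val_eq_coe] at h2 h3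
    rw [Set.mem_Ici]
    linarith
  rw [hasDerivWithinAt_iff_tendsto_slope, Set.Icc_sdiff_left] at hg
  have : (nhdsWithin (0 : ℝ) (Set.Ioc 0 1)).NeBot := by
    rw [nhdsWithin_Ioc_eq_nhdsGT one_pos]; infer_instance
  have h4 := ge_of_tendsto (b := (E.ut x : ℝ) - E.ut c) hg (by
    filter_upwards [self_mem_nhdsWithin] with t ht
    have h5 := E.u_strictConcave.concaveOn.2 (Set.mem_Ici.2 c.2) (Set.mem_Ici.2 x.2)
      (sub_nonneg.2 ht.2) ht.1.le (sub_add_cancel 1 t)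
    simp only [smul_eq_mul, NNReal.val_eq_coe] at h5
    have h6 : (1 - t) * (c : ℝ) + t * x = c + t * (x - c) := by ring
    rw [h6] at h5
    simp only [slope_def_field, sub_zero, zero_mul, add_zero]
    rw [le_div_iff₀ ht.1, ut_coe, ut_coe]
    linarith)
  linarith

theorem ut_lt_tangent {c x : ℝ≥0} (h : x ≠ c) :
    (E.ut x : ℝ) < E.ut c + E.marginal c * (x - c) := by
  -- Strictness comes from applying the weak inequality at the midpoint, which strict concavity
  -- lifts above the chord.
  have hab : (2⁻¹ : ℝ≥0) + 2⁻¹ = 1 := by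
    rw [← two_mul]; exact mul_inv_cancel₀ two_ne_zero
  have h1 := E.ut_strictConcave hab (by simp) (by simp) h
  have h2 := E.ut_le_tangent c (2⁻¹ * x + 2⁻¹ * c)
  rw [← NNReal.coe_lt_coe] at h1
  push_cast at h1 h2
  nlinarith

theorem marginal_pos (c : ℝ≥0) : 0 < E.marginal c := by
  have h1 := E.ut_le_tangent c (c + 1)
  have h2 : (E.ut c : ℝ) < E.ut (c + 1) := by
    exact_mod_cast E.ut_strictMono (lt_add_one c)
  push_cast at h1
  linarith

/-- Raising utility by `ε * d` costs `ε * d / E.marginal c` up to an error of smaller order,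
absorbed in `ε * κ`. It suffices that the stated upper bound on consumption yields enough utility;
intermediate values then hit the target exactly. -/
theorem eventually_exists_ut {c : ℝ≥0} {d κ : ℝ} (hd : c = 0 → 0 ≤ d) (hκ : 0 < κ) :
    ∀ᶠ ε in nhdsWithin (0 : ℝ) (Set.Ioi 0), ∃ c' : ℝ≥0, (E.ut c' : ℝ) = E.ut c + ε * d ∧
      (c' : ℝ) ≤ c + ε * (d / E.marginal c + κ) := by
  set m := E.marginal c with hm
  have hmpos : 0 < m := E.marginal_pos c
  set k := d / m + κ with hk
  have hpos : ∀ᶠ ε in nhdsWithin (0 : ℝ) (Set.Ioi 0), (0 : ℝ) < ε := self_mem_nhdsWithin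
  have hlin : ∀ a b : ℝ, Tendsto (fun ε : ℝ => a + ε * b) (nhdsWithin 0 (Set.Ioi 0)) (nhds a) := by
    intro a b
    have : Tendsto (fun ε : ℝ => a + ε * b) (nhds 0) (nhds (a + 0 * b)) := by
      apply Continuous.tendsto; fun_prop
    simpa using this.mono_left nhdsWithin_le_nhds
  have hnn : ∀ᶠ ε in nhdsWithin (0 : ℝ) (Set.Ioi 0), 0 ≤ (c : ℝ) + ε * k := by
    rcases eq_or_ne c 0 with h0 | h0
    · filter_upwards [hpos] with ε hε
      have : 0 ≤ k := add_nonneg (div_nonneg (hd h0) hmpos.le) hκ.le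
      positivity
    · exact (hlin c k).eventually_const_le (NNReal.coe_pos.2 (pos_iff_ne_zero.2 h0))
  have hnv : ∀ᶠ ε in nhdsWithin (0 : ℝ) (Set.Ioi 0), 0 ≤ (E.ut c : ℝ) + ε * d := by
    rcases eq_or_ne c 0 with h0 | h0
    · filter_upwards [hpos] with ε hε
      have := hd h0
      positivity
    · refine (hlin (E.ut c) d).eventually_const_le (NNReal.coe_pos.2 ?_)
      rw [← E.ut_zero]
      exact E.ut_strictMono (pos_iff_ne_zero.2 h0)
  have hx : Tendsto (fun ε : ℝ => (c : ℝ) + ε * k) (nhdsWithin 0 (Set.Ioi 0))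
      (nhdsWithin (c : ℝ) (Set.Ici 0)) :=
    tendsto_nhdsWithin_iff.2 ⟨hlin c k, hnn⟩
  -- With this constant the linearization error at step `ε * k` is at most `ε * κ * m`, the
  -- linearized utility of the extra consumption `ε * κ`.
  have ho := ((hasDerivWithinAt_iff_isLittleO.1 (E.marginal_hasDeriv c)).comp_tendsto hx).def
    (c := κ * m / (|k| + 1)) (by positivity)
  filter_upwards [hpos, hnn, hnv, ho] with ε h1 h2 h3 h4
  simp only [Function.comp, Real.norm_eq_abs, add_sub_cancel_left, smul_eq_mul] at h4
  have h5 : κ * m / (|k| + 1) * |ε * k| ≤ ε * (κ * m) := by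
    rw [abs_mul, abs_of_pos h1, div_mul_eq_mul_div, div_le_iff₀ (by positivity)]
    have := mul_le_mul_of_nonneg_left (le_add_of_nonneg_right zero_le_one : |k| ≤ |k| + 1)
      (by positivity : 0 ≤ κ * m * ε)
    linarith
  have h6 := (abs_le.1 (h4.trans h5)).1
  have h7 : m * k = d + m * κ := by rw [hk]; field_simp
  have h8 : E.u c + ε * d ≤ E.u (c + ε * k) := by
    have : ε * k * m = ε * d + ε * (κ * m) := by
      linear_combination ε * h7
    linarith
  obtain ⟨c', h9, h10⟩ := E.exists_ut_eq (v := Real.toNNReal (E.ut c + ε * d))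
    (c₀ := Real.toNNReal (c + ε * k)) (by
    rw [← NNReal.coe_le_coe, Real.coe_toNNReal _ h3, ut_coe, ut_coe, Real.coe_toNNReal _ h2]
    linarith)
  refine ⟨c', by rw [h10, Real.coe_toNNReal _ h3], ?_⟩
  rw [← NNReal.coe_le_coe, Real.coe_toNNReal _ h2] at h9
  exact h9

end Env

end

end Insurance

/-! ### Full coverage as the cheapest way to deliver utility -/

namespace Insurance

/-- The states that can be reached from `(η, θ)` under truth-telling. -/
def sub {Φ : Type*} (η : Hist Φ) (θ : Ty) : Set (Hist Φ × Ty) :=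
  {s | s = (η, θ) ∨ ∃ φ, (φ, θ) :: η <:+ s.1}

theorem self_mem_sub {Φ : Type*} (η : Hist Φ) (θ : Ty) : (η, θ) ∈ sub η θ := Or.inl rfl

theorem cons_mem_sub {Φ : Type*} {η : Hist Φ} {θ : Ty} {s : Hist Φ × Ty} (h : s ∈ sub η θ) (φ : Φ)
    (θ' : Ty) : ((φ, s.2) :: s.1, θ') ∈ sub η θ := by
  rcases h with rfl | ⟨φ', h⟩
  · exact Or.inr ⟨φ, List.suffix_rfl⟩
  · exact Or.inr ⟨φ', h.trans (List.suffix_cons _ _)⟩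

/-- The set `sub η θ` is entered only at its root, so values outside depend on the contracts inside
only through the value at the root. -/
theorem eq_of_cons_mem_sub {Φ : Type*} {η : Hist Φ} {θ : Ty} {s : Hist Φ × Ty} (h : s ∉ sub η θ)
    {φ : Φ} {θ' : Ty} (h' : ((φ, s.2) :: s.1, θ') ∈ sub η θ) : ((φ, s.2) :: s.1, θ') = (η, θ) := by
  rcases h' with h' | ⟨φ', h'⟩
  · exact h'
  · rcases List.suffix_cons_iff.1 h' with h'' | h''
    · refine absurd (Or.inl ?_) h
      simp only [List.cons.injEq, Prod.mk.injEq] at h''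
      exact Prod.ext h''.2.symm h''.1.2.symm
    · exact absurd (Or.inr ⟨φ', h''⟩) h

theorem length_le_of_mem_sub {Φ : Type*} {η : Hist Φ} {θ : Ty} {s : Hist Φ × Ty}
    (h : s ∈ sub η θ) : η.length ≤ s.1.length := by
  rcases h with rfl | ⟨φ, h⟩
  · exact le_rfl
  · exact (Nat.le_succ _).trans h.length_le

theorem not_mem_sub_of_suffix {Φ : Type*} {η K : Hist Φ} {x : Φ × Ty} (θ θ' : Ty)
    (h : x :: K <:+ η) : (K, θ') ∉ sub η θ := fun hm => by
  have h1 := length_le_of_mem_sub hm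
  have h2 := h.length_le
  simp only [List.length_cons] at h1 h2
  omega

theorem sub_subset_sub {Φ : Type*} {η η' : Hist Φ} {θ θ' : Ty} (h : (η', θ') ∈ sub η θ) :
    sub η' θ' ⊆ sub η θ := by
  rintro s (rfl | ⟨φ', h'⟩)
  · exact h
  · rcases h with h | ⟨φ, h⟩
    · cases h; exact Or.inr ⟨φ', h'⟩
    · exact Or.inr ⟨φ, (h.trans (List.suffix_cons _ _)).trans h'⟩

theorem other_not_mem_sub {Φ : Type*} (η : Hist Φ) {θ θ' : Ty} (h : θ' ≠ θ) :
    (η, θ') ∉ sub η θ := by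
  rintro (h' | ⟨φ, h'⟩)
  · cases h'; exact h rfl
  · have := h'.length_le
    simp at this

noncomputable section

namespace Env

variable {Y Φ : Type*} [Fintype Y] [Fintype Φ] (E : Env Y Φ)

/-- The present value in period `n + 1` of one unit in each remaining period. -/
abbrev ann (n : ℕ) : ℝ≥0∞ := annuity E.T E.de n

theorem ann_ne_top (n : ℕ) : E.ann n ≠ ⊤ := annuity_ne_top E.de_lt_one n

theorem ann_ne_zero {n : ℕ} (h : (n : ℕ∞) < E.T) : E.ann n ≠ 0 :=
  (lt_of_lt_of_le one_pos (one_le_annuity h)).ne'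

variable {E}

theorem flow_fullCoverage {f : ℝ≥0 → ℝ≥0} {ρ : Ty → Ty} {M : Mechanism Y Φ} {s : Hist Φ × Ty}
    {c : ℝ≥0} (h : M s.1 (ρ s.2) = fullCoverage c) : E.flow f ρ M s = f c := by
  simp only [flow, h, fullCoverage, ← Finset.sum_mul, E.pe_sum, one_mul]

theorem J_of_const {f : ℝ≥0 → ℝ≥0} {M : Mechanism Y Φ} {η : Hist Φ} {θ : Ty} {c : ℝ≥0}
    (h : ∀ s ∈ sub η θ, M s.1 s.2 = fullCoverage c) {s : Hist Φ × Ty} (hs : s ∈ sub η θ) :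
    E.J f M s = f c * E.ann s.1.length := by
  rw [J, Proc.tot_congr_on (p := E.proc 0 id) (fun s => s ∈ sub η θ)
    (fun s i hs _ => cons_mem_sub hs _ _) (g := fun _ => (f c : ℝ≥0∞))
    (fun s hs _ => flow_fullCoverage (h s hs)) hs, Proc.tot_const (E.proc_w_sum 0 id)]
  simp

theorem dev_of_const {M : Mechanism Y Φ} {η : Hist Φ} {c : ℝ≥0} (hT : (η.length : ℕ∞) < E.T)
    (h : ∀ s ∈ sub η Ty.h, M s.1 s.2 = fullCoverage c) :
    E.dev M η = E.ut c * E.ann η.length := by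
  rw [dev_eq, flow_fullCoverage (h _ (self_mem_sub _ _)), ann, annuity_rec hT, mul_add, mul_one]
  have h1 : ∀ i : Y × Ty, E.U M ((E.signal i.1, Ty.h) :: η, i.2) =
      E.ut c * E.ann (η.length + 1) := fun i =>
    J_of_const h (cons_mem_sub (self_mem_sub η Ty.h) _ _)
  simp only [h1, ← Finset.sum_mul]
  have h2 : ∑ i : Y × Ty, E.pe Ty.l i.1 * E.te Ty.l i.2 = 1 := E.proc_w_sum 0 id (η, Ty.l)
  rw [h2]
  ring

theorem flow_le_iSup (M : Mechanism Y Φ) (s : Hist Φ × Ty) :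
    E.flow E.ut id M s ≤ ⨆ c, (E.ut c : ℝ≥0∞) := by
  calc E.flow E.ut id M s ≤ ∑ y, E.pe s.2 y * ⨆ c, (E.ut c : ℝ≥0∞) := by
        refine Finset.sum_le_sum fun y _ => ?_
        gcongr
        exact le_iSup (fun c => (E.ut c : ℝ≥0∞)) (M s.1 s.2 y)
    _ = _ := by rw [← Finset.sum_mul, E.pe_sum, one_mul]

theorem U_le_iSup (M : Mechanism Y Φ) (s : Hist Φ × Ty) :
    E.U M s ≤ (⨆ c, (E.ut c : ℝ≥0∞)) * E.ann s.1.length := by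
  have := Proc.tot_mono (p := E.proc 0 id) (fun s _ => flow_le_iSup (E := E) M s) s
  rw [Proc.tot_const (E.proc_w_sum 0 id), proc_len, zero_add] at this
  exact this

/-- Every finite continuation utility is delivered by a constant consumption level. -/
theorem exists_const {M : Mechanism Y Φ} {η : Hist Φ} {θ : Ty} (hT : (η.length : ℕ∞) < E.T)
    (hfin : E.U M (η, θ) ≠ ⊤) : ∃ c, E.ut c * E.ann η.length = E.U M (η, θ) := by
  have h0 := E.ann_ne_zero hT
  have h1 := E.ann_ne_top η.length
  set B := ⨆ c, (E.ut c : ℝ≥0∞) with hB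
  have hlt : E.U M (η, θ) < B * E.ann η.length := by
    by_cases hBt : B = ⊤
    · rw [hBt, ENNReal.top_mul h0]; exact lt_top_iff_ne_top.2 hfin
    -- A bounded utility does not attain its supremum: all current consumption levels are at most
    -- `z`, and `z + 1` still gives more. The inequality is thus strict already in the current
    -- period.
    · set z := Finset.univ.sup (M η θ) with hz
      have h2 : E.flow E.ut id M (η, θ) < B := by
        calc E.flow E.ut id M (η, θ) ≤ ∑ y, E.pe θ y * E.ut z := by
              refine Finset.sum_le_sum fun y _ => ?_
              have : E.ut (M η θ y) ≤ E.ut z :=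
                E.ut_strictMono.monotone (Finset.le_sup (f := M η θ) (mem_univ y))
              simp only [id]
              gcongr
          _ = E.ut z := by rw [← Finset.sum_mul, E.pe_sum, one_mul]
          _ < E.ut (z + 1) := by exact_mod_cast E.ut_strictMono (lt_add_one z)
          _ ≤ B := le_iSup (fun c => (E.ut c : ℝ≥0∞)) (z + 1)
      rw [ann, annuity_rec hT, U_rec _ _ hT, mul_add, mul_one]
      refine ENNReal.add_lt_add_of_lt_of_le ?_ h2 ?_
      · refine ne_top_of_le_ne_top hfin ?_
        rw [U_rec _ _ hT]; exact le_add_self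
      · calc _ ≤ E.de * ∑ i : Y × Ty, E.pe θ i.1 * E.te θ i.2 * (B * E.ann (η.length + 1)) := by
              gcongr with i
              exact U_le_iSup M _
          _ = _ := by
              rw [← Finset.sum_mul]
              have h2 : ∑ i : Y × Ty, E.pe θ i.1 * E.te θ i.2 = 1 := E.proc_w_sum 0 id (η, θ)
              rw [h2]; ring
  have hlt' : E.U M (η, θ) / E.ann η.length < B :=
    (ENNReal.div_lt_iff (Or.inl h0) (Or.inl h1)).2 hlt
  obtain ⟨c₀, hc₀⟩ := lt_iSup_iff.1 hlt'
  have h3 : (((E.U M (η, θ) / E.ann η.length).toNNReal : ℝ≥0) : ℝ≥0∞) =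
    E.U M (η, θ) / E.ann η.length := ENNReal.coe_toNNReal (ne_top_of_lt hc₀)
  rw [← h3] at hc₀
  obtain ⟨c, -, hc⟩ := E.exists_ut_eq (ENNReal.coe_lt_coe.1 hc₀).le
  refine ⟨c, ?_⟩
  rw [hc, h3, ENNReal.div_mul_cancel h0 h1]

/-- With `k` the inverse marginal utility at `c`, consumption minus `k` times utility is least at
`c`. The form without subtraction can be summed over all periods in `ℝ≥0∞`. -/
theorem tangent_le {k c z : ℝ≥0} (hk : (k : ℝ) * E.marginal c = 1) :
    c + k * E.ut z ≤ z + k * E.ut c := by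
  rw [← NNReal.coe_le_coe]
  push_cast
  have := mul_le_mul_of_nonneg_left (E.ut_le_tangent c z) k.2
  simp only [NNReal.val_eq_coe] at this
  linear_combination this + ((z : ℝ) - c) * hk

theorem eq_of_tangent_eq {k c z : ℝ≥0} (hk : (k : ℝ) * E.marginal c = 1)
    (h : c + k * E.ut z = z + k * E.ut c) : z = c := by
  by_contra hne
  have hk0 : (0 : ℝ) < k := by
    refine lt_of_le_of_ne k.2 fun h0 => ?_
    rw [← h0, zero_mul] at hk
    exact zero_ne_one hk
  have := mul_lt_mul_of_pos_left (E.ut_lt_tangent hne) hk0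
  have h1 : (c : ℝ) + k * E.ut z = z + k * E.ut c := by exact_mod_cast h
  have : (c : ℝ) + k * E.ut z < z + k * E.ut c := by
    linear_combination this + ((z : ℝ) - c) * hk
  exact this.ne h1

theorem exists_inv_marginal (c : ℝ≥0) : ∃ k : ℝ≥0, (k : ℝ) * E.marginal c = 1 :=
  ⟨⟨(E.marginal c)⁻¹, (inv_pos.2 (E.marginal_pos c)).le⟩, inv_mul_cancel₀ (E.marginal_pos c).ne'⟩

theorem flow_tangent_le {k c : ℝ≥0} (hk : (k : ℝ) * E.marginal c = 1) (M : Mechanism Y Φ)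
    (s : Hist Φ × Ty) : 1 * (c : ℝ≥0∞) + k * E.flow E.ut id M s ≤
      1 * E.flow id id M s + k * (E.ut c : ℝ≥0∞) := by
  have h1 : ∀ x : ℝ≥0∞, x = ∑ y, E.pe s.2 y * x := fun x => by
    rw [← Finset.sum_mul, E.pe_sum, one_mul]
  rw [h1 (1 * (c : ℝ≥0∞)), h1 (k * (E.ut c : ℝ≥0∞))]
  simp only [flow, Finset.mul_sum, ← Finset.sum_add_distrib]
  refine Finset.sum_le_sum fun y _ => ?_
  have h2 : (c : ℝ≥0∞) + k * E.ut (M s.1 s.2 y) ≤ M s.1 s.2 y + k * E.ut c := by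
    exact_mod_cast tangent_le hk
  calc _ = E.pe s.2 y * (c + k * E.ut (M s.1 s.2 y)) := by simp only [id]; ring
    _ ≤ E.pe s.2 y * (M s.1 s.2 y + k * E.ut c) := by gcongr
    _ = _ := by simp only [id]; ring

theorem eq_of_flow_tangent_eq {k c : ℝ≥0} (hk : (k : ℝ) * E.marginal c = 1) {M : Mechanism Y Φ}
    {s : Hist Φ × Ty} (h : 1 * (c : ℝ≥0∞) + k * E.flow E.ut id M s =
      1 * E.flow id id M s + k * (E.ut c : ℝ≥0∞)) : M s.1 s.2 = fullCoverage c := by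
  have h1 : ∀ x : ℝ≥0∞, x = ∑ y, E.pe s.2 y * x := fun x => by
    rw [← Finset.sum_mul, E.pe_sum, one_mul]
  rw [h1 (1 * (c : ℝ≥0∞)), h1 (k * (E.ut c : ℝ≥0∞))] at h
  simp only [flow, Finset.mul_sum, ← Finset.sum_add_distrib] at h
  have h2 := Proc.add_mul_eq_split (a := 0) (b := 0) (d := 1) (w := E.pe s.2)
    (x := fun y => ((c + k * E.ut (M s.1 s.2 y) : ℝ≥0) : ℝ≥0∞))
    (y := fun y => ((M s.1 s.2 y + k * E.ut c : ℝ≥0) : ℝ≥0∞)) one_ne_zero le_rfl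
    (fun y => by exact_mod_cast tangent_le hk) (by
      simp only [zero_add, one_mul]
      exact ENNReal.sum_ne_top.2 fun y _ => ENNReal.mul_ne_top (E.pe_ne_top _ _)
        ENNReal.coe_ne_top) (by
      simp only [zero_add, one_mul]
      push_cast
      convert h using 2 with y _ y _ <;> simp only [id] <;> ring)
  funext y
  exact eq_of_tangent_eq hk (by exact_mod_cast (h2.2 y (E.pe_ne_zero _ _)).1)

theorem tot_tangent_left (k c : ℝ≥0) (M : Mechanism Y Φ) (s : Hist Φ × Ty) :
    (E.proc 0 id).tot (fun s => 1 * (c : ℝ≥0∞) + k * E.flow E.ut id M s) s =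
      c * E.ann s.1.length + k * E.U M s := by
  rw [Proc.tot_linear, Proc.tot_const (E.proc_w_sum 0 id)]
  simp [J]

theorem tot_tangent_right (k c : ℝ≥0) (M : Mechanism Y Φ) (s : Hist Φ × Ty) :
    (E.proc 0 id).tot (fun s => 1 * E.flow id id M s + k * (E.ut c : ℝ≥0∞)) s =
      E.C M s + k * (E.ut c * E.ann s.1.length) := by
  rw [Proc.tot_linear, Proc.tot_const (E.proc_w_sum 0 id)]
  simp [J]

/-- Full coverage is the cheapest way to deliver a continuation utility. -/
theorem const_le_C {M : Mechanism Y Φ} {s : Hist Φ × Ty} {c : ℝ≥0}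
    (h : E.ut c * E.ann s.1.length = E.U M s) : c * E.ann s.1.length ≤ E.C M s := by
  obtain ⟨k, hk⟩ := exists_inv_marginal (E := E) c
  have h1 := Proc.tot_mono (p := E.proc 0 id) (fun s _ => flow_tangent_le hk M s) s
  rw [tot_tangent_left, tot_tangent_right, h] at h1
  refine (ENNReal.add_le_add_iff_right ?_).1 h1
  rw [← h]
  exact ENNReal.mul_ne_top ENNReal.coe_ne_top
    (ENNReal.mul_ne_top ENNReal.coe_ne_top (E.ann_ne_top _))

/-- If full coverage saves nothing, the summed tangent inequality is an equality. It propagates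
along successive high types, who follow each other with positive probability, and the equality case
of the tangent inequality fixes consumption. -/
theorem const_of_C_le {M : Mechanism Y Φ} {η : Hist Φ} {c : ℝ≥0}
    (h : E.ut c * E.ann η.length = E.U M (η, Ty.h)) (hC : E.C M (η, Ty.h) ≤ c * E.ann η.length)
    {η' : Hist Φ} (hη' : AllHigh η') (hs : η <:+ η') (hT : (η'.length : ℕ∞) < E.T) :
    M η' Ty.h = fullCoverage c := by
  obtain ⟨k, hk⟩ := exists_inv_marginal (E := E) c
  have hle := fun s (_ : ((E.proc 0 id).len s : ℕ∞) < E.T) => flow_tangent_le hk M s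
  set f' := fun s : Hist Φ × Ty => 1 * (c : ℝ≥0∞) + k * E.flow E.ut id M s with hf'
  set f := fun s : Hist Φ × Ty => 1 * E.flow id id M s + k * (E.ut c : ℝ≥0∞) with hf
  have key : ∀ η' : Hist Φ, AllHigh η' → η <:+ η' → (η'.length : ℕ∞) < E.T →
      (E.proc 0 id).tot f' (η', Ty.h) = (E.proc 0 id).tot f (η', Ty.h) ∧
        (E.proc 0 id).tot f (η', Ty.h) ≠ ⊤ := by
    have base : (E.proc 0 id).tot f' (η, Ty.h) = (E.proc 0 id).tot f (η, Ty.h) ∧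
        (E.proc 0 id).tot f (η, Ty.h) ≠ ⊤ := by
      rw [tot_tangent_left, tot_tangent_right, ← h, le_antisymm hC (const_le_C h)]
      have := E.ann_ne_top η.length
      exact ⟨rfl, by finiteness⟩
    intro η' hη' hs hT
    induction η' with
    | nil => rw [List.suffix_nil.1 hs] at base; exact base
    | cons x K ih =>
      rcases List.suffix_cons_iff.1 hs with rfl | hs
      · exact base
      · have hK : (K.length : ℕ∞) < E.T := lt_of_le_of_lt (by exact_mod_cast Nat.le_succ _) hT
        obtain ⟨h1, h2⟩ := ih hη'.of_cons.2 hs hK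
        obtain ⟨y, hy⟩ := E.signal_surjective x.1
        have h3 := (Proc.tot_eq_propagate (p := E.proc 0 id) E.de_ne_zero hle
          (by simpa using hK) h1 h2).2 (y, Ty.h)
          (mul_ne_zero (E.pe_ne_zero _ _) (E.te_self_ne_zero _))
        have hx : x = (E.signal y, Ty.h) := Prod.ext hy.symm hη'.of_cons.1
        rw [hx]
        exact h3
  obtain ⟨h1, h2⟩ := key η' hη' hs hT
  exact eq_of_flow_tangent_eq hk (Proc.tot_eq_propagate (p := E.proc 0 id) E.de_ne_zero hle
    (by simpa using hT) h1 h2).1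

theorem J_ne_top_of_onPath {f : ℝ≥0 → ℝ≥0} {M : Mechanism Y Φ}
    (h : ∀ θ, E.J f M ([], θ) ≠ ⊤) {η : Hist Φ} {θ : Ty} (hp : E.OnPath η θ) :
    E.J f M (η, θ) ≠ ⊤ := by
  induction η generalizing θ with
  | nil => exact h θ
  | cons x K ih =>
    by_cases hT : (K.length : ℕ∞) < E.T
    · rw [OnPath, List.map_cons, List.isChain_cons_cons] at hp
      have h1 := ih hp.2
      rw [J_rec _ _ _ hT, ENNReal.add_ne_top] at h1
      obtain ⟨y, hy⟩ := E.signal_surjective x.1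
      intro hc
      apply h1.2
      refine ENNReal.mul_eq_top.2 (Or.inl ⟨E.de_ne_zero, ENNReal.sum_eq_top.2
        ⟨(y, θ), mem_univ _, ?_⟩⟩)
      rw [hy]
      have : ((x.1, x.2) :: K, θ) = (x :: K, θ) := rfl
      rw [this, hc]
      exact ENNReal.mul_top (mul_ne_zero (E.pe_ne_zero _ _) ((E.te_ne_zero_iff _ _).2 hp.1))
    · rw [J_of_not_lt]
      · simp
      · exact fun hc => hT (lt_of_le_of_lt (by exact_mod_cast Nat.le_succ _) hc)

theorem onPath_high {η : Hist Φ} (h : AllHigh η) : E.OnPath η Ty.h := by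
  induction η with
  | nil => simp [OnPath]
  | cons x K ih =>
    rw [OnPath, List.map_cons, List.isChain_cons_cons, h.of_cons.1]
    exact ⟨(E.te_ne_zero_iff _ _).1 (E.te_self_ne_zero _), ih h.of_cons.2⟩

theorem C_nil_ne_top {M : Mechanism Y Φ} (h : E.cost M ≠ ⊤) (θ : Ty) : E.C M ([], θ) ≠ ⊤ := by
  intro hc
  refine h (ENNReal.sum_eq_top.2 ⟨θ, mem_univ _, ?_⟩)
  rw [hc]
  exact ENNReal.mul_top (E.ie_ne_zero θ)

theorem Opt.C_ne_top {w : Ty → ℝ≥0∞} {M : Mechanism Y Φ} (hM : E.Opt w M) {η : Hist Φ} {θ : Ty}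
    (hp : E.OnPath η θ) : E.C M (η, θ) ≠ ⊤ :=
  J_ne_top_of_onPath (C_nil_ne_top hM.cost_ne_top) hp

/-- A low type after high reports may be off path, where the initial utilities give no bound. The
one-shot constraint does: finite utility of the low type bounds her deviation payoff, and since low
types persist, also the low type's utility after the next signal. -/
theorem Feas.U_ne_top {w : Ty → ℝ≥0∞} (hw : ∀ θ, w θ ≠ ⊤) {M : Mechanism Y Φ} (hM : E.Feas w M)
    {η : Hist Φ} (hη : AllHigh η) (θ : Ty) : E.U M (η, θ) ≠ ⊤ := by
  have h0 : ∀ θ, E.U M ([], θ) ≠ ⊤ := fun θ => by rw [hM.delivers]; exact hw θ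
  cases θ
  · induction η with
    | nil => exact h0 _
    | cons x K ih =>
      by_cases hT : (K.length : ℕ∞) < E.T
      · have h1 := ne_top_of_le_ne_top (ih hη.of_cons.2) (hM.osic K hη.of_cons.2 hT)
        rw [dev_eq, ENNReal.add_ne_top] at h1
        obtain ⟨y, hy⟩ := E.signal_surjective x.1
        have hx : x = (E.signal y, Ty.h) := Prod.ext hy.symm hη.of_cons.1
        intro hc
        apply h1.2
        refine ENNReal.mul_eq_top.2 (Or.inl ⟨E.de_ne_zero, ENNReal.sum_eq_top.2
          ⟨(y, Ty.l), mem_univ _, ?_⟩⟩)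
        rw [← hx, hc]
        exact ENNReal.mul_top (mul_ne_zero (E.pe_ne_zero _ _) (E.te_self_ne_zero _))
      · rw [U, J_of_not_lt]
        · simp
        · exact fun hc => hT (lt_of_le_of_lt (by exact_mod_cast Nat.le_succ _) hc)
  · exact J_ne_top_of_onPath h0 (onPath_high hη)

theorem pret_of_const {M : Mechanism Y Φ} {η : Hist Φ} (hη : AllHigh η) {c : ℝ≥0}
    (h : ∀ η' : Hist Φ, AllHigh η' → η <:+ η' → (η'.length : ℕ∞) < E.T →
      M η' Ty.h = fullCoverage c) (θ : Ty) : E.pret M (η, θ) = E.ut c * E.ann η.length := by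
  rw [pret, Proc.tot_congr_on (p := E.proc 0 fun _ => Ty.h)
    (fun s => AllHigh s.1 ∧ η <:+ s.1) (fun s i hs _ => ?_) (g := fun _ => (E.ut c : ℝ≥0∞))
    (fun s hs hT => ?_) (s := (η, θ)) ⟨hη, List.suffix_rfl⟩,
    Proc.tot_const (E.proc_w_sum 0 fun _ => Ty.h)]
  · simp
  · exact ⟨hs.1.cons _, hs.2.trans (List.suffix_cons _ _)⟩
  · exact flow_fullCoverage (h s.1 hs.1 hs.2 (by simpa using hT))

/-- If a high type gets more than a low type, then she is not fully insured. -/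
theorem const_lt_C {w : Ty → ℝ≥0∞} {M : Mechanism Y Φ} (hM : E.Feas w M) {η : Hist Φ}
    (hη : AllHigh η) (hlt : E.U M (η, Ty.l) < E.U M (η, Ty.h)) {c : ℝ≥0}
    (hc : E.ut c * E.ann η.length = E.U M (η, Ty.h)) : c * E.ann η.length < E.C M (η, Ty.h) := by
  by_contra hcon
  push Not at hcon
  -- Otherwise consumption is `c` along all further high reports, and a low type who always reports
  -- high would get the high type's utility.
  have h1 := pret_le hM.osic hη Ty.l
  rw [pret_of_const hη (fun η' h2 h3 h4 => const_of_C_le hc hcon h2 h3 h4), hc] at h1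
  exact hlt.not_ge h1

end Env

end

end Insurance

/-! ### Variations after a high report, the value of slack, uniqueness -/

namespace Insurance

noncomputable section

open Classical in
/-- Replacing the contracts in the set `Z` of states by those of `N`. -/
def graft {Y Φ : Type*} (Z : Set (Hist Φ × Ty)) (M N : Mechanism Y Φ) : Mechanism Y Φ :=
  fun η θ => if (η, θ) ∈ Z then N η θ else M η θ

theorem graft_of_mem {Y Φ : Type*} {Z : Set (Hist Φ × Ty)} {M N : Mechanism Y Φ} {s : Hist Φ × Ty} (h : s ∈ Z) :
    graft Z M N s.1 s.2 = N s.1 s.2 := if_pos h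

theorem graft_of_not_mem {Y Φ : Type*} {Z : Set (Hist Φ × Ty)} {M N : Mechanism Y Φ} {s : Hist Φ × Ty}
    (h : s ∉ Z) : graft Z M N s.1 s.2 = M s.1 s.2 := if_neg h

namespace Env

variable {Y Φ : Type*} [Fintype Y] [Fintype Φ] {E : Env Y Φ}

variable (E) in
/-- `M'` differs from `M` only after a high report at the history `η`, delivers the same utility to
the high type there, and satisfies the later one-shot incentive constraints. -/
structure Variation (M M' : Mechanism Y Φ) (η : Hist Φ) : Prop where
  agree : ∀ s, s ∉ sub η Ty.h → M' s.1 s.2 = M s.1 s.2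
  util : E.U M' (η, Ty.h) = E.U M (η, Ty.h)
  deeper : ∀ η' : Hist Φ, AllHigh η' → (∃ φ, (φ, Ty.h) :: η <:+ η') → (η'.length : ℕ∞) < E.T →
    E.dev M' η' ≤ E.U M' (η', Ty.l)

theorem J_congr_off {f : ℝ≥0 → ℝ≥0} {M M' : Mechanism Y Φ} {η : Hist Φ} {θ : Ty}
    (h : ∀ s, s ∉ sub η θ → M' s.1 s.2 = M s.1 s.2) (he : E.J f M' (η, θ) = E.J f M (η, θ))
    {s : Hist Φ × Ty} (hs : s ∉ sub η θ) : E.J f M' s = E.J f M s := by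
  refine Proc.tot_eq_off (p := E.proc 0 id) (sub η θ) (fun s i hs => cons_mem_sub hs _ _)
    (fun s hs _ => ?_) (fun s i hs _ hi => ?_) hs
  · simp only [flow, id, h s hs]
  · simp only [proc_nx, id] at hi ⊢
    rw [eq_of_cons_mem_sub hs hi]
    exact he

theorem J_le_off {f : ℝ≥0 → ℝ≥0} {M M' : Mechanism Y Φ} {η : Hist Φ} {θ : Ty}
    (h : ∀ s, s ∉ sub η θ → M' s.1 s.2 = M s.1 s.2) (he : E.J f M' (η, θ) ≤ E.J f M (η, θ))
    {s : Hist Φ × Ty} (hs : s ∉ sub η θ) : E.J f M' s ≤ E.J f M s := by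
  refine Proc.tot_le_off (p := E.proc 0 id) (sub η θ) (fun s i hs => cons_mem_sub hs _ _)
    (fun s hs _ => ?_) (fun s i hs _ hi => ?_) hs
  · simp only [flow, id, h s hs, le_refl]
  · simp only [proc_nx, id] at hi ⊢
    rw [eq_of_cons_mem_sub hs hi]
    exact he

theorem Variation.U_eq {M M' : Mechanism Y Φ} {η : Hist Φ} (h : E.Variation M M' η)
    {s : Hist Φ × Ty} (hs : s ∉ sub η Ty.h) : E.U M' s = E.U M s :=
  J_congr_off h.agree h.util hs

/-- Other constraints see the altered states only through the high type's utility at `η`, which is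
unchanged, and the truthful branch of the low type at `η` is untouched. Only the deviation payoff at
`η` is left to check. -/
theorem Variation.feas {w : Ty → ℝ≥0∞} {M M' : Mechanism Y Φ} {η : Hist Φ} (hM : E.Feas w M)
    (h : E.Variation M M' η) (hd : E.dev M' η ≤ E.U M (η, Ty.l)) : E.Feas w M' := by
  constructor
  · intro K hK hT
    by_cases hs : ∃ φ, (φ, Ty.h) :: η <:+ K
    · exact h.deeper K hK hs hT
    have hl : (K, Ty.l) ∉ sub η Ty.h := by
      rintro (h' | h')
      · cases h'
      · exact hs h'
    rw [h.U_eq hl]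
    by_cases hKη : K = η
    · rw [hKη]; exact hd
    have hh : (K, Ty.h) ∉ sub η Ty.h := by
      rintro (h' | h')
      · exact hKη (congrArg Prod.fst h')
      · exact hs h'
    refine le_trans (le_of_eq ?_) (hM.osic K hK hT)
    rw [dev_eq, dev_eq]
    have h1 := h.agree _ hh
    simp only [flow, h1]
    congr 2
    refine Finset.sum_congr rfl fun i _ => ?_
    congr 1
    by_cases hn : ((E.signal i.1, Ty.h) :: K, i.2) ∈ sub η Ty.h
    · rw [eq_of_cons_mem_sub (s := (K, Ty.h)) hh hn, h.util]
    · exact h.U_eq hn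
  · intro θ
    rw [← hM.delivers]
    by_cases hs : (([], θ) : Hist Φ × Ty) ∈ sub η Ty.h
    · rcases hs with hs | ⟨φ, hs⟩
      · rw [hs, h.util]
      · simp at hs
    · exact h.U_eq hs

/-- Every step of the all-high history has positive probability, so a strict saving at its end stays
strict back to the first period. -/
theorem C_lt_up {M M' : Mechanism Y Φ} {η : Hist Φ}
    (h : ∀ s, s ∉ sub η Ty.h → M' s.1 s.2 = M s.1 s.2)
    (hlt : E.C M' (η, Ty.h) < E.C M (η, Ty.h)) (hfin : ∀ θ, E.C M ([], θ) ≠ ⊤) {K : Hist Φ}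
    (hK : AllHigh K) (hs : K <:+ η) (hT : (η.length : ℕ∞) < E.T)
    (hl : E.C M' (K, Ty.h) < E.C M (K, Ty.h)) : E.C M' ([], Ty.h) < E.C M ([], Ty.h) := by
  induction K with
  | nil => exact hl
  | cons x K ih =>
    have hsK : K <:+ η := (List.suffix_cons x K).trans hs
    have hTK : (K.length : ℕ∞) < E.T := lt_of_le_of_lt (by exact_mod_cast hsK.length_le) hT
    have hK' := hK.of_cons
    refine ih hK'.2 hsK (lt_of_le_of_ne ?_ fun heq => ?_)
    · exact J_le_off h hlt.le (not_mem_sub_of_suffix _ _ hs)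
    · have hn : (K, Ty.h) ∉ sub η Ty.h := not_mem_sub_of_suffix _ _ hs
      have hfinK : E.C M (K, Ty.h) ≠ ⊤ := J_ne_top_of_onPath hfin (onPath_high hK'.2)
      rw [C_rec _ _ hTK] at heq hfinK
      rw [C_rec _ _ hTK] at heq
      have hflow : E.flow id id M' (K, Ty.h) = E.flow id id M (K, Ty.h) := by
        simp only [flow, id, h _ hn]
      have h1 := Proc.add_mul_eq_split (w := fun i : Y × Ty => E.pe Ty.h i.1 * E.te Ty.h i.2)
        (x := fun i => E.C M' ((E.signal i.1, Ty.h) :: K, i.2))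
        (y := fun i => E.C M ((E.signal i.1, Ty.h) :: K, i.2)) E.de_ne_zero hflow.le
        (fun i => ?_) hfinK heq
      · obtain ⟨y, hy⟩ := E.signal_surjective x.1
        have h2 := (h1.2 (y, Ty.h) (mul_ne_zero (E.pe_ne_zero _ _) (E.te_self_ne_zero _))).1
        have hx : x = (E.signal y, Ty.h) := Prod.ext hy.symm hK'.1
        rw [hx] at hl
        exact hl.ne h2
      · by_cases hm : ((E.signal i.1, Ty.h) :: K, i.2) ∈ sub η Ty.h
        · rw [eq_of_cons_mem_sub (s := (K, Ty.h)) hn hm]; exact hlt.le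
        · exact J_le_off h hlt.le hm

theorem Opt.C_le {w : Ty → ℝ≥0∞} {M M' : Mechanism Y Φ} {η : Hist Φ} (hM : E.Opt w M)
    (hη : AllHigh η) (hT : (η.length : ℕ∞) < E.T) (h : E.Variation M M' η)
    (hd : E.dev M' η ≤ E.U M (η, Ty.l)) : E.C M (η, Ty.h) ≤ E.C M' (η, Ty.h) := by
  by_contra hlt
  push Not at hlt
  have h1 := C_lt_up h.agree hlt (C_nil_ne_top hM.cost_ne_top) hη List.suffix_rfl hT hlt
  have h2 := hM.le M' (h.feas hM.feas hd)
  have h3 : E.C M' ([], Ty.l) ≤ E.C M ([], Ty.l) := by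
    refine J_le_off h.agree hlt.le ?_
    rintro (h' | ⟨φ, h'⟩)
    · cases h'
    · simp at h'
  refine h2.not_gt ?_
  rw [cost, cost, Ty.sum_eq, Ty.sum_eq]
  refine ENNReal.add_lt_add_of_le_of_lt ?_ (by gcongr)
    ((ENNReal.mul_lt_mul_iff_right (E.ie_ne_zero _) (E.ie_ne_top _)).2 h1)
  exact ENNReal.mul_ne_top (E.ie_ne_top _)
    (ne_top_of_le_ne_top (C_nil_ne_top hM.cost_ne_top Ty.l) h3)

theorem Opt.of_C_le {w : Ty → ℝ≥0∞} {M M' : Mechanism Y Φ} {η : Hist Φ} (hM : E.Opt w M)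
    (h : E.Variation M M' η) (hd : E.dev M' η ≤ E.U M (η, Ty.l))
    (hC : E.C M' (η, Ty.h) ≤ E.C M (η, Ty.h)) : E.Opt w M' := by
  have hc : E.cost M' ≤ E.cost M := by
    refine Finset.sum_le_sum fun θ _ => ?_
    gcongr
    by_cases hs : (([], θ) : Hist Φ × Ty) ∈ sub η Ty.h
    · rcases hs with hs | ⟨φ, hs⟩
      · rw [hs]; exact hC
      · simp at hs
    · exact J_le_off h.agree hC hs
  exact ⟨h.feas hM.feas hd, fun N hN => hc.trans (hM.le N hN), ne_top_of_le_ne_top hM.cost_ne_top hc⟩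

/-- A slack in the incentive constraint has a positive value. -/
theorem Opt.slack_value {w : Ty → ℝ≥0∞} (hw : ∀ θ, w θ ≠ ⊤) {M : Mechanism Y Φ} (hM : E.Opt w M)
    {η : Hist Φ} (hη : AllHigh η) (hT : (η.length : ℕ∞) < E.T)
    (hlt : E.U M (η, Ty.l) < E.U M (η, Ty.h)) :
    ∃ ρ : ℝ, 0 < ρ ∧ ∀ M' : Mechanism Y Φ, E.Variation M M' η → ∀ s : ℝ, 0 ≤ s → s ≤ 1 →
      E.dev M' η + ENNReal.ofReal s ≤ E.U M (η, Ty.l) →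
      E.C M (η, Ty.h) + ENNReal.ofReal (ρ * s) ≤ E.C M' (η, Ty.h) := by
  have hUl := hM.feas.U_ne_top hw hη Ty.l
  have hUh := hM.feas.U_ne_top hw hη Ty.h
  have hC := hM.C_ne_top (onPath_high hη)
  obtain ⟨c, hc⟩ := exists_const hT hUh
  have hgap := const_lt_C hM.feas hη hlt hc
  set K : ℝ≥0∞ := c * E.ann η.length with hKdef
  have hK : K ≠ ⊤ := ENNReal.mul_ne_top ENNReal.coe_ne_top (E.ann_ne_top _)
  have hltr : (E.U M (η, Ty.l)).toReal < (E.U M (η, Ty.h)).toReal :=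
    (ENNReal.toReal_lt_toReal hUl hUh).2 hlt
  have hgapr : K.toReal < (E.C M (η, Ty.h)).toReal := (ENNReal.toReal_lt_toReal hK hC).2 hgap
  -- Mixing in full coverage with weight `s / D` raises the deviation payoff by at most `s / D * (D
  -- - 1 + s)`. The added 1 and `s ≤ 1` keep this within the slack `s`.
  set D := (E.U M (η, Ty.h)).toReal - (E.U M (η, Ty.l)).toReal + 1 with hD
  have hDpos : 1 < D := by rw [hD]; linarith
  refine ⟨((E.C M (η, Ty.h)).toReal - K.toReal) / D, div_pos (by linarith) (by linarith), ?_⟩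
  intro M' hM' s hs0 hs1 hs
  by_cases hC' : E.C M' (η, Ty.h) = ⊤
  · rw [hC']; exact le_top
  have hdev : E.dev M' η ≠ ⊤ := ne_top_of_le_ne_top hUl (le_self_add.trans hs)
  have hsr : (E.dev M' η).toReal + s ≤ (E.U M (η, Ty.l)).toReal := by
    have := ENNReal.toReal_mono hUl hs
    rwa [ENNReal.toReal_add hdev ENNReal.ofReal_ne_top, ENNReal.toReal_ofReal hs0] at this
  have hb0 : 0 ≤ s / D := by positivity
  have hb1 : s / D < 1 := by rw [div_lt_one (by linarith)]; linarith
  set b : ℝ≥0 := ⟨s / D, hb0⟩ with hb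
  set a : ℝ≥0 := ⟨1 - s / D, by linarith⟩ with ha
  have hab : a + b = 1 := NNReal.coe_injective (sub_add_cancel (1 : ℝ) (s / D))
  have har : (a : ℝ) = 1 - s / D := rfl
  have hbr : (b : ℝ) = s / D := rfl
  have habE : (a : ℝ≥0∞) + b = 1 := by exact_mod_cast hab
  -- Full coverage after the high report keeps the high type's utility at the lower cost `K`, but
  -- gives a misreporting low type as much as the high type.
  set N := graft (sub η Ty.h) M fun _ _ => fullCoverage c with hN
  have hNc : ∀ s ∈ sub η Ty.h, N s.1 s.2 = fullCoverage c := fun s hs => graft_of_mem hs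
  have hUN : ∀ s ∈ sub η Ty.h, E.U N s = E.ut c * E.ann s.1.length := fun s hs => J_of_const hNc hs
  have hvar : E.Variation M (E.mix a b M' N) η := by
    refine ⟨fun s hs => ?_, ?_, fun η' h1 h2 h3 => ?_⟩
    · funext y
      rw [mix, hM'.agree s hs, hN, graft_of_not_mem hs, comb_self _ hab]
    · rw [U_mix hab, hM'.util, hUN _ (self_mem_sub _ _), hc, ← add_mul, habE, one_mul]
    · rw [dev_mix hab, U_mix hab]
      have h4 : (η', Ty.l) ∈ sub η Ty.h := Or.inr h2
      have h5 : (η', Ty.h) ∈ sub η Ty.h := Or.inr h2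
      rw [hUN _ h4, dev_of_const h3 fun s hs => hNc s (sub_subset_sub h5 hs)]
      gcongr
      exact hM'.deeper η' h1 h2 h3
  have hdm : E.dev (E.mix a b M' N) η ≤ E.U M (η, Ty.l) := by
    rw [dev_mix hab, dev_of_const hT hNc, hc]
    rw [← ENNReal.toReal_le_toReal (by finiteness) hUl, ENNReal.toReal_add (by finiteness)
      (by finiteness), ENNReal.toReal_mul, ENNReal.toReal_mul, ENNReal.coe_toReal,
      ENNReal.coe_toReal, har, hbr]
    have h1 : s / D * D = s := div_mul_cancel₀ _ (by linarith)
    have h2 : 0 ≤ 1 - s / D := by linarith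
    have h3 := mul_le_mul_of_nonneg_left hsr h2
    have h4 : s / D * s ≤ s / D * 1 := mul_le_mul_of_nonneg_left hs1 hb0
    nlinarith
  have h1 := (hM.C_le hη hT hvar hdm).trans (C_mix_le hab M' N _)
  have hCN : E.C N (η, Ty.h) = K := J_of_const hNc (self_mem_sub _ _)
  rw [hCN] at h1
  have h2 := ENNReal.toReal_mono (by finiteness) h1
  rw [ENNReal.toReal_add (by finiteness) (by finiteness), ENNReal.toReal_mul, ENNReal.toReal_mul,
    ENNReal.coe_toReal, ENNReal.coe_toReal, har, hbr] at h2
  rw [← ENNReal.toReal_le_toReal (by finiteness) hC', ENNReal.toReal_add hC (by finiteness),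
    ENNReal.toReal_ofReal (by
      refine mul_nonneg (div_nonneg (by linarith) (by linarith)) hs0)]
  have h3 : ((E.C M (η, Ty.h)).toReal - K.toReal) / D * s =
      s / D * ((E.C M (η, Ty.h)).toReal - K.toReal) := by ring
  rw [h3]
  set x := s / D
  -- Optimality says that the cost under `M` is at most `1 - x` times that under `M'` plus `x * K`;
  -- the term dropped here is `x ^ 2` times the saving from full coverage.
  have h4 : (1 - x) * ((E.C M (η, Ty.h)).toReal + x * ((E.C M (η, Ty.h)).toReal - K.toReal)) ≤
      (1 - x) * (E.C M' (η, Ty.h)).toReal := by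
    nlinarith [mul_nonneg (mul_nonneg hb0 hb0) (sub_nonneg.2 hgapr.le)]
  exact le_of_mul_le_mul_left h4 (by linarith)

theorem Variation.refl {w : Ty → ℝ≥0∞} {M : Mechanism Y Φ} (hM : E.Feas w M) (η : Hist Φ) :
    E.Variation M M η := ⟨fun _ _ => rfl, rfl, fun η' h1 _ h3 => hM.osic η' h1 h3⟩

/-- Slack left by a variation that is no more expensive could be converted into a saving. -/
theorem Opt.no_slack {w : Ty → ℝ≥0∞} (hw : ∀ θ, w θ ≠ ⊤) {M : Mechanism Y Φ} (hM : E.Opt w M)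
    {η : Hist Φ} (hη : AllHigh η) (hT : (η.length : ℕ∞) < E.T)
    (hlt : E.U M (η, Ty.l) < E.U M (η, Ty.h)) {M' : Mechanism Y Φ} (h : E.Variation M M' η)
    (hC : E.C M' (η, Ty.h) ≤ E.C M (η, Ty.h)) : E.U M (η, Ty.l) ≤ E.dev M' η := by
  by_contra hd
  push Not at hd
  obtain ⟨ρ, hρ, hQ⟩ := hM.slack_value hw hη hT hlt
  have hUl := hM.feas.U_ne_top hw hη Ty.l
  have hdr := (ENNReal.toReal_lt_toReal (ne_top_of_lt hd) hUl).2 hd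
  set s := min 1 ((E.U M (η, Ty.l)).toReal - (E.dev M' η).toReal) with hs
  have hs0 : 0 < s := lt_min one_pos (by linarith)
  have h1 := hQ M' h s hs0.le (min_le_left _ _) ?_
  · have h2 := h1.trans hC
    have h3 : E.C M (η, Ty.h) < E.C M (η, Ty.h) + ENNReal.ofReal (ρ * s) :=
      ENNReal.lt_add_right (hM.C_ne_top (onPath_high hη))
        (ENNReal.ofReal_pos.2 (mul_pos hρ hs0)).ne'
    exact h3.not_ge h2
  · have hd' := ne_top_of_lt hd
    rw [← ENNReal.toReal_le_toReal (by finiteness) hUl,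
      ENNReal.toReal_add hd' (by finiteness), ENNReal.toReal_ofReal hs0.le]
    linarith [min_le_right 1 ((E.U M (η, Ty.l)).toReal - (E.dev M' η).toReal)]

theorem Opt.binds {w : Ty → ℝ≥0∞} (hw : ∀ θ, w θ ≠ ⊤) {M : Mechanism Y Φ} (hM : E.Opt w M)
    {η : Hist Φ} (hη : AllHigh η) (hT : (η.length : ℕ∞) < E.T)
    (hlt : E.U M (η, Ty.l) < E.U M (η, Ty.h)) : E.dev M η = E.U M (η, Ty.l) :=
  le_antisymm (hM.feas.osic η hη hT)
    (hM.no_slack hw hη hT hlt (Variation.refl hM.feas η) le_rfl)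

theorem half_add_half : (2⁻¹ : ℝ≥0) + 2⁻¹ = 1 := by
  rw [← two_mul]; exact mul_inv_cancel₀ two_ne_zero

/-- Solutions of the relaxed problem are unique on path. -/
theorem Opt.agreeOnPath {w : Ty → ℝ≥0∞} {M N : Mechanism Y Φ} (hM : E.Opt w M) (hN : E.Opt w N) :
    E.AgreeOnPath M N := by
  have hab := half_add_half
  -- The cost flow of the average mechanism is at most the average cost flow. Optimality equates the
  -- totals, equality propagates on path, and strict concavity then equates the contracts.
  set f' := E.flow id id (E.mix 2⁻¹ 2⁻¹ M N) with hf'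
  set f := fun s => ((2⁻¹ : ℝ≥0) : ℝ≥0∞) * E.flow id id M s +
    ((2⁻¹ : ℝ≥0) : ℝ≥0∞) * E.flow id id N s with hf
  have hle : ∀ s, ((E.proc 0 id).len s : ℕ∞) < E.T → f' s ≤ f s := fun s _ =>
    flow_id_mix_le hab id M N s
  have htot : ∀ s, (E.proc 0 id).tot f s = ((2⁻¹ : ℝ≥0) : ℝ≥0∞) * E.C M s +
      ((2⁻¹ : ℝ≥0) : ℝ≥0∞) * E.C N s := fun s => by rw [hf, Proc.tot_linear]; rfl
  have hcost : E.cost N = E.cost M := le_antisymm (hN.le M hM.feas) (hM.le N hN.feas)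
  have hsum : ∑ θ, E.ie θ * (E.proc 0 id).tot f ([], θ) = E.cost M := by
    have h1 : ((2⁻¹ : ℝ≥0) : ℝ≥0∞) + ((2⁻¹ : ℝ≥0) : ℝ≥0∞) = 1 := by exact_mod_cast hab
    calc _ = ((2⁻¹ : ℝ≥0) : ℝ≥0∞) * E.cost M + ((2⁻¹ : ℝ≥0) : ℝ≥0∞) * E.cost N := by
          simp only [htot, cost, Ty.sum_eq]; ring
      _ = _ := by rw [hcost, ← add_mul, h1, one_mul]
  have hroot : ∀ θ, (E.proc 0 id).tot f' ([], θ) = (E.proc 0 id).tot f ([], θ) ∧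
      (E.proc 0 id).tot f ([], θ) ≠ ⊤ := by
    have h1 := hM.le _ (hM.feas.mix hab hN.feas)
    have h2 : ∑ θ, E.ie θ * (E.proc 0 id).tot f' ([], θ) ≤
        ∑ θ, E.ie θ * (E.proc 0 id).tot f ([], θ) := by
      gcongr with θ
      exact Proc.tot_mono hle _
    rw [← hsum] at h1
    have h3 := Proc.add_mul_eq_split (a := 0) (b := 0) (d := 1) (w := E.ie)
      (x := fun θ => (E.proc 0 id).tot f' ([], θ)) (y := fun θ => (E.proc 0 id).tot f ([], θ))
      one_ne_zero le_rfl (fun θ => Proc.tot_mono hle _)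
      (by simpa [hsum] using hM.cost_ne_top) (by simpa using le_antisymm h2 h1)
    exact fun θ => h3.2 θ (E.ie_ne_zero θ)
  have key : ∀ η θ, (η.length : ℕ∞) < E.T → E.OnPath η θ →
      (E.proc 0 id).tot f' (η, θ) = (E.proc 0 id).tot f (η, θ) ∧
        (E.proc 0 id).tot f (η, θ) ≠ ⊤ := by
    intro η
    induction η with
    | nil => exact fun θ _ _ => hroot θ
    | cons x K ih =>
      intro θ hT hp
      have hK : (K.length : ℕ∞) < E.T := lt_of_le_of_lt (by exact_mod_cast Nat.le_succ _) hT
      rw [OnPath, List.map_cons, List.isChain_cons_cons] at hp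
      obtain ⟨h1, h2⟩ := ih x.2 hK hp.2
      obtain ⟨y, hy⟩ := E.signal_surjective x.1
      have h3 := (Proc.tot_eq_propagate (p := E.proc 0 id) E.de_ne_zero hle
          (by simpa using hK) h1 h2).2 (y, θ)
          (mul_ne_zero (E.pe_ne_zero _ _) ((E.te_ne_zero_iff _ _).2 hp.1))
      simp only [proc_nx, id, hy] at h3
      exact h3
  intro η θ hT hp
  obtain ⟨h1, h2⟩ := key η θ hT hp
  have h3 := (Proc.tot_eq_propagate (p := E.proc 0 id) E.de_ne_zero hle
    (by simpa using hT) h1 h2).1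
  have h4 := Proc.add_mul_eq_split (a := 0) (b := 0) (d := 1) (w := E.pe θ)
    (x := fun y => ((E.comb 2⁻¹ 2⁻¹ (M η θ y) (N η θ y) : ℝ≥0) : ℝ≥0∞))
    (y := fun y => ((2⁻¹ * M η θ y + 2⁻¹ * N η θ y : ℝ≥0) : ℝ≥0∞)) one_ne_zero le_rfl
    (fun y => by exact_mod_cast E.comb_le hab _ _) (by
      simp only [zero_add, one_mul]
      exact ENNReal.sum_ne_top.2 fun y _ => ENNReal.mul_ne_top (E.pe_ne_top _ _)
        ENNReal.coe_ne_top) (by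
      simp only [hf', hf, flow, id, mix, Finset.mul_sum, ← Finset.sum_add_distrib] at h3
      simp only [zero_add, one_mul]
      rw [h3]
      refine Finset.sum_congr rfl fun y _ => ?_
      rw [ENNReal.coe_add, ENNReal.coe_mul, ENNReal.coe_mul]
      ring)
  funext y
  exact E.eq_of_comb_eq hab (by simp) (by simp)
    (by exact_mod_cast (h4.2 y (E.pe_ne_zero _ _)).1)

end Env

end

end Insurance

/-! ### Changing the continuation after one signal -/

namespace Insurance

/-- The states after the history `K`. -/
def after {Φ : Type*} (K : Hist Φ) : Set (Hist Φ × Ty) := {s | K <:+ s.1}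

theorem not_mem_after_of_ne {Φ : Type*} {K L : Hist Φ} (hl : L.length = K.length) (hne : L ≠ K)
    {s : Hist Φ × Ty} (hs : s ∈ after L) : s ∉ after K := fun hK =>
  hne ((List.suffix_of_suffix_length_le hs hK hl.le).eq_of_length hl)

theorem graft_child_agree {Y Φ : Type*} {M N : Mechanism Y Φ} {η : Hist Φ} {φ : Φ} (θ : Ty) :
    graft (after ((φ, Ty.h) :: η)) M N η θ = M η θ :=
  graft_of_not_mem (s := (η, θ)) fun h => by
    have := List.IsSuffix.length_le h; simp at this

noncomputable section

namespace Env

variable {Y Φ : Type*} [Fintype Y] [Fintype Φ] {E : Env Y Φ}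

theorem J_congr_after {f : ℝ≥0 → ℝ≥0} {M N : Mechanism Y Φ} {K : Hist Φ}
    (h : ∀ s ∈ after K, M s.1 s.2 = N s.1 s.2) {s : Hist Φ × Ty} (hs : s ∈ after K) :
    E.J f M s = E.J f N s := by
  refine Proc.tot_congr_on (p := E.proc 0 id) (fun s => s ∈ after K)
    (fun s i hs _ => List.IsSuffix.trans hs (List.suffix_cons _ _)) (fun s hs _ => ?_) hs
  simp only [flow, id, h s hs]

theorem dev_congr_after {M N : Mechanism Y Φ} {K η : Hist Φ}
    (h : ∀ s ∈ after K, M s.1 s.2 = N s.1 s.2) (hs : K <:+ η) : E.dev M η = E.dev N η := by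
  rw [dev_eq, dev_eq]
  have h1 : M η Ty.h = N η Ty.h := h (η, Ty.h) hs
  simp only [flow, h1]
  refine congrArg₂ _ rfl (congrArg₂ _ rfl (Finset.sum_congr rfl fun i _ => congrArg₂ _ rfl ?_))
  exact J_congr_after h (hs.trans (List.suffix_cons _ _))

theorem J_graft_mem {f : ℝ≥0 → ℝ≥0} {M N : Mechanism Y Φ} {K : Hist Φ} {s : Hist Φ × Ty}
    (hs : s ∈ after K) : E.J f (graft (after K) M N) s = E.J f N s :=
  J_congr_after (fun _ h => graft_of_mem h) hs

theorem J_graft_other {f : ℝ≥0 → ℝ≥0} {M N : Mechanism Y Φ} {K L : Hist Φ}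
    (hl : L.length = K.length) (hne : L ≠ K) {s : Hist Φ × Ty} (hs : s ∈ after L) :
    E.J f (graft (after K) M N) s = E.J f M s :=
  J_congr_after (fun _ h => graft_of_not_mem (not_mem_after_of_ne hl hne h)) hs

/-- Expectation of `X` over next period's type. -/
def avg (E : Env Y Φ) (θ : Ty) (X : Ty → ℝ≥0∞) : ℝ≥0∞ := ∑ θ', E.te θ θ' * X θ'

theorem sum_next (θ : Ty) (F : Y → Ty → ℝ≥0∞) :
    ∑ i : Y × Ty, E.pe θ i.1 * E.te θ i.2 * F i.1 i.2 = ∑ y, E.pe θ y * E.avg θ (F y) := by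
  rw [Fintype.sum_prod_type]
  simp only [avg, Finset.mul_sum, mul_assoc]

theorem J_rec' {f : ℝ≥0 → ℝ≥0} {M : Mechanism Y Φ} {η : Hist Φ} {θ : Ty}
    (h : (η.length : ℕ∞) < E.T) :
    E.J f M (η, θ) = E.flow f id M (η, θ) +
      E.de * ∑ y, E.pe θ y * E.avg θ fun θ' => E.J f M ((E.signal y, θ) :: η, θ') := by
  rw [J_rec _ _ _ h]
  exact congrArg₂ _ rfl (congrArg₂ _ rfl (sum_next θ fun y θ' => E.J f M ((E.signal y, θ) :: η, θ')))

theorem dev_eq' {M : Mechanism Y Φ} {η : Hist Φ} :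
    E.dev M η = E.flow E.ut (fun _ => Ty.h) M (η, Ty.l) +
      E.de * ∑ y, E.pe Ty.l y * E.avg Ty.l fun θ' => E.U M ((E.signal y, Ty.h) :: η, θ') :=
  congrArg₂ _ rfl (congrArg₂ _ rfl
    (sum_next Ty.l fun y θ' => E.U M ((E.signal y, Ty.h) :: η, θ')))

theorem Variation.of_children {M M' : Mechanism Y Φ} {η : Hist Φ} (hT : (η.length : ℕ∞) < E.T)
    (agree : ∀ s : Hist Φ × Ty, (¬ ∃ φ, (φ, Ty.h) :: η <:+ s.1) → M' s.1 s.2 = M s.1 s.2)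
    (hsum : ∑ y, E.pe Ty.h y * E.avg Ty.h (fun θ' => E.U M' ((E.signal y, Ty.h) :: η, θ')) =
      ∑ y, E.pe Ty.h y * E.avg Ty.h (fun θ' => E.U M ((E.signal y, Ty.h) :: η, θ')))
    (deeper : ∀ η' : Hist Φ, AllHigh η' → (∃ φ, (φ, Ty.h) :: η <:+ η') → (η'.length : ℕ∞) < E.T →
      E.dev M' η' ≤ E.U M' (η', Ty.l)) : E.Variation M M' η := by
  refine ⟨fun s hs => agree s fun h => hs (Or.inr h), ?_, deeper⟩
  have h1 : M' η Ty.h = M η Ty.h := agree (η, Ty.h) fun ⟨φ, h⟩ => by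
    have := h.length_le; simp at this
  rw [U, U, J_rec' hT, J_rec' hT]
  refine congrArg₂ _ ?_ (congrArg₂ _ rfl hsum)
  simp only [flow, id, h1]

theorem J_graft_child {f : ℝ≥0 → ℝ≥0} {M N : Mechanism Y Φ} {η : Hist Φ} {φ : Φ} (φ' : Φ)
    (θ : Ty) [Decidable (φ' = φ)] :
    E.J f (graft (after ((φ, Ty.h) :: η)) M N) ((φ', Ty.h) :: η, θ) =
      if φ' = φ then E.J f N ((φ, Ty.h) :: η, θ) else E.J f M ((φ', Ty.h) :: η, θ) := by
  split_ifs with h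
  · subst h
    exact J_graft_mem List.suffix_rfl
  · exact J_graft_other (L := (φ', Ty.h) :: η) (by simp) (by simp [h]) List.suffix_rfl

/-- Replacing the continuation after one signal. -/
theorem Variation.of_child {w : Ty → ℝ≥0∞} {M N : Mechanism Y Φ} (hM : E.Feas w M) {η : Hist Φ}
    (hT : (η.length : ℕ∞) < E.T) {φ : Φ}
    (hH : E.avg Ty.h (fun θ' => E.U N ((φ, Ty.h) :: η, θ')) =
      E.avg Ty.h fun θ' => E.U M ((φ, Ty.h) :: η, θ'))
    (deeper : ∀ η' : Hist Φ, AllHigh η' → (φ, Ty.h) :: η <:+ η' → (η'.length : ℕ∞) < E.T →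
      E.dev N η' ≤ E.U N (η', Ty.l)) :
    E.Variation M (graft (after ((φ, Ty.h) :: η)) M N) η := by
  classical
  refine Variation.of_children hT (fun s hs => graft_of_not_mem fun h => hs ⟨φ, h⟩) ?_ ?_
  · refine Finset.sum_congr rfl fun y _ => congrArg₂ _ rfl ?_
    simp only [J_graft_child]
    split_ifs with h
    · rw [h, hH]
    · rfl
  · rintro η' h1 ⟨φ', h2⟩ h3
    by_cases hφ : φ' = φ
    · subst hφ
      rw [dev_congr_after (fun _ h => graft_of_mem h) h2, U, J_graft_mem h2]
      exact deeper η' h1 h2 h3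
    · have hn : ∀ s ∈ after ((φ', Ty.h) :: η),
          graft (after ((φ, Ty.h) :: η)) M N s.1 s.2 = M s.1 s.2 := fun s hs =>
        graft_of_not_mem (not_mem_after_of_ne (L := (φ', Ty.h) :: η) (by simp) (by simp [hφ]) hs)
      rw [dev_congr_after hn h2, U, J_congr_after hn h2]
      exact hM.osic η' h1 h3

/-- A crude bound suffices: the extra cost arises with discounted probability at most one. -/
theorem C_graft_child_le {M N : Mechanism Y Φ} {η : Hist Φ} (hT : (η.length : ℕ∞) < E.T) {φ : Φ}
    {x : ℝ≥0∞} (h : E.avg Ty.h (fun θ' => E.C N ((φ, Ty.h) :: η, θ')) ≤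
      E.avg Ty.h (fun θ' => E.C M ((φ, Ty.h) :: η, θ')) + x) :
    E.C (graft (after ((φ, Ty.h) :: η)) M N) (η, Ty.h) ≤ E.C M (η, Ty.h) + x := by
  classical
  rw [C, C, J_rec' hT, J_rec' hT, add_assoc]
  refine add_le_add (by simp only [flow, id, graft_child_agree, le_refl]) ?_
  have h1 : ∀ y, E.avg Ty.h (fun θ' => E.C (graft (after ((φ, Ty.h) :: η)) M N)
      ((E.signal y, Ty.h) :: η, θ')) ≤
      E.avg Ty.h (fun θ' => E.C M ((E.signal y, Ty.h) :: η, θ')) + x := by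
    intro y
    simp only [J_graft_child]
    split_ifs with hy
    · rw [hy]; exact h
    · exact le_self_add
  calc _ ≤ E.de * ∑ y, E.pe Ty.h y *
        (E.avg Ty.h (fun θ' => E.C M ((E.signal y, Ty.h) :: η, θ')) + x) := by
        gcongr with y
        exact h1 y
    _ = E.de * ∑ y, E.pe Ty.h y * E.avg Ty.h (fun θ' => E.C M ((E.signal y, Ty.h) :: η, θ')) +
        E.de * x := by
        simp only [mul_add, Finset.sum_add_distrib, ← Finset.sum_mul, E.pe_sum, one_mul]
    _ ≤ _ := by
        gcongr
        exact mul_le_of_le_one_left zero_le E.de_lt_one.le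

theorem sum_add_le_of_le {w A A' : Y → ℝ≥0∞} {x : ℝ≥0∞} {y₀ : Y} (h : ∀ y, A' y ≤ A y)
    (h₀ : A' y₀ + x ≤ A y₀) : ∑ y, w y * A' y + w y₀ * x ≤ ∑ y, w y * A y := by
  classical
  rw [← Finset.add_sum_erase _ _ (mem_univ y₀), ← Finset.add_sum_erase _ _ (mem_univ y₀),
    add_right_comm, ← mul_add]
  gcongr with y
  exact h y

/-- Counting the loss `x` at the single income `y₀` is enough; at other incomes with the same signal
the payoff does not rise. -/
theorem dev_graft_child_le {M N : Mechanism Y Φ} {η : Hist Φ} {y₀ : Y} {x : ℝ≥0∞}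
    (h : E.avg Ty.l (fun θ' => E.U N ((E.signal y₀, Ty.h) :: η, θ')) + x ≤
      E.avg Ty.l (fun θ' => E.U M ((E.signal y₀, Ty.h) :: η, θ'))) :
    E.dev (graft (after ((E.signal y₀, Ty.h) :: η)) M N) η + E.de * (E.pe Ty.l y₀ * x) ≤
      E.dev M η := by
  classical
  rw [dev_eq', dev_eq', add_assoc, ← mul_add]
  refine add_le_add (by simp only [flow, graft_child_agree, le_refl]) ?_
  gcongr
  refine sum_add_le_of_le (fun y => ?_) ?_
  · simp only [J_graft_child]
    split_ifs with hy
    · rw [hy]; exact le_self_add.trans h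
    · rfl
  · simp only [J_graft_child, if_true]
    exact h

/-- Different means make the two income distributions distinct, hence linearly independent since
both sum to one. A nonzero minor at two incomes realizes any pair of expectations. -/
theorem exists_direction (E : Env Y Φ) (a b : ℝ) :
    ∃ d : Y → ℝ, ∑ y, E.p Ty.h y * d y = a ∧ ∑ y, E.p Ty.l y * d y = b := by
  classical
  have : ∃ y₁ y₂, E.p Ty.h y₁ * E.p Ty.l y₂ - E.p Ty.h y₂ * E.p Ty.l y₁ ≠ 0 := by
    by_contra hc
    push Not at hc
    have h1 : ∀ y, E.p Ty.h y = E.p Ty.l y := fun y => by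
      have h2 : ∑ y₂, (E.p Ty.h y * E.p Ty.l y₂ - E.p Ty.h y₂ * E.p Ty.l y) = 0 :=
        Finset.sum_eq_zero fun y₂ _ => hc y y₂
      rw [Finset.sum_sub_distrib, ← Finset.mul_sum, ← Finset.sum_mul, E.p_sum, E.p_sum] at h2
      linarith
    have h2 := E.mean_lt
    simp only [h1] at h2
    exact h2.false
  obtain ⟨y₁, y₂, hD⟩ := this
  set D := E.p Ty.h y₁ * E.p Ty.l y₂ - E.p Ty.h y₂ * E.p Ty.l y₁ with hDdef
  refine ⟨Pi.single y₁ ((a * E.p Ty.l y₂ - b * E.p Ty.h y₂) / D) +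
    Pi.single y₂ ((b * E.p Ty.h y₁ - a * E.p Ty.l y₁) / D), ?_, ?_⟩
  · simp only [Pi.add_apply, mul_add, Finset.sum_add_distrib, Pi.single_apply, mul_ite, mul_zero,
      Finset.sum_ite_eq', mem_univ, if_true]
    field_simp
    rw [hDdef]; ring
  · simp only [Pi.add_apply, mul_add, Finset.sum_add_distrib, Pi.single_apply, mul_ite, mul_zero,
      Finset.sum_ite_eq', mem_univ, if_true]
    field_simp
    rw [hDdef]; ring

theorem avg_const (θ : Ty) (x : ℝ≥0∞) : E.avg θ (fun _ => x) = x := by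
  rw [avg, ← Finset.sum_mul, E.te_sum, one_mul]

/-- A constant consumption level that delivers the expected continuation utility at least cost. -/
theorem exists_avg_const {M : Mechanism Y Φ} {K : Hist Φ} (hT : (K.length : ℕ∞) < E.T)
    (hU : ∀ θ, E.U M (K, θ) ≠ ⊤) (θ : Ty) :
    ∃ c, E.ut c * E.ann K.length = E.avg θ (fun θ' => E.U M (K, θ')) ∧
      c * E.ann K.length ≤ E.avg θ (fun θ' => E.C M (K, θ')) := by
  obtain ⟨cl, hcl⟩ := exists_const hT (hU Ty.l)
  obtain ⟨ch, hch⟩ := exists_const hT (hU Ty.h)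
  have hl := const_le_C (s := (K, Ty.l)) hcl
  have hh := const_le_C (s := (K, Ty.h)) hch
  set a := (E.te θ Ty.l).toNNReal with ha
  set b := (E.te θ Ty.h).toNNReal with hb
  have ha' : (a : ℝ≥0∞) = E.te θ Ty.l := ENNReal.coe_toNNReal (E.te_ne_top _ _)
  have hb' : (b : ℝ≥0∞) = E.te θ Ty.h := ENNReal.coe_toNNReal (E.te_ne_top _ _)
  have hab : a + b = 1 := by
    have := E.te_sum θ
    rw [Ty.sum_eq, ← ha', ← hb'] at this
    exact_mod_cast this
  refine ⟨E.comb a b cl ch, ?_, ?_⟩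
  · rw [ut_comb _ hab, avg, Ty.sum_eq, ← hcl, ← hch, ← ha', ← hb']
    push_cast
    ring
  · have h1 : ((E.comb a b cl ch : ℝ≥0) : ℝ≥0∞) ≤ a * cl + b * ch := by
      exact_mod_cast E.comb_le hab _ _
    rw [avg, Ty.sum_eq, ← ha', ← hb']
    calc _ ≤ (a * cl + b * ch) * E.ann K.length := by gcongr
      _ = a * (cl * E.ann K.length) + b * (ch * E.ann K.length) := by ring
      _ ≤ _ := by gcongr

/-- The determinant of the transition matrix is the difference of the probabilities of becoming low
from low and from high, positive by persistence. -/
theorem trans_gap (E : Env Y Φ) : 0 < E.trans Ty.l Ty.l * E.trans Ty.h Ty.h -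
    E.trans Ty.l Ty.h * E.trans Ty.h Ty.l := by
  have h1 := E.trans_sum Ty.l
  have h2 := E.trans_sum Ty.h
  rw [Ty.sum_eq] at h1 h2
  have h3 := E.persistent Ty.l Ty.h (by decide)
  have h4 : E.trans Ty.l Ty.h = 1 - E.trans Ty.l Ty.l := by linarith
  have h5 : E.trans Ty.h Ty.h = 1 - E.trans Ty.h Ty.l := by linarith
  rw [h4, h5]
  linarith

theorem avg_toReal (θ : Ty) {X : Ty → ℝ≥0∞} (hX : ∀ θ, X θ ≠ ⊤) :
    (E.avg θ X).toReal = E.trans θ Ty.l * (X Ty.l).toReal + E.trans θ Ty.h * (X Ty.h).toReal := by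
  have h : ∀ θ', (E.te θ θ').toReal = E.trans θ θ' := fun θ' =>
    ENNReal.toReal_ofReal (E.trans_nonneg θ θ')
  have := E.te_ne_top θ
  have h1 := fun θ' => ENNReal.mul_ne_top (this θ') (hX θ')
  rw [avg, Ty.sum_eq, ENNReal.toReal_add (h1 _) (h1 _), ENNReal.toReal_mul, ENNReal.toReal_mul,
    h, h]

theorem avg_ne_top (θ : Ty) {X : Ty → ℝ≥0∞} (hX : ∀ θ, X θ ≠ ⊤) : E.avg θ X ≠ ⊤ :=
  ENNReal.sum_ne_top.2 fun θ' _ => ENNReal.mul_ne_top (E.te_ne_top _ _) (hX θ')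

theorem J_of_const_after {f : ℝ≥0 → ℝ≥0} {M : Mechanism Y Φ} {K : Hist Φ} {c : ℝ≥0}
    (h : ∀ s ∈ after K, M s.1 s.2 = fullCoverage c) {s : Hist Φ × Ty} (hs : s ∈ after K) :
    E.J f M s = f c * E.ann s.1.length :=
  J_of_const (η := s.1) (θ := s.2) (fun s' hs' => h s' (by
    rcases hs' with rfl | ⟨φ, hs'⟩
    · exact hs
    · exact (List.IsSuffix.trans hs (List.suffix_cons _ _)).trans hs')) (self_mem_sub _ _)

theorem dev_of_const_after {M : Mechanism Y Φ} {K : Hist Φ} {c : ℝ≥0}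
    (h : ∀ s ∈ after K, M s.1 s.2 = fullCoverage c) {η : Hist Φ} (hs : K <:+ η)
    (hT : (η.length : ℕ∞) < E.T) : E.dev M η = E.ut c * E.ann η.length :=
  dev_of_const hT fun s hs' => h s (by
    rcases hs' with rfl | ⟨φ, hs'⟩
    · exact hs
    · exact (hs.trans (List.suffix_cons _ _)).trans hs')

/-- A change of the continuation after one signal that costs no more cannot make the deviation of the
low type less attractive. -/
theorem Opt.avg_low_le {w : Ty → ℝ≥0∞} (hw : ∀ θ, w θ ≠ ⊤) {M : Mechanism Y Φ} (hM : E.Opt w M)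
    {η : Hist Φ} (hη : AllHigh η) (hT : (η.length : ℕ∞) < E.T)
    (hlt : E.U M (η, Ty.l) < E.U M (η, Ty.h)) {φ : Φ} {N : Mechanism Y Φ}
    (hH : E.avg Ty.h (fun θ' => E.U N ((φ, Ty.h) :: η, θ')) =
      E.avg Ty.h fun θ' => E.U M ((φ, Ty.h) :: η, θ'))
    (deeper : ∀ η' : Hist Φ, AllHigh η' → (φ, Ty.h) :: η <:+ η' → (η'.length : ℕ∞) < E.T →
      E.dev N η' ≤ E.U N (η', Ty.l))
    (hC : E.avg Ty.h (fun θ' => E.C N ((φ, Ty.h) :: η, θ')) ≤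
      E.avg Ty.h (fun θ' => E.C M ((φ, Ty.h) :: η, θ'))) :
    E.avg Ty.l (fun θ' => E.U M ((φ, Ty.h) :: η, θ')) ≤
      E.avg Ty.l (fun θ' => E.U N ((φ, Ty.h) :: η, θ')) := by
  obtain ⟨y₀, rfl⟩ := E.signal_surjective φ
  have hvar := Variation.of_child hM.feas hT hH deeper
  have hC' := C_graft_child_le (M := M) (N := N) (φ := E.signal y₀) (x := 0) hT (by rwa [add_zero])
  rw [add_zero] at hC'
  have h1 := hM.no_slack hw hη hT hlt hvar hC'
  by_contra hgt
  push Not at hgt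
  have h2 := (dev_graft_child_le (M := M) (N := N) (η := η) (y₀ := y₀)
    (add_tsub_cancel_of_le hgt.le).le).trans (hM.feas.osic η hη hT)
  refine (ENNReal.lt_add_right (ne_top_of_le_ne_top (hM.feas.U_ne_top hw hη Ty.l)
    (le_self_add.trans h2)) ?_).not_ge (h2.trans h1)
  exact mul_ne_zero E.de_ne_zero (mul_ne_zero (E.pe_ne_zero _ _) (tsub_pos_of_lt hgt).ne')

/-- If a high type gets more than a low type, then after the next signal she cannot get less. -/
theorem Opt.child_eq {w : Ty → ℝ≥0∞} (hw : ∀ θ, w θ ≠ ⊤) {M : Mechanism Y Φ} (hM : E.Opt w M)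
    {η : Hist Φ} (hη : AllHigh η) (hlt : E.U M (η, Ty.l) < E.U M (η, Ty.h)) {φ : Φ}
    (hTK : (((φ, Ty.h) :: η).length : ℕ∞) < E.T)
    (hle : E.U M ((φ, Ty.h) :: η, Ty.h) ≤ E.U M ((φ, Ty.h) :: η, Ty.l)) :
    E.U M ((φ, Ty.h) :: η, Ty.h) = E.U M ((φ, Ty.h) :: η, Ty.l) := by
  have hT : (η.length : ℕ∞) < E.T := lt_of_le_of_lt (by exact_mod_cast Nat.le_succ _) hTK
  have hU := fun θ => hM.feas.U_ne_top hw (hη.cons φ) θ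
  obtain ⟨c, hc1, hc2⟩ := exists_avg_const hTK hU Ty.h
  set K := (φ, Ty.h) :: η with hKdef
  -- The constant `c` keeps the high type's expected utility at no higher cost. If the low type got
  -- strictly more after the signal, a deviating low type, who is more likely to stay low, would
  -- lose from this averaging, against `Opt.avg_low_le`.
  set N : Mechanism Y Φ := fun _ _ => fullCoverage c with hN
  have hNc : ∀ s ∈ after K, N s.1 s.2 = fullCoverage c := fun _ _ => rfl
  have hJ : ∀ (f : ℝ≥0 → ℝ≥0) θ, E.J f N (K, θ) = f c * E.ann K.length :=
    fun f θ => J_of_const_after hNc (s := (K, θ)) List.suffix_rfl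
  have h1 := hM.avg_low_le hw hη hT hlt (φ := φ) (N := N)
    (by rw [← hc1]; simp only [U, ← hKdef, hJ, avg_const])
    (fun η' _ h2 h3 => by
      rw [dev_of_const_after hNc h2 h3, U, J_of_const_after hNc (s := (η', Ty.l)) h2])
    (by
      refine le_trans (le_of_eq ?_) hc2
      simp only [C, ← hKdef, hJ, avg_const]
      rfl)
  by_contra hne
  have hr := (ENNReal.toReal_lt_toReal (hU _) (hU _)).2 (lt_of_le_of_ne hle hne)
  refine h1.not_gt ?_
  simp only [U, ← hKdef, hJ, avg_const]
  rw [hc1, ← ENNReal.toReal_lt_toReal (avg_ne_top _ hU) (avg_ne_top _ hU), avg_toReal _ hU,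
    avg_toReal _ hU]
  have h1 := E.trans_sum Ty.l
  have h2 := E.trans_sum Ty.h
  rw [Ty.sum_eq] at h1 h2
  have h3 := E.persistent Ty.l Ty.h (by decide)
  have h4 : E.trans Ty.l Ty.h = 1 - E.trans Ty.l Ty.l := by linarith
  have h5 : E.trans Ty.h Ty.h = 1 - E.trans Ty.h Ty.l := by linarith
  rw [h4, h5]
  nlinarith

end Env

end

end Insurance

/-! ### Future type reward: separating equal continuation utilities -/

namespace Insurance

theorem AllHigh.eq_or_cons_suffix {Φ : Type*} {K η : Hist Φ} (h : AllHigh η) (hs : K <:+ η) :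
    η = K ∨ ∃ φ, (φ, Ty.h) :: K <:+ η := by
  induction η with
  | nil => left; exact (List.suffix_nil.1 hs).symm
  | cons x η ih =>
    rcases List.suffix_cons_iff.1 hs with rfl | hs
    · exact Or.inl rfl
    · have hx : x = (x.1, Ty.h) := Prod.ext rfl h.of_cons.1
      rcases ih h.of_cons.2 hs with rfl | ⟨φ, h'⟩
      · right; exact ⟨x.1, by rw [← hx]⟩
      · right; exact ⟨φ, h'.trans (List.suffix_cons _ _)⟩

noncomputable section

open Classical in
/-- The contract `z` for the high type at `K`, consumption `c'` after a low report at `K`, and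
consumption `c` after a high one. -/
def screen {Y Φ : Type*} (K : Hist Φ) (z : Flow Y) (c' c : ℝ≥0) : Mechanism Y Φ := fun η θ =>
  if (η, θ) = (K, Ty.h) then z else if (η, θ) ∈ sub K Ty.l then fullCoverage c' else fullCoverage c

theorem screen_high {Y Φ : Type*} (K : Hist Φ) (z : Flow Y) (c' c : ℝ≥0) : screen K z c' c K Ty.h = z :=
  if_pos rfl

theorem screen_low {Y Φ : Type*} {K : Hist Φ} (z : Flow Y) (c' c : ℝ≥0) {s : Hist Φ × Ty} (hs : s ∈ sub K Ty.l) :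
    screen K z c' c s.1 s.2 = fullCoverage c' := by
  have : s ≠ (K, Ty.h) := fun h => other_not_mem_sub K (θ := Ty.l) (by decide) (h ▸ hs)
  rw [screen, if_neg this, if_pos hs]

theorem screen_after {Y Φ : Type*} {K : Hist Φ} (z : Flow Y) (c' c : ℝ≥0) {φ : Φ} {s : Hist Φ × Ty}
    (hs : s ∈ after ((φ, Ty.h) :: K)) : screen K z c' c s.1 s.2 = fullCoverage c := by
  have h1 : s ≠ (K, Ty.h) := fun h => by
    rw [h] at hs
    have := List.IsSuffix.length_le hs
    simp at this
  have h2 : s ∉ sub K Ty.l := by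
    rintro (h | ⟨φ', h⟩)
    · rw [h] at hs
      have := List.IsSuffix.length_le hs
      simp at this
    · have := List.suffix_of_suffix_length_le hs h (by simp)
      have := this.eq_of_length (by simp)
      simp at this
  rw [screen, if_neg h1, if_neg h2]

namespace Env

variable {Y Φ : Type*} [Fintype Y] [Fintype Φ] {E : Env Y Φ}

theorem J_screen_low (f : ℝ≥0 → ℝ≥0) (K : Hist Φ) (z : Flow Y) (c' c : ℝ≥0) :
    E.J f (screen K z c' c) (K, Ty.l) = f c' * E.ann K.length :=
  J_of_const (fun _ hs => screen_low z c' c hs) (self_mem_sub _ _)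

theorem J_screen_next (f : ℝ≥0 → ℝ≥0) (K : Hist Φ) (z : Flow Y) (c' c : ℝ≥0) (φ : Φ) (θ : Ty) :
    E.J f (screen K z c' c) ((φ, Ty.h) :: K, θ) = f c * E.ann (K.length + 1) :=
  J_of_const_after (K := (φ, Ty.h) :: K) (fun _ hs => screen_after z c' c hs)
    (s := ((φ, Ty.h) :: K, θ)) List.suffix_rfl

theorem J_screen_high {f : ℝ≥0 → ℝ≥0} {K : Hist Φ} (hT : (K.length : ℕ∞) < E.T) (z : Flow Y)
    (c' c : ℝ≥0) : E.J f (screen K z c' c) (K, Ty.h) =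
      ∑ y, E.pe Ty.h y * (f (z y) : ℝ≥0∞) + E.de * (f c * E.ann (K.length + 1)) := by
  rw [J_rec' hT]
  simp only [J_screen_next, avg_const, ← Finset.sum_mul, E.pe_sum, one_mul]
  simp only [flow, id, screen_high]

theorem dev_screen (K : Hist Φ) (z : Flow Y)
    (c' c : ℝ≥0) : E.dev (screen K z c' c) K =
      ∑ y, E.pe Ty.l y * (E.ut (z y) : ℝ≥0∞) + E.de * (E.ut c * E.ann (K.length + 1)) := by
  rw [dev_eq']
  simp only [U, J_screen_next, avg_const, ← Finset.sum_mul, E.pe_sum, one_mul]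
  simp only [flow, screen_high]

theorem ann_toReal {n : ℕ} (h : (n : ℕ∞) < E.T) :
    (E.ann n).toReal = 1 + (E.de * E.ann (n + 1)).toReal := by
  have h1 := E.ann_ne_top (n + 1)
  have h2 := E.de_ne_top
  rw [ann, annuity_rec h, ENNReal.toReal_add (by simp) (by finiteness), ENNReal.toReal_one]

theorem sum_p_toReal (θ : Ty) (x : Y → ℝ≥0) :
    (∑ y, E.pe θ y * (x y : ℝ≥0∞)).toReal = ∑ y, E.p θ y * (x y : ℝ) := by
  rw [sum_p_ofReal, ENNReal.toReal_ofReal (E.sum_p_nonneg θ x)]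

theorem sum_p_ne_top (θ : Ty) (x : Y → ℝ≥0) : ∑ y, E.pe θ y * (x y : ℝ≥0∞) ≠ ⊤ := by
  rw [sum_p_ofReal]; exact ENNReal.ofReal_ne_top

theorem sum_chain_toReal {n : ℕ} (hT : (n : ℕ∞) < E.T) (θ : Ty) (x : Y → ℝ≥0) (r : ℝ≥0) :
    (∑ y, E.pe θ y * (x y : ℝ≥0∞) + E.de * (r * E.ann (n + 1))).toReal =
      ∑ y, E.p θ y * (x y : ℝ) + r * ((E.ann n).toReal - 1) := by
  have h1 := E.ann_ne_top (n + 1)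
  have h2 := E.de_ne_top
  rw [ENNReal.toReal_add (sum_p_ne_top _ _) (by finiteness), sum_p_toReal, ann_toReal hT]
  have : E.de * (r * E.ann (n + 1)) = r * (E.de * E.ann (n + 1)) := by ring
  rw [this, ENNReal.toReal_mul, ENNReal.coe_toReal]
  ring

theorem sum_chain_ne_top (n : ℕ) (θ : Ty) (x : Y → ℝ≥0) (r : ℝ≥0) :
    ∑ y, E.pe θ y * (x y : ℝ≥0∞) + E.de * (r * E.ann (n + 1)) ≠ ⊤ := by
  have h1 := E.ann_ne_top (n + 1)
  have h2 := E.de_ne_top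
  exact ENNReal.add_ne_top.2 ⟨sum_p_ne_top _ _, by finiteness⟩

/-- If a high type gets more than a low type, then after the next signal both types get the same
continuation utility only if it is the least possible one. -/
theorem Opt.child_eq_zero {w : Ty → ℝ≥0∞} (hw : ∀ θ, w θ ≠ ⊤) {M : Mechanism Y Φ}
    (hM : E.Opt w M) {η : Hist Φ} (hη : AllHigh η) (hlt : E.U M (η, Ty.l) < E.U M (η, Ty.h)) {φ : Φ}
    (hTK : (((φ, Ty.h) :: η).length : ℕ∞) < E.T)
    (heq : E.U M ((φ, Ty.h) :: η, Ty.h) = E.U M ((φ, Ty.h) :: η, Ty.l)) :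
    E.U M ((φ, Ty.h) :: η, Ty.h) = 0 := by
  by_contra hne
  have hT : (η.length : ℕ∞) < E.T := lt_of_le_of_lt (by exact_mod_cast Nat.le_succ _) hTK
  obtain ⟨y₀, rfl⟩ := E.signal_surjective φ
  set K := (E.signal y₀, Ty.h) :: η with hKdef
  have hU := fun θ => hM.feas.U_ne_top hw (hη.cons (E.signal y₀)) θ
  obtain ⟨c, hc1, hc2⟩ := exists_avg_const hTK hU Ty.h
  have hall : ∀ θ, E.U M (K, θ) = E.U M (K, Ty.l) := fun θ => by
    cases θ
    · rfl
    · exact heq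
  have havg : ∀ θ, E.avg θ (fun θ' => E.U M (K, θ')) = E.ut c * E.ann K.length := fun θ => by
    rw [hc1]; simp only [hall, avg_const]
  have hc0 : c ≠ 0 := by
    rintro rfl
    rw [E.ut_zero] at hc1
    simp only [hall, avg_const, ENNReal.coe_zero, zero_mul] at hc1
    exact hne (heq.trans hc1.symm)
  obtain ⟨ρ, hρ, hQ⟩ := hM.slack_value hw hη hT hlt
  set n := (E.ann K.length).toReal with hn
  have hnfin := E.ann_ne_top K.length
  have hn1 : 1 ≤ n := by
    rw [hn, ann_toReal hTK]
    exact le_add_of_nonneg_right ENNReal.toReal_nonneg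
  set thh := E.trans Ty.h Ty.h with hthh
  set thl := E.trans Ty.h Ty.l with hthl
  set tll := E.trans Ty.l Ty.l with htll
  set tlh := E.trans Ty.l Ty.h with htlh
  have hth : thl + thh = 1 := by have := E.trans_sum Ty.h; rwa [Ty.sum_eq] at this
  have htl : tll + tlh = 1 := by have := E.trans_sum Ty.l; rwa [Ty.sum_eq] at this
  have hthl0 : 0 ≤ thl := E.trans_nonneg _ _
  have hthh0 : 0 ≤ thh := E.trans_nonneg _ _
  have htll0 : 0 ≤ tll := E.trans_nonneg _ _
  have htlh0 : 0 ≤ tlh := E.trans_nonneg _ _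
  have hgap : 0 < tll * thh - tlh * thl := trans_gap E
  set m := E.marginal c with hm
  have hmpos : 0 < m := E.marginal_pos c
  -- Per unit of `ε`, at `K` the high type gains `thl` while a low type loses `thh`, whether she
  -- reports high or low. The expectation after a high type is unchanged, the constraint at `K`
  -- stays an equality, and the expectation after a low type falls by the determinant. Starting from
  -- common consumption `c`, expected cost after a high type is unchanged to first order.
  obtain ⟨d, hdh, hdl⟩ := exists_direction E thl (-thh)
  -- The deviation payoff at `η` falls by at least `ε * σ`.
  set σ := E.δ * (E.p Ty.l y₀ * (tll * thh - tlh * thl)) with hσ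
  have hσpos : 0 < σ := mul_pos E.δ_pos (mul_pos (E.p_pos _ _) hgap)
  have hσ1 : σ ≤ 1 := by
    have h1 : E.p Ty.l y₀ ≤ 1 := by
      rw [← E.p_sum Ty.l]
      exact Finset.single_le_sum (f := E.p Ty.l) (fun y _ => (E.p_pos _ y).le) (mem_univ y₀)
    have h2 : tll * thh - tlh * thl ≤ 1 := by nlinarith
    have h3 : E.p Ty.l y₀ * (tll * thh - tlh * thl) ≤ 1 :=
      mul_le_one₀ h1 hgap.le h2
    exact mul_le_one₀ E.δ_lt_one.le (mul_nonneg (E.p_pos _ _).le hgap.le) h3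
  -- The cost error `ε * κ * (n + 1)` is then half of `ρ * (ε * σ)`, the value of the slack created.
  set κ := ρ * σ / (2 * (n + 1)) with hκ
  have hκpos : 0 < κ := by positivity
  have hev1 : ∀ᶠ ε in nhdsWithin (0 : ℝ) (Set.Ioi 0), ∀ y, ∃ c' : ℝ≥0,
      (E.ut c' : ℝ) = E.ut c + ε * d y ∧ (c' : ℝ) ≤ c + ε * (d y / m + κ) :=
    eventually_all.2 fun y => E.eventually_exists_ut (fun h => absurd h hc0) hκpos
  -- The low type's loss is spread evenly over the remaining periods, whose present value is `n`.
  -- Positivity of `c` is what permits a reduction.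
  have hev2 := E.eventually_exists_ut (c := c) (d := -thh / n) (fun h => absurd h hc0) hκpos
  have hev3 : ∀ᶠ ε in nhdsWithin (0 : ℝ) (Set.Ioi 0), ε ≤ 1 :=
    nhdsWithin_le_nhds (eventually_le_nhds one_pos)
  have hev4 : ∀ᶠ ε in nhdsWithin (0 : ℝ) (Set.Ioi 0), (0 : ℝ) < ε := self_mem_nhdsWithin
  obtain ⟨ε, hz, ⟨c', hc'1, hc'2⟩, hε1, hε0⟩ := (hev1.and (hev2.and (hev3.and hev4))).exists
  rw [← hm] at hc'2
  choose z hz1 hz2 using hz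
  have hsum : ∀ θ, ∑ y, E.p θ y * (E.ut (z y) : ℝ) = E.ut c + ε * ∑ y, E.p θ y * d y := fun θ => by
    simp only [hz1, mul_add, Finset.sum_add_distrib, ← Finset.sum_mul, E.p_sum, one_mul,
      Finset.mul_sum]
    congr 1
    exact Finset.sum_congr rfl fun y _ => by ring
  set N := screen (Φ := Φ) K z c' c with hN
  have hUl : (E.U N (K, Ty.l)).toReal = E.ut c * n - ε * thh := by
    rw [U, J_screen_low, ENNReal.toReal_mul, ENNReal.coe_toReal, hc'1, ← hn]
    field_simp
    ring
  have hUh : (E.U N (K, Ty.h)).toReal = E.ut c * n + ε * thl := by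
    rw [U, J_screen_high hTK, sum_chain_toReal hTK, hsum, hdh]
    ring
  have hdev : (E.dev N K).toReal = E.ut c * n - ε * thh := by
    rw [dev_screen, sum_chain_toReal hTK, hsum, hdl]
    ring
  have hUfin : ∀ θ, E.U N (K, θ) ≠ ⊤ := fun θ => by
    cases θ
    · rw [U, J_screen_low]; finiteness
    · rw [U, J_screen_high hTK]; exact sum_chain_ne_top _ _ _ _
  have hdevfin : E.dev N K ≠ ⊤ := by rw [dev_screen]; exact sum_chain_ne_top _ _ _ _
  have hCfin : ∀ θ, E.C N (K, θ) ≠ ⊤ := fun θ => by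
    cases θ
    · rw [C, J_screen_low]; finiteness
    · rw [C, J_screen_high hTK]; exact sum_chain_ne_top _ _ (fun y => id (z y)) _
  have hcfin : E.ut c * E.ann K.length ≠ ⊤ := by finiteness
  have hvar : E.Variation M (graft (after K) M N) η := by
    refine Variation.of_child hM.feas hT ?_ fun η' h1 h2 h3 => ?_
    · rw [← hKdef, havg, ← ENNReal.toReal_eq_toReal_iff' (avg_ne_top _ hUfin) hcfin,
        avg_toReal _ hUfin, hUl, hUh, ENNReal.toReal_mul, ENNReal.coe_toReal, ← hn]
      change thl * _ + thh * _ = _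
      linear_combination (E.ut c * n) * hth
    · rw [← hKdef] at h2
      rcases h1.eq_or_cons_suffix h2 with rfl | ⟨φ, h4⟩
      · rw [← ENNReal.toReal_le_toReal hdevfin (hUfin _), hdev, hUl]
      · have h5 : ∀ s ∈ after ((φ, Ty.h) :: K), N s.1 s.2 = fullCoverage c := fun _ hs =>
          screen_after z c' c hs
        rw [dev_of_const_after h5 h4 h3, U, J_of_const_after h5 (s := (η', Ty.l)) h4]
  have hC : E.avg Ty.h (fun θ' => E.C N (K, θ')) ≤ E.avg Ty.h (fun θ' => E.C M (K, θ')) +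
      ENNReal.ofReal (ε * κ * (n + 1)) := by
    refine le_trans ?_ (add_le_add hc2 le_rfl)
    rw [← ENNReal.toReal_le_toReal (avg_ne_top _ hCfin) (by finiteness), avg_toReal _ hCfin,
      ENNReal.toReal_add (by finiteness) (by finiteness), ENNReal.toReal_mul, ENNReal.coe_toReal,
      ENNReal.toReal_ofReal (by positivity), ← hn]
    change thl * _ + thh * _ ≤ _
    have h1 : (E.C N (K, Ty.l)).toReal = c' * n := by
      rw [C, J_screen_low, ENNReal.toReal_mul, ENNReal.coe_toReal]; rfl
    have h2 : (E.C N (K, Ty.h)).toReal ≤ c * n + ε * (thl / m + κ) := by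
      rw [C, J_screen_high hTK, sum_chain_toReal hTK Ty.h (fun y => id (z y))]
      have h3 : ∑ y, E.p Ty.h y * (z y : ℝ) ≤ ∑ y, E.p Ty.h y * (c + ε * (d y / m + κ)) :=
        Finset.sum_le_sum fun y _ => mul_le_mul_of_nonneg_left (hz2 y) (E.p_pos _ _).le
      have h4 : ∑ y, E.p Ty.h y * ((c : ℝ) + ε * (d y / m + κ)) = c + ε * (thl / m + κ) := by
        have h5 : ∀ y, E.p Ty.h y * ((c : ℝ) + ε * (d y / m + κ)) =
          E.p Ty.h y * (c + ε * κ) + E.p Ty.h y * d y * (ε / m) := fun y => by ring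
        simp only [h5, Finset.sum_add_distrib, ← Finset.sum_mul, E.p_sum, hdh]
        ring
      simp only [id]
      linarith
    rw [h1]
    have h3 : (c' : ℝ) * n ≤ c * n + ε * (-thh / m + κ * n) := by
      have h4 := mul_le_mul_of_nonneg_right hc'2 (by linarith : 0 ≤ n)
      refine h4.trans (le_of_eq ?_)
      field_simp
    have h4 := mul_le_mul_of_nonneg_left h3 hthl0
    have h5 := mul_le_mul_of_nonneg_left h2 hthh0
    have h6 : thl * (c * n + ε * (-thh / m + κ * n)) + thh * (c * n + ε * (thl / m + κ)) =
        c * n + ε * κ * (thl * n + thh) := by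
      linear_combination (c * n) * hth
    have h7 : ε * κ * (thl * n + thh) ≤ ε * κ * (n + 1) := by
      refine mul_le_mul_of_nonneg_left ?_ (by positivity)
      nlinarith
    linarith
  have hCη := C_graft_child_le (M := M) (N := N) hT hC
  have hx0 : 0 ≤ ε * (tll * thh - tlh * thl) := by positivity
  have hD : E.avg Ty.l (fun θ' => E.U N (K, θ')) + ENNReal.ofReal (ε * (tll * thh - tlh * thl)) ≤
      E.avg Ty.l (fun θ' => E.U M (K, θ')) := by
    have h1 := avg_ne_top (E := E) Ty.l hUfin
    rw [havg, ← ENNReal.toReal_le_toReal (by finiteness) hcfin,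
      ENNReal.toReal_add h1 (by finiteness), avg_toReal _ hUfin,
      hUl, hUh, ENNReal.toReal_mul, ENNReal.coe_toReal, ← hn, ENNReal.toReal_ofReal hx0]
    change tll * _ + tlh * _ + _ ≤ _
    refine le_of_eq ?_
    linear_combination (E.ut c * n) * htl
  have hDη := (dev_graft_child_le (M := M) (N := N) (η := η) (y₀ := y₀) hD).trans
    (hM.feas.osic η hη hT)
  have hx : E.de * (E.pe Ty.l y₀ * ENNReal.ofReal (ε * (tll * thh - tlh * thl))) =
      ENNReal.ofReal (ε * σ) := by
    rw [pe, de, ← ENNReal.ofReal_mul (E.p_pos _ _).le, ← ENNReal.ofReal_mul E.δ_pos.le, hσ]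
    congr 1
    ring
  rw [hx] at hDη
  have hfinal := (hQ _ hvar (ε * σ) (by positivity) (mul_le_one₀ hε1 hσpos.le hσ1) hDη).trans hCη
  rw [ENNReal.add_le_add_iff_left (hM.C_ne_top (onPath_high hη)),
    ENNReal.ofReal_le_ofReal_iff (by positivity)] at hfinal
  have h1 : ε * κ * (n + 1) = ρ * (ε * σ) / 2 := by
    rw [hκ]; field_simp
  have h2 : 0 < ρ * (ε * σ) := by positivity
  linarith

/-- High types get more than low types, unless both get the least possible utility. -/
theorem Opt.typeReward {w : Ty → ℝ≥0∞} (hw : ∀ θ, w θ ≠ ⊤) (hwlt : w Ty.l < w Ty.h)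
    {M : Mechanism Y Φ} (hM : E.Opt w M) {η : Hist Φ} (hη : AllHigh η)
    (hT : (η.length : ℕ∞) < E.T) :
    E.U M (η, Ty.l) < E.U M (η, Ty.h) ∨ (E.U M (η, Ty.l) = 0 ∧ E.U M (η, Ty.h) = 0) := by
  induction η with
  | nil => left; rwa [hM.feas.delivers, hM.feas.delivers]
  | cons x η ih =>
    have hT' : (η.length : ℕ∞) < E.T := lt_of_le_of_lt (by exact_mod_cast Nat.le_succ _) hT
    obtain ⟨φ, r⟩ := x
    obtain ⟨rfl, hη'⟩ : r = Ty.h ∧ AllHigh η := hη.of_cons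
    rcases ih hη' hT' with h | ⟨h1, h2⟩
    · by_contra hcon
      push Not at hcon
      have h1 := hM.child_eq hw hη' h hT hcon.1
      have h2 := hM.child_eq_zero hw hη' h hT h1
      exact hcon.2 (h1 ▸ h2) h2
    -- Zero utilities stay zero. For the low type after the next signal this goes through the
    -- deviation payoff at `η`, which the constraint bounds by zero.
    · right
      obtain ⟨y, rfl⟩ := E.signal_surjective φ
      have h3 := hM.feas.osic η hη' hT'
      rw [h1, nonpos_iff_eq_zero, dev_eq, add_eq_zero, mul_eq_zero] at h3
      have h4 := h3.2.resolve_left E.de_ne_zero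
      rw [U, J_rec _ _ _ hT', add_eq_zero, mul_eq_zero] at h2
      have h5 := h2.2.resolve_left E.de_ne_zero
      rw [Finset.sum_eq_zero_iff] at h4 h5
      constructor
      · exact (mul_eq_zero.1 (h4 (y, Ty.l) (mem_univ _))).resolve_left
          (mul_ne_zero (E.pe_ne_zero _ _) (E.te_self_ne_zero _))
      · exact (mul_eq_zero.1 (h5 (y, Ty.h) (mem_univ _))).resolve_left
          (mul_ne_zero (E.pe_ne_zero _ _) (E.te_self_ne_zero _))

end Env

end

end Insurance

/-! ### Signal effect: swapping continuations between signals -/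

namespace Insurance

/-- The mechanism that continues after `K` as `M` does after `K'`. -/
def move {Y Φ : Type*} (K K' : Hist Φ) (M : Mechanism Y Φ) : Mechanism Y Φ :=
  fun ζ θ => M (ζ.take (ζ.length - K.length) ++ K') θ

theorem move_append {Y Φ : Type*} (K K' : Hist Φ) (M : Mechanism Y Φ) (ζ : Hist Φ) (θ : Ty) :
    move K K' M (ζ ++ K) θ = M (ζ ++ K') θ := by
  simp [move]

theorem AllHigh.append {Φ : Type*} {K K' ζ : Hist Φ} (h : AllHigh (ζ ++ K)) (h' : AllHigh K') :
    AllHigh (ζ ++ K') := by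
  intro x hx
  rcases List.mem_append.1 hx with hx | hx
  · exact h x (List.mem_append_left _ hx)
  · exact h' x hx

noncomputable section

namespace Env

variable {Y Φ : Type*} [Fintype Y] [Fintype Φ] {E : Env Y Φ}

theorem J_move (f : ℝ≥0 → ℝ≥0) {K K' : Hist Φ} (hl : K'.length = K.length) (M : Mechanism Y Φ)
    (ζ : Hist Φ) (θ : Ty) : E.J f (move K K' M) (ζ ++ K, θ) = E.J f M (ζ ++ K', θ) := by
  have := Proc.tot_map (p := E.proc 0 id) (p' := E.proc 0 id)
    (fun s => (s.1.take (s.1.length - K.length) ++ K', s.2)) (fun s => s ∈ after K)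
    (fun s i hs _ => List.IsSuffix.trans hs (List.suffix_cons _ _)) rfl rfl ?_ ?_ ?_
    (f := E.flow f id (move K K' M)) (f' := E.flow f id M) ?_ (s := (ζ ++ K, θ))
    (List.suffix_append _ _)
  · rw [J, J, ← this]
    simp
  · rintro ⟨_, θ⟩ ⟨ζ, rfl⟩
    simp [hl]
  · intro s i _
    rfl
  · rintro ⟨_, θ⟩ i ⟨ζ, rfl⟩ _
    have : ζ.length + K.length + 1 - K.length = ζ.length + 1 := by omega
    simp [this]
  · rintro ⟨_, θ⟩ ⟨ζ, rfl⟩ _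
    simp only [flow, id, move_append]
    simp

theorem dev_move {K K' : Hist Φ} (hl : K'.length = K.length) (M : Mechanism Y Φ) (ζ : Hist Φ) :
    E.dev (move K K' M) (ζ ++ K) = E.dev M (ζ ++ K') := by
  rw [dev_eq, dev_eq]
  simp only [flow, move_append]
  refine congrArg₂ _ rfl (congrArg₂ _ rfl (Finset.sum_congr rfl fun i _ => congrArg₂ _ rfl ?_))
  exact J_move _ hl M ((E.signal i.1, Ty.h) :: ζ) i.2

theorem move_osic {w : Ty → ℝ≥0∞} {M : Mechanism Y Φ} (hM : E.Feas w M) {K K' : Hist Φ}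
    (hl : K'.length = K.length) (hK' : AllHigh K') {η' : Hist Φ} (h1 : AllHigh η')
    (h2 : K <:+ η') (h3 : (η'.length : ℕ∞) < E.T) :
    E.dev (move K K' M) η' ≤ E.U (move K K' M) (η', Ty.l) := by
  obtain ⟨ζ, rfl⟩ := h2
  rw [dev_move hl, U, J_move _ hl]
  exact hM.osic _ (h1.append hK') (by simpa [hl] using h3)

theorem onPath_cons {φ : Φ} {ζ : Hist Φ} {θ θ' : Ty} :
    E.OnPath ((φ, θ) :: ζ) θ' ↔ 0 < E.trans θ θ' ∧ E.OnPath ζ θ := by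
  rw [OnPath, List.map_cons, List.isChain_cons_cons, OnPath]

theorem J_congr_onPath {f : ℝ≥0 → ℝ≥0} {M N : Mechanism Y Φ} {K : Hist Φ}
    (h : ∀ s ∈ after K, E.OnPath s.1 s.2 → (s.1.length : ℕ∞) < E.T → M s.1 s.2 = N s.1 s.2)
    {s : Hist Φ × Ty} (hs : s ∈ after K) (hp : E.OnPath s.1 s.2) : E.J f M s = E.J f N s := by
  refine Proc.tot_congr_on (p := E.proc 0 id) (fun s => s ∈ after K ∧ E.OnPath s.1 s.2)
    (fun s i hs hi => ⟨List.IsSuffix.trans hs.1 (List.suffix_cons _ _), ?_⟩) (fun s hs hT => ?_)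
    ⟨hs, hp⟩
  · rw [proc_nx, onPath_cons]
    exact ⟨(E.te_ne_zero_iff _ _).1 (right_ne_zero_of_mul hi), hs.2⟩
  · simp only [flow, id, h s hs.1 hs.2 (by simpa using hT)]

open Classical in
/-- Total weight of the incomes with signal `φ`. -/
def mass (E : Env Y Φ) (θ : Ty) (φ : Φ) : ℝ≥0∞ := ∑ y with E.signal y = φ, E.pe θ y

theorem sum_signal (θ : Ty) (F : Φ → ℝ≥0∞) :
    ∑ y, E.pe θ y * F (E.signal y) = ∑ φ, E.mass θ φ * F φ := by
  classical
  rw [← Finset.sum_fiberwise (s := univ) (g := E.signal)]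
  refine Finset.sum_congr rfl fun φ _ => ?_
  rw [mass, Finset.sum_mul]
  refine Finset.sum_congr (by ext; simp) fun y hy => ?_
  rw [(Finset.mem_filter.1 hy).2]

theorem mass_ne_zero (θ : Ty) (φ : Φ) : E.mass θ φ ≠ 0 := by
  obtain ⟨y, hy⟩ := E.signal_surjective φ
  intro h
  rw [mass, Finset.sum_eq_zero_iff] at h
  exact E.pe_ne_zero θ y (h y (by simp [hy]))

theorem sum_mass (θ : Ty) : ∑ φ, E.mass θ φ = 1 := by
  have := E.sum_signal θ fun _ => 1
  simpa [E.pe_sum] using this.symm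

theorem mass_ne_top (θ : Ty) (φ : Φ) : E.mass θ φ ≠ ⊤ :=
  ENNReal.sum_ne_top.2 fun y _ => E.pe_ne_top θ y

theorem lrSignal_eq (φ : Φ) :
    E.lrSignal φ = (E.mass Ty.l φ).toReal / (E.mass Ty.h φ).toReal := by
  classical
  have h : ∀ θ, (E.mass θ φ).toReal = ∑ y with E.signal y = φ, E.p θ y := fun θ => by
    rw [mass, ENNReal.toReal_sum fun y _ => E.pe_ne_top θ y]
    exact Finset.sum_congr rfl fun y _ => ENNReal.toReal_ofReal (E.p_pos θ y).le
  rw [lrSignal, h, h]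

theorem sum_le_of_two {W F F' : Φ → ℝ≥0∞} {φ φ' : Φ} (hne : φ ≠ φ')
    (h : ∀ ψ, ψ ≠ φ → ψ ≠ φ' → F' ψ ≤ F ψ)
    (h2 : W φ * F' φ + W φ' * F' φ' ≤ W φ * F φ + W φ' * F φ') :
    ∑ ψ, W ψ * F' ψ ≤ ∑ ψ, W ψ * F ψ := by
  classical
  have e : ∀ G : Φ → ℝ≥0∞, ∑ ψ, W ψ * G ψ =
      (W φ * G φ + W φ' * G φ') + ∑ ψ ∈ (univ.erase φ).erase φ', W ψ * G ψ := fun G => by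
    rw [add_assoc, Finset.add_sum_erase _ (fun ψ => W ψ * G ψ) (by simp [hne.symm]),
      Finset.add_sum_erase _ (fun ψ => W ψ * G ψ) (mem_univ φ)]
  rw [e, e]
  refine add_le_add h2 (Finset.sum_le_sum fun ψ hψ => ?_)
  simp only [Finset.mem_erase, mem_univ, and_true] at hψ
  gcongr
  exact h ψ hψ.2 hψ.1

theorem avg_linear (θ : Ty) (a b : ℝ≥0∞) (X X' : Ty → ℝ≥0∞) :
    E.avg θ (fun θ' => a * X θ' + b * X' θ') = a * E.avg θ X + b * E.avg θ X' := by
  simp only [avg, Ty.sum_eq]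
  ring

theorem avg_mono (θ : Ty) {X X' : Ty → ℝ≥0∞} (h : ∀ θ', X θ' ≤ X' θ') :
    E.avg θ X ≤ E.avg θ X' := by
  unfold avg
  gcongr with θ'
  exact h θ'

/-- Continuation utilities are higher after signals with a lower likelihood ratio. -/
theorem Opt.signalEffect {w : Ty → ℝ≥0∞} (hw : ∀ θ, w θ ≠ ⊤) {M : Mechanism Y Φ} (hM : E.Opt w M)
    {η : Hist Φ} (hη : AllHigh η) (hlt : E.U M (η, Ty.l) < E.U M (η, Ty.h))
    (hT : (η.length : ℕ∞) < E.T) {φ φ' : Φ} (hlr : E.lrSignal φ' ≤ E.lrSignal φ) :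
    E.avg Ty.l (fun θ' => E.U M ((φ, Ty.h) :: η, θ')) ≤
      E.avg Ty.l (fun θ' => E.U M ((φ', Ty.h) :: η, θ')) := by
  classical
  by_cases hne : φ = φ'
  · rw [hne]
  set K := (φ, Ty.h) :: η with hK
  set K' := (φ', Ty.h) :: η with hK'
  have hl : K'.length = K.length := by simp [hK, hK']
  have hKh : AllHigh K := hη.cons φ
  have hKh' : AllHigh K' := hη.cons φ'
  have hU := fun θ => hM.feas.U_ne_top hw hKh θ
  have hU' := fun θ => hM.feas.U_ne_top hw hKh' θ
  have hmv : ∀ (f : ℝ≥0 → ℝ≥0) θ, E.J f (move K K' M) (K, θ) = E.J f M (K', θ) :=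
    fun f θ => J_move f hl M [] θ
  have hmv' : ∀ (f : ℝ≥0 → ℝ≥0) θ, E.J f (move K' K M) (K', θ) = E.J f M (K, θ) :=
    fun f θ => J_move f hl.symm M [] θ
  by_contra hlow
  push Not at hlow
  set P := E.mass Ty.h φ with hP
  set P' := E.mass Ty.h φ' with hP'
  have hPP : P + P' ≤ 1 := by
    rw [← E.sum_mass Ty.h, ← Finset.sum_pair hne]
    exact Finset.sum_le_sum_of_subset (Finset.subset_univ _)
  -- After `φ` the continuation of `φ'` is used with weight `P'`, and after `φ'` that of `φ` with
  -- weight `P`. For a high type the mass `P * P'` is exchanged in both directions, so her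
  -- expectations are preserved (`hswap`).
  set a := P'.toNNReal with ha
  set b := P.toNNReal with hb
  have haE : (a : ℝ≥0∞) = P' := ENNReal.coe_toNNReal (mass_ne_top _ _)
  have hbE : (b : ℝ≥0∞) = P := ENNReal.coe_toNNReal (mass_ne_top _ _)
  have hba : b + a ≤ 1 := by
    rw [← haE, ← hbE] at hPP
    exact_mod_cast hPP
  have ha0 : a ≠ 0 := fun h => mass_ne_zero (E := E) Ty.h φ' (by rw [← hP', ← haE, h]; rfl)
  set a' := 1 - a with ha'
  set b' := 1 - b with hb'
  have hab : a' + a = 1 := tsub_add_cancel_of_le (le_add_self.trans hba)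
  have hbb : b' + b = 1 := tsub_add_cancel_of_le (le_self_add.trans hba)
  have habE : (a' : ℝ≥0∞) + a = 1 := by exact_mod_cast hab
  have hbbE : (b' : ℝ≥0∞) + b = 1 := by exact_mod_cast hbb
  set N := E.mix a' a M (move K K' M) with hN
  set N' := E.mix b' b M (move K' K M) with hN'
  set M' := graft (after K) (graft (after K') M N') N with hM'
  have hUN : ∀ θ, E.U N (K, θ) = a' * E.U M (K, θ) + a * E.U M (K', θ) := fun θ => by
    exact (U_mix hab _ _ _).trans (congrArg _ (congrArg _ (hmv E.ut θ)))
  have hUN' : ∀ θ, E.U N' (K', θ) = b' * E.U M (K', θ) + b * E.U M (K, θ) := fun θ => by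
    exact (U_mix hbb _ _ _).trans (congrArg _ (congrArg _ (hmv' E.ut θ)))
  have hCN : ∀ θ, E.C N (K, θ) ≤ a' * E.C M (K, θ) + a * E.C M (K', θ) := fun θ => by
    exact (C_mix_le hab _ _ _).trans_eq (congrArg _ (congrArg _ (hmv id θ)))
  have hCN' : ∀ θ, E.C N' (K', θ) ≤ b' * E.C M (K', θ) + b * E.C M (K, θ) := fun θ => by
    exact (C_mix_le hbb _ _ _).trans_eq (congrArg _ (congrArg _ (hmv' id θ)))
  have hJ1 : ∀ (f : ℝ≥0 → ℝ≥0) θ, E.J f M' (K, θ) = E.J f N (K, θ) := fun f θ =>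
    J_graft_mem (s := (K, θ)) List.suffix_rfl
  have hKne : K' ≠ K := by simp [hK, hK', Ne.symm hne]
  have hJ2 : ∀ (f : ℝ≥0 → ℝ≥0) θ, E.J f M' (K', θ) = E.J f N' (K', θ) := fun f θ => by
    rw [hM', J_graft_other hl hKne (s := (K', θ)) List.suffix_rfl]
    exact J_graft_mem (s := (K', θ)) List.suffix_rfl
  have hother : ∀ ψ, ψ ≠ φ → ψ ≠ φ' → ∀ s ∈ after ((ψ, Ty.h) :: η), M' s.1 s.2 = M s.1 s.2 := by
    intro ψ h1 h2 s hs
    rw [hM', graft_of_not_mem (not_mem_after_of_ne (L := (ψ, Ty.h) :: η) (by simp [hK])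
      (by simp [hK, h1]) hs), graft_of_not_mem (not_mem_after_of_ne (L := (ψ, Ty.h) :: η)
      (by simp [hK']) (by simp [hK', h2]) hs)]
  have hJ3 : ∀ (f : ℝ≥0 → ℝ≥0) ψ, ψ ≠ φ → ψ ≠ φ' → ∀ θ,
      E.J f M' ((ψ, Ty.h) :: η, θ) = E.J f M ((ψ, Ty.h) :: η, θ) := fun f ψ h1 h2 θ =>
    J_congr_after (hother ψ h1 h2) (s := ((ψ, Ty.h) :: η, θ)) List.suffix_rfl
  have hself : ∀ θ, M' η θ = M η θ := fun θ => by
    rw [hM', hK, graft_child_agree, hK', graft_child_agree]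
  have hswap : ∀ X X' : ℝ≥0∞, P * (a' * X + a * X') + P' * (b' * X' + b * X) = P * X + P' * X' := by
    intro X X'
    calc _ = (P * a' + P' * b) * X + (P * a + P' * b') * X' := by ring
      _ = (P * a' + P * a) * X + (P' * b + P' * b') * X' := by
        rw [haE, hbE]; ring
      _ = _ := by rw [← mul_add, ← mul_add, habE, add_comm (b : ℝ≥0∞), hbbE, mul_one, mul_one]
  have hUavg : ∀ θ, E.avg θ (fun θ' => E.U M' (K, θ')) = a' * E.avg θ (fun θ' => E.U M (K, θ')) +
      a * E.avg θ (fun θ' => E.U M (K', θ')) := fun θ => by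
    rw [← avg_linear]
    refine congrArg _ (funext fun θ' => ?_)
    exact (hJ1 E.ut θ').trans (hUN θ')
  have hUavg' : ∀ θ, E.avg θ (fun θ' => E.U M' (K', θ')) =
      b' * E.avg θ (fun θ' => E.U M (K', θ')) +
      b * E.avg θ (fun θ' => E.U M (K, θ')) := fun θ => by
    rw [← avg_linear]
    refine congrArg _ (funext fun θ' => ?_)
    exact (hJ2 E.ut θ').trans (hUN' θ')
  have hvar : E.Variation M M' η := by
    refine Variation.of_children hT (fun s hs => ?_) ?_ ?_
    · rw [hM', graft_of_not_mem fun h => hs ⟨φ, h⟩, graft_of_not_mem fun h => hs ⟨φ', h⟩]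
    · rw [sum_signal Ty.h fun ψ => E.avg Ty.h fun θ' => E.U M' ((ψ, Ty.h) :: η, θ'),
        sum_signal Ty.h fun ψ => E.avg Ty.h fun θ' => E.U M ((ψ, Ty.h) :: η, θ')]
      have h2 : P * E.avg Ty.h (fun θ' => E.U M' (K, θ')) +
          P' * E.avg Ty.h (fun θ' => E.U M' (K', θ')) =
          P * E.avg Ty.h (fun θ' => E.U M (K, θ')) +
          P' * E.avg Ty.h (fun θ' => E.U M (K', θ')) := by
        rw [hUavg, hUavg', hswap]
      refine le_antisymm (sum_le_of_two hne (fun ψ h1 h2 => ?_) h2.le)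
        (sum_le_of_two hne (fun ψ h1 h2 => ?_) h2.ge)
      · simp only [U, hJ3 _ ψ h1 h2, le_refl]
      · simp only [U, hJ3 _ ψ h1 h2, le_refl]
    · rintro η' h1 ⟨ψ, h2⟩ h3
      by_cases hψ : ψ = φ
      · subst hψ
        have h4 : ∀ s ∈ after K, M' s.1 s.2 = N s.1 s.2 := fun _ h => graft_of_mem h
        rw [dev_congr_after h4 h2, U, J_congr_after h4 (s := (η', Ty.l)) h2, hN, dev_mix hab]
        refine le_trans ?_ (U_mix hab _ _ _).ge
        gcongr
        · exact hM.feas.osic η' h1 h3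
        · exact move_osic hM.feas hl hKh' h1 h2 h3
      by_cases hψ' : ψ = φ'
      · subst hψ'
        have h4 : ∀ s ∈ after K', M' s.1 s.2 = N' s.1 s.2 := fun s h => by
          rw [hM', graft_of_not_mem (not_mem_after_of_ne hl hKne h), graft_of_mem h]
        rw [dev_congr_after h4 h2, U, J_congr_after h4 (s := (η', Ty.l)) h2, hN', dev_mix hbb]
        refine le_trans ?_ (U_mix hbb _ _ _).ge
        gcongr
        · exact hM.feas.osic η' h1 h3
        · exact move_osic hM.feas hl.symm hKh h1 h2 h3
      · rw [dev_congr_after (hother ψ hψ hψ') h2, U,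
          J_congr_after (hother ψ hψ hψ') (s := (η', Ty.l)) h2]
        exact hM.feas.osic η' h1 h3
  have hC : E.C M' (η, Ty.h) ≤ E.C M (η, Ty.h) := by
    rw [C, C, J_rec' hT, J_rec' hT]
    refine add_le_add (by simp only [flow, id, hself, le_refl]) ?_
    gcongr E.de * ?_
    rw [sum_signal Ty.h fun ψ => E.avg Ty.h fun θ' => E.J id M' ((ψ, Ty.h) :: η, θ'),
      sum_signal Ty.h fun ψ => E.avg Ty.h fun θ' => E.J id M ((ψ, Ty.h) :: η, θ')]
    refine sum_le_of_two hne (fun ψ h1 h2 => by simp only [hJ3 _ ψ h1 h2, le_refl]) ?_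
    refine le_trans ?_ (hswap _ _).le
    rw [← avg_linear Ty.h (a' : ℝ≥0∞) a, ← avg_linear Ty.h (b' : ℝ≥0∞) b]
    exact add_le_add (mul_le_mul_right (avg_mono _ fun θ => (hJ1 id θ).le.trans (hCN θ)) _)
      (mul_le_mul_right (avg_mono _ fun θ => (hJ2 id θ).le.trans (hCN' θ)) _)
  -- With `Q`, `Q'` the masses of `φ`, `φ'` for a low type, the deviation payoff changes by `(D -
  -- D') * (Q' * P - Q * P')` times the discount factor. This is nonpositive since `φ'` has no
  -- larger likelihood ratio and `D' < D`.
  have hd : E.dev M' η ≤ E.dev M η := by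
    rw [dev_eq', dev_eq']
    refine add_le_add (by simp only [flow, hself, le_refl]) ?_
    gcongr E.de * ?_
    rw [sum_signal Ty.l fun ψ => E.avg Ty.l fun θ' => E.U M' ((ψ, Ty.h) :: η, θ'),
      sum_signal Ty.l fun ψ => E.avg Ty.l fun θ' => E.U M ((ψ, Ty.h) :: η, θ')]
    refine sum_le_of_two hne (fun ψ h1 h2 => by simp only [U, hJ3 _ ψ h1 h2, le_refl]) ?_
    rw [← hK, ← hK', hUavg, hUavg']
    set D := E.avg Ty.l fun θ' => E.U M (K, θ') with hD
    set D' := E.avg Ty.l fun θ' => E.U M (K', θ') with hD'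
    have hDf : D ≠ ⊤ := avg_ne_top _ hU
    have hDf' : D' ≠ ⊤ := avg_ne_top _ hU'
    have hQf := mass_ne_top (E := E) Ty.l φ
    have hQf' := mass_ne_top (E := E) Ty.l φ'
    have hr := (ENNReal.toReal_lt_toReal hDf' hDf).2 hlow
    rw [lrSignal_eq, lrSignal_eq, div_le_div_iff₀
      (ENNReal.toReal_pos (mass_ne_zero _ _) (mass_ne_top _ _))
      (ENNReal.toReal_pos (mass_ne_zero _ _) (mass_ne_top _ _))] at hlr
    have har : (a : ℝ) = P'.toReal := rfl
    have hbr : (b : ℝ) = P.toReal := rfl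
    have habr : (a' : ℝ) + a = 1 := by exact_mod_cast hab
    have hbbr : (b' : ℝ) + b = 1 := by exact_mod_cast hbb
    rw [← ENNReal.toReal_le_toReal (by finiteness) (by finiteness),
      ENNReal.toReal_add (by finiteness) (by finiteness),
      ENNReal.toReal_add (by finiteness) (by finiteness), ENNReal.toReal_mul, ENNReal.toReal_mul,
      ENNReal.toReal_mul, ENNReal.toReal_mul, ENNReal.toReal_add (by finiteness) (by finiteness),
      ENNReal.toReal_add (by finiteness) (by finiteness), ENNReal.toReal_mul, ENNReal.toReal_mul,
      ENNReal.toReal_mul, ENNReal.toReal_mul]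
    simp only [ENNReal.coe_toReal]
    rw [← hP, ← hP', ← har, ← hbr] at hlr
    rw [eq_sub_of_add_eq habr, eq_sub_of_add_eq hbbr]
    nlinarith [mul_nonneg (sub_nonneg.2 hlr) (sub_pos.2 hr).le]
  -- The swapped mechanism is optimal too, so by uniqueness the continuations after the two signals
  -- agree on path.
  have hopt := hM.of_C_le hvar (hd.trans (hM.feas.osic η hη hT)) hC
  have hagree := hM.agreeOnPath hopt
  have hpath : ∀ s ∈ after K, E.OnPath s.1 s.2 → (s.1.length : ℕ∞) < E.T →
      move K K' M s.1 s.2 = M s.1 s.2 := by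
    intro s hs hp hsT
    have h1 := hagree s.1 s.2 hsT hp
    rw [hM', graft_of_mem hs, hN] at h1
    funext y
    exact (E.eq_of_comb_eq_left hab ha0 (congrFun h1 y).symm).symm
  have hJeq : ∀ f : ℝ≥0 → ℝ≥0, E.avg Ty.h (fun θ' => E.J f (move K K' M) (K, θ')) =
      E.avg Ty.h (fun θ' => E.J f M (K, θ')) := fun f => by
    refine Finset.sum_congr rfl fun θ' _ => ?_
    by_cases h0 : E.te Ty.h θ' = 0
    · rw [h0, zero_mul, zero_mul]
    · show E.te Ty.h θ' * E.J f (move K K' M) (K, θ') = E.te Ty.h θ' * E.J f M (K, θ')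
      rw [J_congr_onPath hpath (s := (K, θ')) List.suffix_rfl
        (onPath_cons.2 ⟨(E.te_ne_zero_iff _ _).1 h0, onPath_high hη⟩)]
  -- Low types after a high report may be off path, where uniqueness says nothing. Moving the whole
  -- continuation of `φ'` to `φ` preserves the high type's expected utility and cost, so the
  -- comparison for low types comes from `Opt.avg_low_le`.
  have hfin := hM.avg_low_le hw hη hT hlt (φ := φ) (N := move K K' M) (hJeq E.ut)
    (fun η' h1 h2 h3 => move_osic hM.feas hl hKh' h1 h2 h3) (hJeq id).le
  simp only [U, ← hK, hmv] at hfin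
  exact hlow.not_ge hfin

end Env

end

end Insurance

/-! ### Multipliers for a single flow contract -/

namespace Insurance

/-- A family of points in the plane that no admissible pair of directions separates from a line
through the origin lies above such a line, and on it where both signs of the direction are allowed. -/
theorem exists_slope {ι : Type*} [Fintype ι] {S : Set ι} {a b : ι → ℝ} (ha : ∀ y ∈ S, 0 ≤ a y)
    (H : ∀ y z α β, (0 ≤ α ∨ y ∈ S) → (0 ≤ β ∨ z ∈ S) → α * a y + β * a z ≤ 0 →
      0 ≤ α * b y + β * b z) :
    ∃ k : ℝ, 0 ≤ k ∧ ∀ y, 0 ≤ b y + k * a y ∧ (y ∈ S → b y + k * a y = 0) := by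
  classical
  -- A point of `S` with `0 < a s` determines the slope. Otherwise `S` sits at the origin, and the
  -- steepest descending point with positive `a`, if any, does.
  by_cases hs : ∃ s ∈ S, 0 < a s
  · obtain ⟨s, hsS, has⟩ := hs
    have hk : ∀ t : ℝ, t * a s / a s = t := fun t => mul_div_cancel_right₀ t has.ne'
    refine ⟨-b s / a s, div_nonneg ?_ has.le, fun y => ⟨?_, fun hy => ?_⟩⟩
    · have := H s s (-1) 0 (Or.inr hsS) (Or.inr hsS) (by linarith)
      linarith
    · have h := H y s 1 (-a y / a s) (Or.inl zero_le_one) (Or.inr hsS) (by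
        rw [div_mul_cancel₀ _ has.ne']; linarith)
      have e : b y + -b s / a s * a y = 1 * b y + -a y / a s * b s := by ring
      rw [e]; exact h
    · have h := H y s 1 (-a y / a s) (Or.inl zero_le_one) (Or.inr hsS) (by
        rw [div_mul_cancel₀ _ has.ne']; linarith)
      have h' := H y s (-1) (a y / a s) (Or.inr hy) (Or.inr hsS) (by
        rw [div_mul_cancel₀ _ has.ne']; linarith)
      have e : b y + -b s / a s * a y = 1 * b y + -a y / a s * b s := by ring
      have e' : -(b y + -b s / a s * a y) = -1 * b y + a y / a s * b s := by ring
      linarith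
  · push Not at hs
    have haS : ∀ y ∈ S, a y = 0 := fun y hy => le_antisymm (hs y hy) (ha y hy)
    have hbS : ∀ y ∈ S, b y = 0 := fun y hy => by
      have h1 := H y y 1 0 (Or.inr hy) (Or.inr hy) (by rw [haS y hy]; simp)
      have h2 := H y y (-1) 0 (Or.inr hy) (Or.inr hy) (by rw [haS y hy]; simp)
      linarith
    by_cases hz : ∃ z, 0 < a z ∧ b z < 0
    · obtain ⟨z, hz, hmax⟩ := Finset.exists_max_image
        (univ.filter fun z => 0 < a z ∧ b z < 0) (fun z => -b z / a z)
        (by obtain ⟨z, hz⟩ := hz; exact ⟨z, by simpa using hz⟩)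
      simp only [Finset.mem_filter, mem_univ, true_and] at hz hmax
      obtain ⟨haz, hbz⟩ := hz
      have hk : 0 < -b z / a z := div_pos (by linarith) haz
      refine ⟨-b z / a z, hk.le, fun y => ⟨?_, fun hy => by rw [haS y hy, hbS y hy]; simp⟩⟩
      rcases le_or_gt (a y) 0 with hay | hay
      · have h := H y z 1 (-a y / a z) (Or.inl zero_le_one)
          (Or.inl (div_nonneg (by linarith) haz.le)) (by
            rw [div_mul_cancel₀ _ haz.ne']; linarith)
        have e : b y + -b z / a z * a y = 1 * b y + -a y / a z * b z := by ring
        rw [e]; exact h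
      · rcases le_or_gt 0 (b y) with hby | hby
        · positivity
        · have h := hmax y ⟨hay, hby⟩
          rw [div_le_iff₀ hay] at h
          linarith
    · push Not at hz
      refine ⟨0, le_rfl, fun y => ⟨?_, fun hy => by rw [hbS y hy]; simp⟩⟩
      rcases le_or_gt (a y) 0 with hay | hay
      · have := H y y 1 0 (Or.inl zero_le_one) (Or.inl le_rfl) (by linarith)
        linarith
      · have := hz y hay
        linarith

/-- Farkas' lemma for one equality and one inequality constraint, in the case where the variables
outside `S` have a sign. -/
theorem exists_multipliers {ι : Type*} [Fintype ι] {S : Set ι} {ℓ g : ι → ℝ} (hg : ∀ y, 0 ≤ g y)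
    (H : ∀ e : ι → ℝ, ∑ y, e y = 0 → ∑ y, ℓ y * e y ≤ 0 → (∀ y, y ∉ S → 0 ≤ e y) →
      0 ≤ ∑ y, g y * e y) :
    ∃ μ k : ℝ, 0 ≤ k ∧ ∀ y, μ - k * ℓ y ≤ g y ∧ (y ∈ S → μ - k * ℓ y = g y) := by
  classical
  by_cases hS : S.Nonempty
  -- The coordinate `y₀`, whose sign is free, absorbs the equality constraint and leaves a planar
  -- problem in differences from `y₀`. Minimality of `ℓ` gives the sign condition required by
  -- `exists_slope`.
  · obtain ⟨y₀, hy₀, hmin⟩ := Set.exists_min_image S ℓ S.toFinite hS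
    obtain ⟨k, hk, h⟩ := exists_slope (S := S) (a := fun y => ℓ y - ℓ y₀) (b := fun y => g y - g y₀)
      (fun y hy => sub_nonneg.2 (hmin y hy)) (fun y z α β hα hβ hle => by
        have key : ∀ f : ι → ℝ, ∑ w, f w * ((Pi.single y α : ι → ℝ) w + (Pi.single z β : ι → ℝ) w -
            (Pi.single y₀ (α + β) : ι → ℝ) w) = α * (f y - f y₀) + β * (f z - f y₀) := fun f => by
          simp only [mul_sub, mul_add, Finset.sum_sub_distrib, Finset.sum_add_distrib,
            Pi.single_apply, mul_ite, mul_zero, Finset.sum_ite_eq', mem_univ, if_true]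
          ring
        rw [← key g]
        refine H _ ?_ (by rw [key ℓ]; exact hle) fun w hw => ?_
        · have := key fun _ => 1
          simpa using this
        · have hw0 : w ≠ y₀ := fun e => hw (e ▸ hy₀)
          have h0 : (Pi.single y₀ (α + β) : ι → ℝ) w = 0 := Pi.single_eq_of_ne hw0 _
          rw [h0, sub_zero]
          refine add_nonneg ?_ ?_
          · rw [Pi.single_apply]
            split_ifs with e
            · exact hα.resolve_right (e ▸ hw)
            · exact le_rfl
          · rw [Pi.single_apply]
            split_ifs with e
            · exact hβ.resolve_right (e ▸ hw)
            · exact le_rfl)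
    refine ⟨g y₀ + k * ℓ y₀, k, hk, fun y => ⟨?_, fun hy => ?_⟩⟩
    · have := (h y).1
      linarith
    · have := (h y).2 hy
      linarith
  · refine ⟨0, 0, le_rfl, fun y => ⟨by simpa using hg y, fun hy => (hS ⟨y, hy⟩).elim⟩⟩

theorem AllHigh.map_sigs {Φ : Type*} {η : Hist Φ} (h : AllHigh η) :
    (sigs η).map (·, Ty.h) = η := by
  rw [sigs, List.map_map]
  refine (List.map_congr_left fun x hx => ?_).trans (List.map_id _)
  rw [Function.comp, ← h x hx]
  rfl

noncomputable section

namespace Env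

variable {Y Φ : Type*} [Fintype Y] [Fintype Φ] {E : Env Y Φ}

/-- A first-order variation of one flow contract of an optimal mechanism cannot save cost. -/
theorem Opt.sum_div_marginal_nonneg {w : Ty → ℝ≥0∞} {M : Mechanism Y Φ} (hM : E.Opt w M)
    {η : Hist Φ} (hη : AllHigh η) (hT : (η.length : ℕ∞) < E.T) {d : Y → ℝ}
    (hh : ∑ y, E.p Ty.h y * d y = 0) (hl : ∑ y, E.p Ty.l y * d y ≤ 0)
    (hd : ∀ y, M η Ty.h y = 0 → 0 ≤ d y) :
    0 ≤ ∑ y, E.p Ty.h y * (d y / E.marginal (M η Ty.h y)) := by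
  by_contra hneg
  push Not at hneg
  set s := ∑ y, E.p Ty.h y * (d y / E.marginal (M η Ty.h y)) with hs
  -- Half of the first-order saving is reserved for the approximation error.
  have hκ : 0 < -s / 2 := by linarith
  have hev : ∀ᶠ ε in nhdsWithin (0 : ℝ) (Set.Ioi 0), ∀ y, ∃ c' : ℝ≥0,
      (E.ut c' : ℝ) = E.ut (M η Ty.h y) + ε * d y ∧
      (c' : ℝ) ≤ M η Ty.h y + ε * (d y / E.marginal (M η Ty.h y) + -s / 2) :=
    eventually_all.2 fun y => E.eventually_exists_ut (hd y) hκ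
  have hpos : ∀ᶠ ε in nhdsWithin (0 : ℝ) (Set.Ioi 0), (0 : ℝ) < ε := self_mem_nhdsWithin
  obtain ⟨ε, hz, hε⟩ := (hev.and hpos).exists
  choose z hz1 hz2 using hz
  set M' := graft {(η, Ty.h)} M (fun _ _ => z) with hM'
  have hself : M' η Ty.h = z := graft_of_mem (s := (η, Ty.h)) rfl
  have hoff : ∀ s : Hist Φ × Ty, s ≠ (η, Ty.h) → M' s.1 s.2 = M s.1 s.2 := fun s hs =>
    graft_of_not_mem hs
  have hafter : ∀ φ, ∀ s ∈ after ((φ, Ty.h) :: η), M' s.1 s.2 = M s.1 s.2 := by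
    intro φ s hs
    refine hoff s ?_
    rintro rfl
    have := List.IsSuffix.length_le hs
    simp at this
  have hJ : ∀ (f : ℝ≥0 → ℝ≥0) φ θ, E.J f M' ((φ, Ty.h) :: η, θ) = E.J f M ((φ, Ty.h) :: η, θ) :=
    fun f φ θ => J_congr_after (hafter φ) (s := ((φ, Ty.h) :: η, θ)) List.suffix_rfl
  have hsum : ∀ θ, ∑ y, E.p θ y * (E.ut (z y) : ℝ) =
      ∑ y, E.p θ y * (E.ut (M η Ty.h y) : ℝ) + ε * ∑ y, E.p θ y * d y := fun θ => by
    simp only [hz1, mul_add, Finset.sum_add_distrib, Finset.mul_sum]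
    congr 1
    exact Finset.sum_congr rfl fun y _ => by ring
  have hvar : E.Variation M M' η := by
    refine ⟨fun s hs => hoff s fun h => hs (h ▸ self_mem_sub _ _), ?_, ?_⟩
    · rw [U, U, J_rec' hT, J_rec' hT]
      simp only [hJ]
      congr 1
      simp only [flow, id, hself]
      rw [E.sum_p_ofReal Ty.h fun y => E.ut (z y), E.sum_p_ofReal Ty.h fun y => E.ut (M η Ty.h y),
        hsum, hh, mul_zero, add_zero]
    · rintro η' h1 ⟨φ, h2⟩ h3
      rw [dev_congr_after (hafter φ) h2, U, J_congr_after (hafter φ) (s := (η', Ty.l)) h2]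
      exact hM.feas.osic η' h1 h3
  have hdev : E.dev M' η ≤ E.U M (η, Ty.l) := by
    refine le_trans ?_ (hM.feas.osic η hη hT)
    rw [dev_eq', dev_eq']
    simp only [U, hJ]
    gcongr
    simp only [flow, hself]
    rw [E.sum_p_ofReal Ty.l fun y => E.ut (z y), E.sum_p_ofReal Ty.l fun y => E.ut (M η Ty.h y),
      hsum]
    exact ENNReal.ofReal_le_ofReal (by nlinarith)
  have hC := hM.C_le hη hT hvar hdev
  have hfin := hM.C_ne_top (onPath_high hη)
  rw [C, J_rec' hT] at hfin
  rw [C, C, J_rec' hT, J_rec' hT] at hC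
  simp only [hJ] at hC
  have h1 := (ENNReal.add_le_add_iff_right (ENNReal.add_ne_top.1 hfin).2).1 hC
  simp only [flow, id, hself] at h1
  rw [← ENNReal.toReal_le_toReal (sum_p_ne_top _ _) (sum_p_ne_top _ _), sum_p_toReal,
    sum_p_toReal] at h1
  have h2 : ∑ y, E.p Ty.h y * (z y : ℝ) ≤ ∑ y, E.p Ty.h y *
      (M η Ty.h y + ε * (d y / E.marginal (M η Ty.h y) + -s / 2)) :=
    Finset.sum_le_sum fun y _ => mul_le_mul_of_nonneg_left (hz2 y) (E.p_pos _ _).le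
  have h3 : ∑ y, E.p Ty.h y * (M η Ty.h y + ε * (d y / E.marginal (M η Ty.h y) + -s / 2)) =
      ∑ y, E.p Ty.h y * (M η Ty.h y : ℝ) + ε * s + ε * (-s / 2) := by
    have h5 : ∀ y, E.p Ty.h y * (M η Ty.h y + ε * (d y / E.marginal (M η Ty.h y) + -s / 2)) =
        E.p Ty.h y * (M η Ty.h y : ℝ) + ε * (E.p Ty.h y * (d y / E.marginal (M η Ty.h y))) +
          E.p Ty.h y * (ε * (-s / 2)) := fun y => by ring
    simp only [h5, Finset.sum_add_distrib, ← Finset.sum_mul, ← Finset.mul_sum, E.p_sum, one_mul]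
    rw [hs]
  nlinarith

theorem Opt.exists_multipliers {w : Ty → ℝ≥0∞} {M : Mechanism Y Φ} (hM : E.Opt w M)
    {η : Hist Φ} (hη : AllHigh η) (hT : (η.length : ℕ∞) < E.T) :
    ∃ μ k : ℝ, 0 ≤ k ∧ ∀ y, μ - k * E.lr y ≤ 1 / E.marginal (M η Ty.h y) ∧
      (0 < M η Ty.h y → μ - k * E.lr y = 1 / E.marginal (M η Ty.h y)) := by
  refine Insurance.exists_multipliers (S := {y | 0 < M η Ty.h y})
    (fun y => (one_div_pos.2 (E.marginal_pos _)).le) fun e he hle hS => ?_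
  have hp : ∀ y, E.p Ty.h y ≠ 0 := fun y => (E.p_pos _ _).ne'
  have h1 : ∀ y, E.p Ty.h y * (e y / E.p Ty.h y) = e y := fun y => mul_div_cancel₀ _ (hp y)
  have h := hM.sum_div_marginal_nonneg hη hT (d := fun y => e y / E.p Ty.h y)
    (by simpa only [h1] using he)
    (by
      refine le_trans (le_of_eq (Finset.sum_congr rfl fun y _ => ?_)) hle
      rw [lr]; ring)
    (fun y hy => div_nonneg (hS y (by simp [hy])) (E.p_pos _ _).le)
  refine h.trans_eq (Finset.sum_congr rfl fun y _ => ?_)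
  rw [← mul_div_assoc, h1, one_div, div_eq_mul_inv, mul_comm]

theorem Opt.inverseMarginal {w : Ty → ℝ≥0∞} {M : Mechanism Y Φ} (hM : E.Opt w M) :
    ∃ μ lam : List Φ → ℝ, (∀ σ, 0 ≤ lam σ) ∧ E.InverseMarginal M μ lam := by
  have h : ∀ σ : List Φ, ∃ μ k : ℝ, 0 ≤ k ∧ ((σ.length : ℕ∞) < E.T → ∀ y,
      μ - k * E.lr y ≤ 1 / E.marginal (M (σ.map (·, Ty.h)) Ty.h y) ∧
      (0 < M (σ.map (·, Ty.h)) Ty.h y →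
        μ - k * E.lr y = 1 / E.marginal (M (σ.map (·, Ty.h)) Ty.h y))) := fun σ => by
    by_cases hT : (σ.length : ℕ∞) < E.T
    · obtain ⟨μ, k, hk, h⟩ := hM.exists_multipliers (η := σ.map (·, Ty.h))
        (by rintro x hx; obtain ⟨φ, -, rfl⟩ := List.mem_map.1 hx; rfl) (by simpa using hT)
      exact ⟨μ, k, hk, fun _ => h⟩
    · exact ⟨0, 0, le_rfl, fun h => (hT h).elim⟩
  choose μ lam hlam h using h
  refine ⟨μ, lam, hlam, fun η hη hT => ?_⟩
  have := h (sigs η) (by simpa [sigs] using hT)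
  rwa [hη.map_sigs] at this

end Env

end

end Insurance

/-! ### Full coverage after a low report and incentive compatibility -/

namespace Insurance

/-- The history before the first low report, if there is a low report. -/
def firstLow {Φ : Type*} : Hist Φ → Ty → Option (Hist Φ)
  | [], .l => some []
  | [], .h => none
  | x :: η, θ => match firstLow η x.2 with
    | some K => some K
    | none => if θ = Ty.l then some (x :: η) else none

theorem firstLow_cons_of_some {Φ : Type*} {x : Φ × Ty} {η K : Hist Φ} {θ : Ty}
    (h : firstLow η x.2 = some K) : firstLow (x :: η) θ = some K := by
  simp only [firstLow, h]

theorem AllHigh.firstLow_high {Φ : Type*} {η : Hist Φ} (h : AllHigh η) :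
    firstLow η Ty.h = none := by
  induction η with
  | nil => rfl
  | cons x η ih =>
    have h1 : firstLow η x.2 = none := by rw [h.of_cons.1]; exact ih h.of_cons.2
    simp [firstLow, h1]

theorem AllHigh.firstLow_low {Φ : Type*} {η : Hist Φ} (h : AllHigh η) :
    firstLow η Ty.l = some η := by
  cases η with
  | nil => rfl
  | cons x η =>
    have h1 : firstLow η x.2 = none := by rw [h.of_cons.1]; exact h.of_cons.2.firstLow_high
    simp [firstLow, h1]

theorem allHigh_of_firstLow_eq_none {Φ : Type*} {η : Hist Φ} {θ : Ty}
    (h : firstLow η θ = none) : AllHigh η ∧ θ = Ty.h := by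
  induction η generalizing θ with
  | nil => cases θ
           · exact absurd h (by simp [firstLow])
           · exact ⟨allHigh_nil, rfl⟩
  | cons x η ih =>
    rcases h1 : firstLow η x.2 with _ | K
    · obtain ⟨h2, h3⟩ := ih h1
      have h4 : x = (x.1, Ty.h) := Prod.ext rfl h3
      refine ⟨by rw [h4]; exact h2.cons _, ?_⟩
      cases θ
      · simp [firstLow, h1] at h
      · rfl
    · rw [firstLow_cons_of_some h1] at h
      exact absurd h (by simp)

theorem firstLow_of_not_allHigh {Φ : Type*} {η : Hist Φ} (h : ¬ AllHigh η) :
    ∃ K, ∀ θ, firstLow η θ = some K := by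
  cases η with
  | nil => exact (h allHigh_nil).elim
  | cons x η =>
    rcases h1 : firstLow η x.2 with _ | K
    · obtain ⟨h2, h3⟩ := allHigh_of_firstLow_eq_none h1
      have h4 : x = (x.1, Ty.h) := Prod.ext rfl h3
      exact (h (by rw [h4]; exact h2.cons _)).elim
    · exact ⟨K, fun θ => firstLow_cons_of_some h1⟩

theorem firstLow_cons_ne_none {Φ : Type*} {x : Φ × Ty} {η : Hist Φ} (h : firstLow η x.2 ≠ none)
    (θ : Ty) : firstLow (x :: η) θ ≠ none := by
  obtain ⟨K, hK⟩ := Option.ne_none_iff_exists'.1 h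
  rw [firstLow_cons_of_some hK]
  simp

theorem low_of_firstLow_cons {Φ : Type*} {φ : Φ} {η : Hist Φ} {θ θ' : Ty}
    (h : firstLow η θ = none) (h' : firstLow ((φ, θ) :: η) θ' ≠ none) :
    AllHigh ((φ, θ) :: η) ∧ θ' = Ty.l := by
  obtain ⟨h1, rfl⟩ := allHigh_of_firstLow_eq_none h
  refine ⟨h1.cons _, ?_⟩
  cases θ'
  · rfl
  · exact (h' (h1.cons _).firstLow_high).elim

theorem AllHigh.firstLow_append {Φ : Type*} {η₀ : Hist Φ} (h : AllHigh η₀) (η₁ : Hist Φ) (φ : Φ)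
    (θ : Ty) : firstLow (η₁ ++ (φ, Ty.l) :: η₀) θ = some η₀ := by
  induction η₁ generalizing θ with
  | nil => exact firstLow_cons_of_some h.firstLow_low
  | cons x η₁ ih => exact firstLow_cons_of_some (ih x.2)

noncomputable section

namespace Env

section

variable {Y Φ : Type*} [Fintype Y] [Fintype Φ] (E : Env Y Φ)

open Classical in
/-- The consumption level that, given forever, has the continuation utility of a low type. -/
def equivalent (M : Mechanism Y Φ) (K : Hist Φ) : ℝ≥0 :=
  if h : ∃ c, E.ut c * E.ann K.length = E.U M (K, Ty.l) then h.choose else 0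

/-- The mechanism that grants full coverage from the first low report on, at the same utilities. -/
def insure (M : Mechanism Y Φ) : Mechanism Y Φ := fun η θ =>
  match firstLow η θ with
  | some K => fullCoverage (E.equivalent M K)
  | none => M η θ

/-- Continuation utility of a consumer who reports `r` now and is truthful afterwards. -/
def report (M : Mechanism Y Φ) (η : Hist Φ) (θ r : Ty) : ℝ≥0∞ :=
  E.flow E.ut (fun _ => r) M (η, θ) +
    E.de * ∑ i : Y × Ty, E.pe θ i.1 * E.te θ i.2 * E.U M ((E.signal i.1, r) :: η, i.2)

end

variable {Y Φ : Type*} [Fintype Y] [Fintype Φ] {E : Env Y Φ}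

/-- A mechanism at which no single misreport pays, at any history, is incentive compatible. -/
theorem ic_of_report_le {M : Mechanism Y Φ} (h : ∀ (η : Hist Φ) θ r, (η.length : ℕ∞) < E.T →
    E.report M η θ r ≤ E.U M (η, θ)) : E.IC M := by
  refine E.ic_iff.2 fun r => ?_
  gcongr with i
  -- Truth-telling utility is a supersolution of the recursion of any strategy. As excess utilities
  -- are nonnegative, no condition at infinity enters this one-shot deviation principle.
  refine Proc.tot_le_of_super (p := E.sproc r) (fun _ => True) (fun _ _ _ _ => trivial)
    (g := fun s => E.U M (E.pub s.1, s.2)) (fun s _ hs => ?_) (s := ([], i)) trivial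
  refine le_trans (le_of_eq ?_) (h (E.pub s.1) s.2 (r s.1 s.2) (by rw [E.pub_length]; exact hs))
  rfl

theorem equivalent_spec {M : Mechanism Y Φ} {K : Hist Φ} (hT : (K.length : ℕ∞) < E.T)
    (hfin : E.U M (K, Ty.l) ≠ ⊤) :
    E.ut (E.equivalent M K) * E.ann K.length = E.U M (K, Ty.l) := by
  have h := exists_const hT hfin
  rw [equivalent, dif_pos h]
  exact h.choose_spec

theorem insure_of_some {M : Mechanism Y Φ} {η K : Hist Φ} {θ : Ty} (h : firstLow η θ = some K) :
    E.insure M η θ = fullCoverage (E.equivalent M K) := by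
  simp only [insure, h]

theorem insure_of_none {M : Mechanism Y Φ} {η : Hist Φ} {θ : Ty} (h : firstLow η θ = none) :
    E.insure M η θ = M η θ := by
  simp only [insure, h]

theorem J_insure_of_some (f : ℝ≥0 → ℝ≥0) {M : Mechanism Y Φ} {η K : Hist Φ} {θ : Ty}
    (h : firstLow η θ = some K) :
    E.J f (E.insure M) (η, θ) = f (E.equivalent M K) * E.ann η.length := by
  rw [J, Proc.tot_congr_on (p := E.proc 0 id) (fun s => firstLow s.1 s.2 = some K)
    (fun s i hs _ => firstLow_cons_of_some hs) (g := fun _ => (f (E.equivalent M K) : ℝ≥0∞))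
    (fun s hs _ => flow_fullCoverage (insure_of_some hs)) h, Proc.tot_const (E.proc_w_sum 0 id)]
  simp

/-- The altered states are entered from all-high histories at a low type, so a comparison at those
entry points is enough. -/
theorem J_insure_le {f : ℝ≥0 → ℝ≥0} {M : Mechanism Y Φ}
    (h : ∀ K, AllHigh K → (K.length : ℕ∞) < E.T →
      f (E.equivalent M K) * E.ann K.length ≤ E.J f M (K, Ty.l)) {η : Hist Φ} (hη : AllHigh η)
    (θ : Ty) : E.J f (E.insure M) (η, θ) ≤ E.J f M (η, θ) := by
  have hlow : ∀ K, AllHigh K → E.J f (E.insure M) (K, Ty.l) ≤ E.J f M (K, Ty.l) := fun K hK => by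
    by_cases hT : (K.length : ℕ∞) < E.T
    · rw [J_insure_of_some f hK.firstLow_low]
      exact h K hK hT
    · rw [J_of_not_lt _ _ _ hT, J_of_not_lt _ _ _ hT]
  cases θ
  · exact hlow η hη
  · refine Proc.tot_le_off (p := E.proc 0 id) {s | firstLow s.1 s.2 ≠ none}
      (fun s i hs => ?_) (fun s hs _ => ?_) (fun s i hs _ hi => ?_) (s := (η, Ty.h))
      (by simpa using hη.firstLow_high)
    · exact firstLow_cons_ne_none (x := (E.signal i.1, s.2)) hs i.2
    · have hs' : firstLow s.1 s.2 = none := by simpa using hs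
      simp only [flow, id, insure_of_none hs', le_refl]
    · obtain ⟨h1, h2⟩ := low_of_firstLow_cons (by simpa using hs) hi
      show E.J f (E.insure M) ((E.signal i.1, s.2) :: s.1, i.2) ≤
        E.J f M ((E.signal i.1, s.2) :: s.1, i.2)
      rw [show i.2 = Ty.l from h2]
      exact hlow _ h1

theorem U_insure {M : Mechanism Y Φ} (hfin : ∀ K, AllHigh K → E.U M (K, Ty.l) ≠ ⊤) {η : Hist Φ}
    (hη : AllHigh η) (θ : Ty) : E.U (E.insure M) (η, θ) = E.U M (η, θ) := by
  have hlow : ∀ K, AllHigh K → E.U (E.insure M) (K, Ty.l) = E.U M (K, Ty.l) := fun K hK => by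
    by_cases hT : (K.length : ℕ∞) < E.T
    · rw [U, J_insure_of_some E.ut hK.firstLow_low]
      exact equivalent_spec hT (hfin K hK)
    · rw [U, U, J_of_not_lt _ _ _ hT, J_of_not_lt _ _ _ hT]
  cases θ
  · exact hlow η hη
  · refine Proc.tot_eq_off (p := E.proc 0 id) {s | firstLow s.1 s.2 ≠ none}
      (fun s i hs => ?_) (fun s hs _ => ?_) (fun s i hs _ hi => ?_) (s := (η, Ty.h))
      (by simpa using hη.firstLow_high)
    · exact firstLow_cons_ne_none (x := (E.signal i.1, s.2)) hs i.2
    · have hs' : firstLow s.1 s.2 = none := by simpa using hs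
      simp only [flow, id, insure_of_none hs']
    · obtain ⟨h1, h2⟩ := low_of_firstLow_cons (by simpa using hs) hi
      show E.J E.ut (E.insure M) ((E.signal i.1, s.2) :: s.1, i.2) =
        E.J E.ut M ((E.signal i.1, s.2) :: s.1, i.2)
      rw [show i.2 = Ty.l from h2]
      exact hlow _ h1

theorem dev_insure {M : Mechanism Y Φ} (hfin : ∀ K, AllHigh K → E.U M (K, Ty.l) ≠ ⊤) {η : Hist Φ}
    (hη : AllHigh η) : E.dev (E.insure M) η = E.dev M η := by
  rw [dev_eq, dev_eq]
  simp only [flow, insure_of_none hη.firstLow_high, U_insure hfin (hη.cons _)]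

/-- All quantities in the constraints are kept, and full coverage delivers the low types' utilities
at least cost. -/
theorem Opt.insure {w : Ty → ℝ≥0∞} (hw : ∀ θ, w θ ≠ ⊤) {M : Mechanism Y Φ} (hM : E.Opt w M) :
    E.Opt w (E.insure M) := by
  have hfin : ∀ K, AllHigh K → E.U M (K, Ty.l) ≠ ⊤ := fun K hK => hM.feas.U_ne_top hw hK _
  have hcost : E.cost (E.insure M) ≤ E.cost M := by
    unfold cost
    gcongr with i
    exact J_insure_le (fun K hK hT => const_le_C (s := (K, Ty.l)) (equivalent_spec hT (hfin K hK)))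
      allHigh_nil i
  refine ⟨⟨fun η hη hT => ?_, fun θ => ?_⟩, fun N hN => hcost.trans (hM.le N hN),
    ne_top_of_le_ne_top hM.cost_ne_top hcost⟩
  · rw [dev_insure hfin hη, U_insure hfin hη]
    exact hM.feas.osic η hη hT
  · rw [U_insure hfin allHigh_nil]
    exact hM.feas.delivers θ

theorem Opt.fullCoverageAfterLow {w : Ty → ℝ≥0∞} (hw : ∀ θ, w θ ≠ ⊤) {M : Mechanism Y Φ}
    (hM : E.Opt w M) : E.FullCoverageAfterLow M := by
  have h := hM.agreeOnPath (hM.insure hw)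
  refine ⟨fun σ => E.equivalent M (σ.map (·, Ty.h)), fun η₀ hη => ?_⟩
  simp only [hη.map_sigs]
  refine ⟨fun hT hp => ?_, fun η₁ φ θ hT hp => ?_⟩
  · rw [h _ _ hT hp, insure_of_some hη.firstLow_low]
  · rw [h _ _ hT hp, insure_of_some (hη.firstLow_append η₁ φ θ)]

theorem report_self (M : Mechanism Y Φ) {η : Hist Φ} (θ : Ty) (hT : (η.length : ℕ∞) < E.T) :
    E.report M η θ θ = E.U M (η, θ) :=
  (E.U_rec M hT).symm

theorem report_const {M : Mechanism Y Φ} {η : Hist Φ} {θ r : Ty} {c : ℝ≥0}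
    (hT : (η.length : ℕ∞) < E.T) (h : M η r = fullCoverage c)
    (hU : ∀ φ θ', E.U M ((φ, r) :: η, θ') = E.ut c * E.ann (η.length + 1)) :
    E.report M η θ r = E.ut c * E.ann η.length := by
  rw [report, flow_fullCoverage (c := c) (by exact h)]
  simp only [hU, ← Finset.sum_mul]
  have := E.proc_w_sum 0 id (η, θ)
  simp only [proc] at this
  rw [this, ann, ann, annuity_rec hT]
  ring

/-- After a low report contracts ignore reports. Before it, low types are held by the one-shot
constraints, and a high type who reports low gets exactly the low type's utility. -/
theorem ic_insure {M : Mechanism Y Φ} (hfin : ∀ K, AllHigh K → E.U M (K, Ty.l) ≠ ⊤)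
    (hosic : ∀ η : Hist Φ, AllHigh η → (η.length : ℕ∞) < E.T → E.dev M η ≤ E.U M (η, Ty.l))
    (hle : ∀ η : Hist Φ, AllHigh η → (η.length : ℕ∞) < E.T → E.U M (η, Ty.l) ≤ E.U M (η, Ty.h)) :
    E.IC (E.insure M) := by
  have hr : ∀ {η K : Hist Φ} {r : Ty} (θ : Ty), (η.length : ℕ∞) < E.T → firstLow η r = some K →
      E.report (E.insure M) η θ r = E.ut (E.equivalent M K) * E.ann η.length := fun θ hT h =>
    report_const hT (insure_of_some h) fun φ θ' => J_insure_of_some _ (firstLow_cons_of_some h)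
  refine ic_of_report_le fun η θ r hT => ?_
  by_cases hη : AllHigh η
  · cases θ <;> cases r
    · exact (report_self _ _ hT).le
    · refine le_trans (le_of_eq ?_) ((dev_insure hfin hη).le.trans
        ((hosic η hη hT).trans (U_insure hfin hη _).ge))
      rfl
    · rw [hr Ty.h hT hη.firstLow_low, U_insure hfin hη, equivalent_spec hT (hfin η hη)]
      exact hle η hη hT
    · exact (report_self _ _ hT).le
  · obtain ⟨K, hK⟩ := firstLow_of_not_allHigh hη
    rw [hr θ hT (hK r), U, J_insure_of_some _ (hK θ)]

/-- For utilities that do not decrease in the type, some optimal mechanism is incentive compatible. -/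
theorem Opt.exists_ic {w : Ty → ℝ≥0∞} (hw : ∀ θ, w θ ≠ ⊤) (hle : w Ty.l ≤ w Ty.h)
    {M : Mechanism Y Φ} (hM : E.Opt w M) : ∃ M', E.Opt w M' ∧ E.IC M' := by
  rcases hle.lt_or_eq with hlt | heq
  · refine ⟨E.insure M, hM.insure hw, ic_insure (fun K hK => hM.feas.U_ne_top hw hK _)
      hM.feas.osic fun η hη hT => ?_⟩
    rcases hM.typeReward hw hlt hη hT with h | ⟨h1, h2⟩
    · exact h.le
    · rw [h1, h2]
  -- With equal initial utilities, one constant consumption level for everybody is feasible,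
  -- cheapest and leaves nothing to manipulate.
  · obtain ⟨c, hc⟩ := exists_const (M := M) (η := []) (θ := Ty.l) E.T_pos'
      (hM.feas.U_ne_top hw allHigh_nil _)
    have hall : ∀ θ, E.ut c * E.ann 0 = E.U M ([], θ) := fun θ => by
      rw [hM.feas.delivers θ]
      refine hc.trans ((hM.feas.delivers _).trans ?_)
      cases θ
      · rfl
      · exact heq
    set N : Mechanism Y Φ := fun _ _ => fullCoverage c with hN
    have hJ : ∀ (f : ℝ≥0 → ℝ≥0) (η : Hist Φ) θ, E.J f N (η, θ) = f c * E.ann η.length :=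
      fun f η θ => J_of_const (η := η) (θ := θ) (fun _ _ => rfl) (self_mem_sub _ _)
    have hcost : E.cost N ≤ E.cost M := by
      unfold cost
      gcongr with i
      rw [C, hJ]
      exact const_le_C (s := ([], i)) (hall i)
    refine ⟨N, ⟨⟨fun η _ hT => ?_, fun θ => ?_⟩, fun N' hN' => hcost.trans (hM.le N' hN'),
      ne_top_of_le_ne_top hM.cost_ne_top hcost⟩, ic_of_report_le fun η θ r hT => ?_⟩
    · rw [dev_of_const hT (fun _ _ => rfl), U, hJ]
    · rw [U, hJ]
      exact (hall θ).trans (hM.feas.delivers θ)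
    · rw [report_const hT (c := c) rfl fun φ θ' => hJ _ _ _, U, hJ]

/-- Mechanisms that agree before the horizon are equally good and equally hard to manipulate. -/
theorem ic_congr {M N : Mechanism Y Φ}
    (h : ∀ (η : Hist Φ) θ, (η.length : ℕ∞) < E.T → M η θ = N η θ) (hN : E.IC N) : E.IC M := by
  have hJ : ∀ s, E.U M s = E.U N s := fun s =>
    Proc.tot_congr_on (p := E.proc 0 id) (fun _ => True) (fun _ _ _ _ => trivial)
      (fun s _ hs => by simp only [flow, id, h s.1 s.2 (by simpa using hs)]) trivial
  have hS : ∀ r s, E.SU M r s = E.SU N r s := fun r s =>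
    Proc.tot_congr_on (p := E.sproc r) (fun _ => True) (fun _ _ _ _ => trivial)
      (fun s _ hs => by
        simp only [h (E.pub s.1) (r s.1 s.2) (by rw [E.pub_length]; exact hs)]) trivial
  refine E.ic_iff.2 fun r => ?_
  simp only [hJ, hS]
  exact E.ic_iff.1 hN r

theorem onPath_of_pos (h : ∀ i j, 0 < E.trans i j) (η : Hist Φ) (θ : Ty) : E.OnPath η θ := by
  induction η generalizing θ with
  | nil => exact List.isChain_singleton _
  | cons x η ih => exact onPath_cons.2 ⟨h _ _, ih x.2⟩

/-- A competitor may itself violate one-shot constraints off path; it is its relaxed-feasible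
companion of equal cost that is compared with `M`. -/
theorem Opt.solvesFirm {W : Ty → ℝ} (hW : ∀ θ, E.lowest 0 ≤ W θ) {M : Mechanism Y Φ}
    (hM : E.Opt (E.excess W) M) (hic : E.IC M) : E.SolvesFirm W M := by
  refine ⟨hic, ((E.feas_iff hW).1 hM.feas).2, fun N hN hd => ?_⟩
  obtain ⟨N', hN', hcost⟩ := exists_feas_of_ic (E.excess_ne_top W) hN
    fun θ => (E.V_nil_eq_iff (hW θ)).1 (hd θ)
  rw [profit_le_iff, ← hcost]
  exact hM.le N' hN'

end Env

end

end Insurance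

/-! ### Existence by compactness -/

namespace Insurance

theorem _root_.ENNReal.continuous_tsum_of_le {X : Type*} [TopologicalSpace X] {f : ℕ → X → ℝ≥0∞}
    {b : ℕ → ℝ≥0∞} (hf : ∀ k, Continuous (f k)) (hb : ∑' k, b k ≠ ⊤) (h : ∀ k x, f k x ≤ b k) :
    Continuous fun x => ∑' k, f k x := by
  have hbk : ∀ k, b k ≠ ⊤ := fun k => ENNReal.ne_top_of_tsum_ne_top hb k
  have hfk : ∀ k x, f k x ≠ ⊤ := fun k x => ne_top_of_le_ne_top (hbk k) (h k x)
  have h1 : Continuous fun x => ∑' k, (f k x).toReal :=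
    continuous_tsum
      (fun k => continuous_iff_continuousAt.2 fun x =>
        (ENNReal.tendsto_toReal (hfk k x)).comp (hf k).continuousAt)
      (ENNReal.summable_toReal hb) fun k x => by
        rw [Real.norm_of_nonneg ENNReal.toReal_nonneg]
        exact ENNReal.toReal_mono (hbk k) (h k x)
  have h2 : (fun x => ∑' k, f k x) = fun x => ENNReal.ofReal (∑' k, (f k x).toReal) := by
    funext x
    rw [← ENNReal.tsum_toReal_eq (hfk · x), ENNReal.ofReal_toReal]
    exact ne_top_of_le_ne_top hb (ENNReal.tsum_le_tsum fun k => h k x)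
  rw [h2]
  exact ENNReal.continuous_ofReal.comp h1

namespace Proc

variable {S I X : Type*} [Fintype I] [TopologicalSpace X] {p : Proc S I}

theorem continuous_iterate_step (hw : ∀ s i, p.w s i ≠ ⊤) {f : X → S → ℝ≥0∞}
    (hf : ∀ s, Continuous fun x => f x s) (k : ℕ) (s : S) :
    Continuous fun x => (p.step^[k] (f x)) s := by
  induction k generalizing s with
  | zero => exact hf s
  | succ k ih =>
    simp only [Function.iterate_succ_apply']
    exact continuous_finsetSum _ fun i _ =>
      (ENNReal.continuous_const_mul (hw s i)).comp (ih (p.nx s i))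

theorem continuous_term (hw : ∀ s i, p.w s i ≠ ⊤) (hδ : p.δ ≠ ⊤) {f : X → S → ℝ≥0∞}
    (hf : ∀ s, Continuous fun x => f x s) (k : ℕ) (s : S) :
    Continuous fun x => if ((p.len s + k : ℕ) : ℕ∞) < p.T then p.δ ^ k * (p.step^[k] (f x)) s
      else 0 := by
  split_ifs
  · exact (ENNReal.continuous_const_mul (ENNReal.pow_ne_top hδ)).comp
      (continuous_iterate_step hw hf k s)
  · exact continuous_const

theorem lowerSemicontinuous_tot (hw : ∀ s i, p.w s i ≠ ⊤) (hδ : p.δ ≠ ⊤) {f : X → S → ℝ≥0∞}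
    (hf : ∀ s, Continuous fun x => f x s) (s : S) : LowerSemicontinuous fun x => p.tot (f x) s :=
  lowerSemicontinuous_tsum fun k => (continuous_term hw hδ hf k s).lowerSemicontinuous

theorem iterate_step_le (hw : ∀ s, ∑ i, p.w s i = 1) {f : S → ℝ≥0∞} {B : ℝ≥0∞}
    (h : ∀ s, f s ≤ B) (k : ℕ) (s : S) : (p.step^[k] f) s ≤ B := by
  induction k generalizing s with
  | zero => exact h s
  | succ k ih =>
    rw [Function.iterate_succ_apply', step]
    calc _ ≤ ∑ i, p.w s i * B := by gcongr with i; exact ih _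
      _ = B := by rw [← Finset.sum_mul, hw, one_mul]

/-- With a finite horizon the series is a finite sum; with bounded flows it is dominated by a
geometric series. -/
theorem continuous_tot (hw : ∀ s, ∑ i, p.w s i = 1) (hδ : p.δ < 1) {f : X → S → ℝ≥0∞}
    (hf : ∀ s, Continuous fun x => f x s)
    (hb : p.T ≠ ⊤ ∨ ∃ B : ℝ≥0, ∀ x s, f x s ≤ B) (s : S) :
    Continuous fun x => p.tot (f x) s := by
  have hwt : ∀ s i, p.w s i ≠ ⊤ := fun s i => by
    refine ne_top_of_le_ne_top ENNReal.one_ne_top (?_ : p.w s i ≤ 1)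
    rw [← hw s]
    exact Finset.single_le_sum (f := p.w s) (fun _ _ => zero_le) (mem_univ i)
  have hterm := continuous_term hwt hδ.ne_top hf (s := s)
  rcases hb with hT | ⟨B, hB⟩
  · obtain ⟨n, hn⟩ := ENat.ne_top_iff_exists.1 hT
    have : ∀ x, p.tot (f x) s = ∑ k ∈ range n, if ((p.len s + k : ℕ) : ℕ∞) < p.T then
        p.δ ^ k * (p.step^[k] (f x)) s else 0 := fun x => by
      refine tsum_eq_sum fun k hk => if_neg fun h => hk ?_
      rw [← hn] at h
      have : p.len s + k < n := by exact_mod_cast h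
      exact mem_range.2 (by omega)
    simp only [this]
    exact continuous_finsetSum _ fun k _ => hterm k
  · refine ENNReal.continuous_tsum_of_le hterm (b := fun k => p.δ ^ k * B) ?_ fun k x => ?_
    · rw [ENNReal.tsum_mul_right, ENNReal.tsum_geometric]
      refine ENNReal.mul_ne_top (ENNReal.inv_ne_top.2 (tsub_pos_of_lt hδ).ne') ENNReal.coe_ne_top
    · split_ifs
      · gcongr
        exact iterate_step_le hw (hB x) k s
      · exact zero_le

end Proc

noncomputable section

namespace Env

variable {Y Φ : Type*} [Fintype Y] [Fintype Φ] {E : Env Y Φ}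

theorem flow_continuous {f : ℝ≥0 → ℝ≥0} (hf : Continuous f) (ρ : Ty → Ty) (s : Hist Φ × Ty) :
    Continuous fun M : Mechanism Y Φ => E.flow f ρ M s := by
  refine continuous_finsetSum _ fun y _ => (ENNReal.continuous_const_mul (E.pe_ne_top _ _)).comp
    (ENNReal.continuous_coe.comp (hf.comp ?_))
  fun_prop

theorem exists_ut_le (hu : BddAbove (E.u '' Set.Ici 0)) : ∃ B : ℝ≥0, ∀ c, E.ut c ≤ B := by
  obtain ⟨B, hB⟩ := hu
  refine ⟨(B - E.u 0).toNNReal, fun c => ?_⟩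
  rw [← NNReal.coe_le_coe, ut_coe]
  refine le_trans ?_ (Real.le_coe_toNNReal _)
  exact sub_le_sub_right (hB (Set.mem_image_of_mem _ (Set.mem_Ici.2 c.2))) _

theorem tot_flow_continuous (hb : E.T ≠ ⊤ ∨ BddAbove (E.u '' Set.Ici 0)) (n : ℕ) (ρ : Ty → Ty)
    (s : Hist Φ × Ty) :
    Continuous fun M : Mechanism Y Φ => (E.proc n ρ).tot (E.flow E.ut ρ M) s := by
  refine Proc.continuous_tot (E.proc_w_sum n ρ) E.de_lt_one
    (fun s => flow_continuous E.ut_continuous ρ s) (hb.imp id fun hu => ?_) s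
  obtain ⟨B, hB⟩ := exists_ut_le hu
  refine ⟨B, fun M s => ?_⟩
  calc E.flow E.ut ρ M s ≤ ∑ y, E.pe s.2 y * (B : ℝ≥0∞) := by
        unfold flow
        gcongr with y
        exact_mod_cast hB _
    _ = B := by rw [← Finset.sum_mul, E.pe_sum, one_mul]

theorem U_continuous (hb : E.T ≠ ⊤ ∨ BddAbove (E.u '' Set.Ici 0)) (s : Hist Φ × Ty) :
    Continuous fun M : Mechanism Y Φ => E.U M s :=
  tot_flow_continuous hb 0 id s

theorem dev_continuous (hb : E.T ≠ ⊤ ∨ BddAbove (E.u '' Set.Ici 0)) (η : Hist Φ) :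
    Continuous fun M : Mechanism Y Φ => E.dev M η := by
  simp only [dev_eq]
  refine (flow_continuous E.ut_continuous _ _).add ((ENNReal.continuous_const_mul E.de_ne_top).comp
    (continuous_finsetSum _ fun i _ => (ENNReal.continuous_const_mul
      (ENNReal.mul_ne_top (E.pe_ne_top _ _) (E.te_ne_top _ _))).comp (U_continuous hb _)))

theorem cost_lowerSemicontinuous :
    LowerSemicontinuous fun M : Mechanism Y Φ => E.cost M := by
  refine lowerSemicontinuous_sum fun i _ => ?_
  have : ∀ M : Mechanism Y Φ, E.ie i * E.C M ([], i) =
      (E.proc 0 id).tot (fun s => E.ie i * E.flow id id M s + 0 * 0) ([], i) := fun M => by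
    rw [Proc.tot_linear]; simp [C, J]
  simp only [this, mul_zero, add_zero]
  exact Proc.lowerSemicontinuous_tot
    (fun s i => ENNReal.mul_ne_top (E.pe_ne_top _ _) (E.te_ne_top _ _)) E.de_ne_top
    (fun s => (ENNReal.continuous_const_mul (E.ie_ne_top i)).comp (flow_continuous continuous_id _ _))
    _

/-- The continuation cost at a state is at most the total cost divided by a positive discounted
probability of getting there. -/
theorem exists_C_le (κ : ℝ≥0) {η : Hist Φ} {θ : Ty} (hp : E.OnPath η θ) :
    ∃ B : ℝ≥0, ∀ M : Mechanism Y Φ, E.cost M ≤ κ → E.C M (η, θ) ≤ B := by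
  induction η generalizing θ with
  | nil =>
    refine ⟨((E.ie θ)⁻¹ * κ).toNNReal, fun M hM => ?_⟩
    rw [ENNReal.coe_toNNReal (ENNReal.mul_ne_top (ENNReal.inv_ne_top.2 (E.ie_ne_zero θ)) (by simp)),
      ← ENNReal.mul_le_iff_le_inv (E.ie_ne_zero θ) (E.ie_ne_top θ)]
    exact (Finset.single_le_sum (f := fun i => E.ie i * E.C M ([], i)) (fun _ _ => zero_le)
      (mem_univ θ)).trans hM
  | cons x η ih =>
    obtain ⟨φ, θ₀⟩ := x
    obtain ⟨h1, h2⟩ := onPath_cons.1 hp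
    obtain ⟨B, hB⟩ := ih h2
    obtain ⟨y, rfl⟩ := E.signal_surjective φ
    have ha0 : E.de * (E.pe θ₀ y * E.te θ₀ θ) ≠ 0 :=
      mul_ne_zero E.de_ne_zero (mul_ne_zero (E.pe_ne_zero _ _) ((E.te_ne_zero_iff _ _).2 h1))
    have hat : E.de * (E.pe θ₀ y * E.te θ₀ θ) ≠ ⊤ :=
      ENNReal.mul_ne_top E.de_ne_top (ENNReal.mul_ne_top (E.pe_ne_top _ _) (E.te_ne_top _ _))
    refine ⟨((E.de * (E.pe θ₀ y * E.te θ₀ θ))⁻¹ * B).toNNReal, fun M hM => ?_⟩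
    rw [ENNReal.coe_toNNReal (ENNReal.mul_ne_top (ENNReal.inv_ne_top.2 ha0) (by simp)),
      ← ENNReal.mul_le_iff_le_inv ha0 hat]
    by_cases hT : (η.length : ℕ∞) < E.T
    · refine le_trans ?_ (hB M hM)
      rw [E.C_rec M hT, mul_assoc]
      refine le_trans ?_ le_add_self
      gcongr
      exact Finset.single_le_sum (f := fun i : Y × Ty => E.pe θ₀ i.1 * E.te θ₀ i.2 *
        E.C M ((E.signal i.1, θ₀) :: η, i.2)) (fun _ _ => zero_le) (mem_univ (y, θ))
    · have hT' : ¬ ((((E.signal y, θ₀) :: η : Hist Φ).length : ℕ) : ℕ∞) < E.T := fun h =>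
        hT (lt_of_le_of_lt (by exact_mod_cast Nat.le_succ _) h)
      rw [C, J_of_not_lt _ _ _ hT', mul_zero]
      exact zero_le

theorem exists_consumption_le (κ : ℝ≥0) {η : Hist Φ} {θ : Ty} (hp : E.OnPath η θ)
    (hT : (η.length : ℕ∞) < E.T) (y : Y) :
    ∃ B : ℝ≥0, ∀ M : Mechanism Y Φ, E.cost M ≤ κ → M η θ y ≤ B := by
  obtain ⟨B, hB⟩ := exists_C_le κ hp
  refine ⟨((E.pe θ y)⁻¹ * B).toNNReal, fun M hM => ?_⟩
  rw [← ENNReal.coe_le_coe, ENNReal.coe_toNNReal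
    (ENNReal.mul_ne_top (ENNReal.inv_ne_top.2 (E.pe_ne_zero θ y)) (by simp)),
    ← ENNReal.mul_le_iff_le_inv (E.pe_ne_zero θ y) (E.pe_ne_top θ y)]
  refine le_trans ?_ (hB M hM)
  rw [E.C_rec M hT]
  refine le_trans ?_ le_self_add
  exact Finset.single_le_sum (f := fun y => E.pe θ y * (M η θ y : ℝ≥0∞)) (fun _ _ => zero_le)
    (mem_univ y)

open Classical in
/-- The mechanism that pays nothing off path and after the horizon. -/
def truncate (E : Env Y Φ) (M : Mechanism Y Φ) : Mechanism Y Φ := fun η θ =>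
  if E.OnPath η θ ∧ (η.length : ℕ∞) < E.T then M η θ else fullCoverage 0

theorem truncate_of_onPath {M : Mechanism Y Φ} {η : Hist Φ} {θ : Ty} (hp : E.OnPath η θ)
    (hT : (η.length : ℕ∞) < E.T) : E.truncate M η θ = M η θ :=
  if_pos ⟨hp, hT⟩

theorem J_truncate (f : ℝ≥0 → ℝ≥0) (M : Mechanism Y Φ) {η : Hist Φ} {θ : Ty}
    (hp : E.OnPath η θ) : E.J f (E.truncate M) (η, θ) = E.J f M (η, θ) :=
  J_congr_onPath (K := η) (fun _ _ => truncate_of_onPath) (s := (η, θ)) List.suffix_rfl hp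

theorem onPath_nil (θ : Ty) : E.OnPath [] θ := List.isChain_singleton _

theorem cost_truncate (M : Mechanism Y Φ) : E.cost (E.truncate M) = E.cost M := by
  unfold cost
  simp only [C, J_truncate id M (onPath_nil _)]

theorem onPath_high_low (h0 : E.te Ty.h Ty.l ≠ 0) {η : Hist Φ} (hη : AllHigh η) (θ : Ty) :
    E.OnPath η θ := by
  cases θ
  · cases η with
    | nil => exact onPath_nil _
    | cons x η =>
      obtain ⟨h1, h2⟩ := hη.of_cons
      obtain ⟨φ, θ⟩ := x
      obtain rfl : θ = Ty.h := h1
      exact onPath_cons.2 ⟨(E.te_ne_zero_iff _ _).1 h0, onPath_high h2⟩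
  · exact onPath_high hη

theorem feas_truncate {w : Ty → ℝ≥0∞} (h0 : E.te Ty.h Ty.l ≠ 0) {M : Mechanism Y Φ}
    (hM : E.Feas w M) : E.Feas w (E.truncate M) := by
  refine ⟨fun η hη hT => ?_, fun θ => ?_⟩
  · have h1 : E.dev (E.truncate M) η = E.dev M η := by
      rw [dev_eq, dev_eq]
      simp only [flow, truncate_of_onPath (onPath_high hη) hT, U,
        J_truncate E.ut M (onPath_high_low h0 (hη.cons _) _)]
    rw [h1, U, J_truncate E.ut M (onPath_high_low h0 hη _)]
    exact hM.osic η hη hT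
  · rw [U, J_truncate E.ut M (onPath_nil θ)]
    exact hM.delivers θ

theorem pret_truncate (M : Mechanism Y Φ) (θ : Ty) :
    E.pret (E.truncate M) ([], θ) = E.pret M ([], θ) := by
  refine Proc.tot_congr_on (p := E.proc 0 fun _ => Ty.h) (fun s => AllHigh s.1)
    (fun s i hs _ => hs.cons _) (fun s hs hT => ?_) allHigh_nil
  simp only [flow, truncate_of_onPath (onPath_high hs) (by simpa using hT)]

/-- Among the truncated mechanisms in a closed class that contains one of finite cost, some mechanism
has the least cost. -/
theorem exists_min_cost {A : Set (Mechanism Y Φ)} (hA : IsClosed A)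
    (htr : ∀ M ∈ A, E.truncate M ∈ A) {M₀ : Mechanism Y Φ} (hM₀ : M₀ ∈ A)
    (hfin : E.cost M₀ ≠ ⊤) : ∃ M ∈ A, E.cost M ≠ ⊤ ∧ ∀ N ∈ A, E.cost M ≤ E.cost N := by
  have hex : ∀ η θ y, ∃ B : ℝ≥0, ∀ M : Mechanism Y Φ, E.cost M ≤ (E.cost M₀).toNNReal →
      E.truncate M η θ y ≤ B := fun η θ y => by
    by_cases h : E.OnPath η θ ∧ (η.length : ℕ∞) < E.T
    · obtain ⟨B, hB⟩ := exists_consumption_le (E.cost M₀).toNNReal h.1 h.2 y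
      exact ⟨B, fun M hM => by rw [truncate_of_onPath h.1 h.2]; exact hB M hM⟩
    · exact ⟨0, fun M _ => by rw [truncate, if_neg h]; rfl⟩
  choose B hB using hex
  rw [ENNReal.coe_toNNReal hfin] at hB
  -- Cost controls consumption only on path; truncation puts zero elsewhere, so a product of compact
  -- intervals contains all truncated competitors that cost no more than `M₀`.
  set box : Set (Mechanism Y Φ) := Set.pi Set.univ fun η => Set.pi Set.univ fun θ =>
    Set.pi Set.univ fun y => Set.Icc 0 (B η θ y) with hbox
  have hcompact : IsCompact box := isCompact_univ_pi fun η => isCompact_univ_pi fun θ =>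
    isCompact_univ_pi fun y => isCompact_Icc
  have hmem : ∀ M, E.cost M ≤ E.cost M₀ → E.truncate M ∈ box := fun M hM η _ θ _ y _ =>
    ⟨zero_le, hB η θ y M hM⟩
  have hne : (box ∩ A).Nonempty := ⟨E.truncate M₀, hmem M₀ le_rfl, htr M₀ hM₀⟩
  obtain ⟨M, hM, hmin⟩ := LowerSemicontinuousOn.exists_isMinOn hne (hcompact.inter_right hA)
    ((cost_lowerSemicontinuous (E := E)).lowerSemicontinuousOn _)
  have hle : E.cost M ≤ E.cost M₀ := by
    exact (isMinOn_iff.1 hmin _ ⟨hmem M₀ le_rfl, htr M₀ hM₀⟩).trans_eq (cost_truncate M₀)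
  refine ⟨M, hM.2, ne_top_of_le_ne_top hfin hle, fun N hN => ?_⟩
  rcases le_total (E.cost N) (E.cost M₀) with h | h
  · exact (isMinOn_iff.1 hmin _ ⟨hmem N h, htr N hN⟩).trans_eq (cost_truncate N)
  · exact hle.trans h

/-- If high types may turn low, all states in the constraints are on path and truncation is
harmless. Otherwise the constraints are replaced by the single one that the initial low type does
not gain from always reporting high, and `pretend` restores the others. -/
theorem exists_opt (hb : E.T ≠ ⊤ ∨ BddAbove (E.u '' Set.Ici 0)) {w : Ty → ℝ≥0∞}
    {M₀ : Mechanism Y Φ} (hM₀ : E.Feas w M₀) (hfin : E.cost M₀ ≠ ⊤) : ∃ M, E.Opt w M := by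
  by_cases h0 : E.te Ty.h Ty.l = 0
  · obtain ⟨M, hM, hMfin, hmin⟩ := exists_min_cost
      (A := {M | (∀ θ, E.U M ([], θ) = w θ) ∧ E.pret M ([], Ty.l) ≤ E.U M ([], Ty.l)})
      (by
        refine IsClosed.and (p₁ := fun M => ∀ θ, E.U M ([], θ) = w θ) ?_
          (isClosed_le (tot_flow_continuous hb 0 _ _) (U_continuous hb _))
        rw [Set.ofPred_forall]
        exact isClosed_iInter fun θ => isClosed_eq (U_continuous hb _) continuous_const)
      (fun M hM => by
        refine ⟨fun θ => ?_, ?_⟩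
        · rw [U, J_truncate E.ut M (onPath_nil θ)]; exact hM.1 θ
        · rw [pret_truncate, U, J_truncate E.ut M (onPath_nil _)]; exact hM.2)
      ⟨hM₀.delivers, pret_le hM₀.osic allHigh_nil _⟩ hfin
    refine ⟨pretend M, feas_pretend h0 hM.1 hM.2, fun N hN => ?_, by rwa [cost_pretend h0]⟩
    rw [cost_pretend h0]
    exact hmin N ⟨hN.delivers, pret_le hN.osic allHigh_nil _⟩
  · obtain ⟨M, hM, hMfin, hmin⟩ := exists_min_cost (A := {M | E.Feas w M})
      ((isClosed_iInter fun η => isClosed_iInter fun (_ : AllHigh η) => isClosed_iInter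
          fun (_ : (η.length : ℕ∞) < E.T) =>
          isClosed_le (dev_continuous hb η) (U_continuous hb (η, Ty.l))).inter
        (isClosed_iInter fun θ => isClosed_eq (U_continuous hb ([], θ))
          (continuous_const (y := w θ))) |> fun h => by
          convert h using 1
          ext M
          simp only [Set.mem_ofPred_eq, Set.mem_inter_iff, Set.mem_iInter]
          exact ⟨fun h => ⟨h.osic, h.delivers⟩, fun h => ⟨h.1, h.2⟩⟩)
      (fun M hM => feas_truncate h0 hM) hM₀ hfin
    exact ⟨M, hM, hmin, hMfin⟩

end Env

end

end Insurance

/-! ### Return to extended-real payoffs and conclusion -/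

namespace Insurance

noncomputable section

namespace Env

variable {Y Φ : Type*} [Fintype Y] [Fintype Φ] {E : Env Y Φ}

theorem V_lt_iff {M M' : Mechanism Y Φ} {η η' : Hist Φ} {θ θ' : Ty} (h : η.length = η'.length) :
    E.V M η θ < E.V M' η' θ' ↔ E.U M (η, θ) < E.U M' (η', θ') := by
  rw [← not_le, ← not_le, E.V_le_iff h.symm]

theorem V_of_ne_top {M : Mechanism Y Φ} {η : Hist Φ} {θ : Ty} (h : E.U M (η, θ) ≠ ⊤) :
    E.V M η θ = ((E.lowest η.length + (E.U M (η, θ)).toReal : ℝ) : EReal) := by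
  rw [V_eq, EReal.coe_add, EReal.coe_ennreal_toReal h]

theorem avg_V {M : Mechanism Y Φ} {η : Hist Φ} (h : ∀ θ, E.U M (η, θ) ≠ ⊤) (θ : Ty) :
    (E.trans θ Ty.h : EReal) * E.V M η Ty.h + (E.trans θ Ty.l : EReal) * E.V M η Ty.l =
      ((E.lowest η.length + (E.avg θ fun θ' => E.U M (η, θ')).toReal : ℝ) : EReal) := by
  rw [V_of_ne_top (h _), V_of_ne_top (h _), avg_toReal θ h, ← EReal.coe_mul, ← EReal.coe_mul,
    ← EReal.coe_add, EReal.coe_eq_coe_iff]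
  have := E.trans_sum θ
  rw [Ty.sum_eq] at this
  linear_combination (E.lowest η.length) * this

theorem exists_feas_of_mem_feasible {W : Ty → ℝ} (hW : W ∈ E.feasible) :
    (∀ θ, E.lowest 0 ≤ W θ) ∧ ∃ M, E.Feas (E.excess W) M ∧ E.cost M ≠ ⊤ := by
  obtain ⟨M, hic, hprofit, hd⟩ := hW
  have hlow := E.lowest_le_of_delivers hd
  obtain ⟨N, hN, hcost⟩ := exists_feas_of_ic (E.excess_ne_top W) hic
    fun θ => (E.V_nil_eq_iff (hlow θ)).1 (hd θ)
  exact ⟨hlow, N, hN, by rw [hcost]; exact E.profit_ne_bot_iff.1 hprofit⟩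

theorem Opt.osicBinds {w : Ty → ℝ≥0∞} (hw : ∀ θ, w θ ≠ ⊤) (hlt : w Ty.l < w Ty.h)
    {M : Mechanism Y Φ} (hM : E.Opt w M) : E.OSICBinds M := by
  intro H hH hT
  rw [E.osicBinds_iff_at hH hT]
  have hη := E.allHigh_pub hH
  have hT' : ((E.pub H).length : ℕ∞) < E.T := by rwa [E.pub_length]
  rcases hM.typeReward hw hlt hη hT' with h | ⟨h, -⟩
  · exact hM.binds hw hη hT' h
  · have := hM.feas.osic _ hη hT'
    rw [h] at this ⊢
    exact le_antisymm this zero_le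

theorem Opt.satisfies_typeReward {w : Ty → ℝ≥0∞} (hw : ∀ θ, w θ ≠ ⊤) (hlt : w Ty.l < w Ty.h)
    {M : Mechanism Y Φ} (hM : E.Opt w M) : E.TypeReward M := by
  intro η hη hT
  rw [V_lt_iff rfl, V_eq_leastV_iff, V_eq_leastV_iff]
  exact hM.typeReward hw hlt hη hT

theorem U_next_eq_zero {M : Mechanism Y Φ} {η : Hist Φ} (hT : (η.length : ℕ∞) < E.T)
    (h : E.U M (η, Ty.h) = 0) {θ : Ty} (hθ : E.te Ty.h θ ≠ 0) (φ : Φ) :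
    E.U M ((φ, Ty.h) :: η, θ) = 0 := by
  obtain ⟨y, rfl⟩ := E.signal_surjective φ
  rw [E.U_rec M hT, add_eq_zero, mul_eq_zero, Finset.sum_eq_zero_iff] at h
  have := (h.2.resolve_left E.de_ne_zero) (y, θ) (mem_univ _)
  exact (mul_eq_zero.1 this).resolve_left (mul_ne_zero (E.pe_ne_zero _ _) hθ)

theorem Opt.satisfies_signalEffect {w : Ty → ℝ≥0∞} (hw : ∀ θ, w θ ≠ ⊤) (hlt : w Ty.l < w Ty.h)
    {M : Mechanism Y Φ} (hM : E.Opt w M) : E.SignalEffect M := by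
  intro η hη hT φ φ' hlr
  have hT' : (η.length : ℕ∞) < E.T := lt_of_le_of_lt (by exact_mod_cast Nat.le_succ _) hT
  have hU := fun φ θ => hM.feas.U_ne_top hw (hη.cons φ) θ
  rw [avg_V (hU φ), avg_V (hU φ'), EReal.coe_le_coe_iff]
  simp only [List.length_cons]
  gcongr
  · exact avg_ne_top _ (hU φ')
  rcases hM.typeReward hw hlt hη hT' with h | ⟨hl, hh⟩
  · exact hM.signalEffect hw hη h hT' hlr
  -- Both averages vanish: the high type's utility is zero after every signal, and the type reward
  -- then forces the low type's to be zero.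
  · have hzero : ∀ ψ θ, E.U M ((ψ, Ty.h) :: η, θ) = 0 := fun ψ θ => by
      have h1 := U_next_eq_zero hT' hh (E.te_self_ne_zero Ty.h) ψ
      rcases hM.typeReward hw hlt (hη.cons ψ) (by simpa using hT) with h | ⟨h2, -⟩
      · rw [h1] at h
        exact absurd h not_lt_zero
      · cases θ
        · exact h2
        · exact h1
    simp only [hzero, le_refl]

end Env

end

end Insurance

open Insurance Env
theorem mainTheorem1 {Y Φ : Type*} [Fintype Y] [Fintype Φ] (E : Env Y Φ)
    (W : Ty → ℝ) (hW : W ∈ E.feasible) :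
    -- existence of a solution to the relaxed problem
    ((E.T ≠ ⊤ ∨ BddAbove (E.u '' Set.Ici 0)) → ∃ M, E.SolvesRelaxed W M) ∧
    -- uniqueness, at all histories of positive probability
    (∀ M M', E.SolvesRelaxed W M → E.SolvesRelaxed W M' → E.AgreeOnPath M M') ∧
    -- properties of the solution
    (W Ty.l < W Ty.h → ∀ M, E.SolvesRelaxed W M →
      E.OSICBinds M ∧ E.FullCoverageAfterLow M ∧
      (∃ μ lam : List Φ → ℝ, (∀ σ, 0 ≤ lam σ) ∧ E.InverseMarginal M μ lam) ∧
      E.TypeReward M ∧ E.SignalEffect M) ∧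
    -- a bounded solution of the relaxed problem is optimal
    (W Ty.l ≤ W Ty.h → ∀ M, E.SolvesRelaxed W M → E.Bounded M →
      (∃ M', E.AgreeOnPath M M' ∧ E.SolvesRelaxed W M' ∧ E.SolvesFirm W M') ∧
      ((∀ i j, 0 < E.trans i j) → E.SolvesFirm W M)) := by
  obtain ⟨hlow, M₀, hM₀, hfin⟩ := exists_feas_of_mem_feasible hW
  have hw := E.excess_ne_top W
  have hiff : ∀ {M}, E.SolvesRelaxed W M ↔ E.Opt (E.excess W) M :=
    E.solvesRelaxed_iff hlow ⟨M₀, hM₀, hfin⟩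
  simp only [hiff]
  refine ⟨fun hb => exists_opt hb hM₀ hfin, fun M M' hM hM' => hM.agreeOnPath hM',
    fun hlt M hM => ?_, fun hle M hM _ => ?_⟩
  · have hwlt : E.excess W Ty.l < E.excess W Ty.h := by
      have := hlow Ty.l
      exact (ENNReal.ofReal_lt_ofReal_iff (by linarith)).2 (by linarith)
    exact ⟨hM.osicBinds hw hwlt, hM.fullCoverageAfterLow hw, hM.inverseMarginal,
      hM.satisfies_typeReward hw hwlt, hM.satisfies_signalEffect hw hwlt⟩
  · obtain ⟨M', hM', hic⟩ := hM.exists_ic hw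
      (ENNReal.ofReal_le_ofReal (sub_le_sub_right hle _))
    -- If all transitions are possible, every history is on path; `M` then equals the incentive
    -- compatible optimum `M'` before the horizon and inherits its incentive compatibility.
    have hagree := hM.agreeOnPath hM'
    refine ⟨⟨M', hagree, hM', hM'.solvesFirm hlow hic⟩, fun hpos => hM.solvesFirm hlow ?_⟩
    exact ic_congr (fun η θ hT => hagree η θ hT (onPath_of_pos hpos η θ)) hic
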